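/- Let $k$ be an algebraically closed field of characteristic $2$, let $\omega\in k$ satisfy $\omega^2+\omega+1=0$, and let $A_4\le A_5$ be the stabiliser of the point $5$. Modules are left modules; $\operatorname{rad}M$ is the intersection of the maximal submodules of $M$, $\operatorname{soc}M$ is the sum of its simple submodules, the radical layers of $M$ are the quotients $\operatorname{rad}^{n}M/\operatorname{rad}^{n+1}M$ ($n=0,1,\dots$, where $\operatorname{rad}^0M=M$ and $\operatorname{rad}^{n+1}M=\operatorname{rad}(\operatorname{rad}^nM)$), the head is $M/\operatorname{rad}M$, and $M$ is uniserial if its submodules are linearly ordered by inclusion. Let $S_1=k$ be the trivial $kA_5$-module and let $S_4\subseteq k^5$ be the submodule of vectors with coordinate sum $0$ in the permutation module. There is a representation $S_2:A_5\to \mathrm{SL}_2(k)$ that permutes the five lines of $k^2$ spanned by $(1,1),(1,\omega),(1,\omega^2),(1,0),(0,1)$ as $A_5$ permutes $1,2,3,4,5$; let $S_3$ be the one obtained by replacing $\omega$ by $\omega^2$. There are one-dimensional $kA_4$-modules $T_2,T_3$ on which $(1,2,3)$ acts by $\omega$, $\omega^2$ respectively; let $T_2^{A_5},T_3^{A_5}$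 be the induced $kA_5$-modules. Then the following hold. 1. $S_1,S_2,S_3,S_4$ are simple, of dimensions $1,2,2,4$, pairwise non-isomorphic, and every simple $kA_5$-module is isomorphic to one of them. 2. There are left ideals $P_1,P_2,P_3,P_4$ of $kA_5$, of dimensions $12,8,8,4$, that are projective indecomposable modules, pairwise non-isomorphic, such that $P_i$ has head isomorphic to $S_i$ and every finitely generated projective indecomposable $kA_5$-module is isomorphic to one of them, and as left modules $$kA_5\cong P_1\oplus P_2^{2}\oplus P_3^{2}\oplus P_4^{4}.$$ 3. $P_4\cong S_4$. $P_2$ is uniserial with radical layers $S_2,S_1,S_3,S_1,S_2$ (from the top), and $P_3$ is uniserial with radical layers $S_3,S_1,S_2,S_1,S_3$. 4. $T_2^{A_5}$ is uniserial with radical layers $S_3,S_1,S_2$, and $T_3^{A_5}$ is uniserial with radical layers $S_2,S_1,S_3$. 5. $\operatorname{soc}P_1\cong S_1$, $\operatorname{soc}P_1\subseteq\operatorname{rad}P_1$, $\operatorname{rad}P_1/\operatorname{soc}P_1\cong T_2^{A_5}\oplus T_3^{A_5}$, and the radical layers of $P_1$ are $S_1,\;S_3\oplus S_2,\;S_1\oplus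 S_1,\;S_2\oplus S_3,\;S_1$. 6. The Cartan matrix, whose $(i,j)$ entry is the multiplicity of $S_i$ as a composition factor of $P_j$, is $$\begin{pmatrix}4&2&2&0\\2&2&1&0\\2&1&2&0\\0&0&0&1\end{pmatrix}.$$ 7. $kA_5$ has exactly two blocks, i.e. exactly two ideals $kA_5e$ with $e$ a primitive idempotent of the centre. They are $kA_5e_1$ and $kA_5e_2$ with block idempotents satisfying $e_1e_2=0$, $e_1+e_2=1$, so that $kA_5=kA_5e_1\oplus kA_5e_2$; $P_1,P_2,P_3$ and the trivial module belong to $kA_5e_1$ and $P_4$ belongs to $kA_5e_2$ (where $M$ belongs to $kA_5e$ if $e$ acts as the identity on $M$). If $1=\sum_t f_t$ is any finite decomposition into orthogonal primitive idempotents of $kA_5$, then $e_1$ is the sum of the $f_t$ with $kA_5f_t$ isomorphic to $P_1$, $P_2$ or $P_3$, and $e_2$ is the sum of the $f_t$ with $kA_5f_t\cong P_4$. -/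

import Mathlib

open scoped MonoidAlgebra

universe u v

/-! ### Modules over a ring -/

section Modules

variable (A : Type*) [Ring A] (M : Type*) [AddCommGroup M] [Module A M]

/-- A nonzero module that is not the direct sum of two nonzero submodules. -/
def IsIndecomposableModule : Prop :=
  Nontrivial M ∧ ∀ N N' : Submodule A M, IsCompl N N' → N = ⊥ ∨ N' = ⊥

/-- The submodules are linearly ordered by inclusion. -/
def IsUniserialModule : Prop :=
  ∀ N N' : Submodule A M, N ≤ N' ∨ N' ≤ N

/-- The socle: the sum of all simple submodules. -/
def moduleSocle : Submodule A M :=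
  sSup {N : Submodule A M | IsSimpleModule A N}

/-- The radical series `rad⁰ M = M`, `radⁿ⁺¹ M = rad (radⁿ M)`; here `Module.jacobson` is the
intersection of all maximal submodules. -/
def radSeries : ℕ → Submodule A M
  | 0 => ⊤
  | n + 1 => (Module.jacobson A (radSeries n)).map (radSeries n).subtype

/-- The radical layer `radⁿ M / radⁿ⁺¹ M`; for `n = 0` this is the head of `M`. -/
abbrev RadLayer (n : ℕ) : Type _ :=
  radSeries A M n ⧸ (radSeries A M (n + 1)).submoduleOf (radSeries A M n)

/-- The heart `rad M / soc M` (meant for modules with `soc M ≤ rad M`). -/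
abbrev ModuleHeart : Type _ :=
  Module.jacobson A M ⧸ (moduleSocle A M).submoduleOf (Module.jacobson A M)

/-- `M` has a composition series, and in each composition series of `M` exactly `n` of the
factors are isomorphic to `S`. -/
def HasMultiplicity (S : Type*) [AddCommGroup S] [Module A S] (n : ℕ) : Prop :=
  (∃ s : CompositionSeries (Submodule A M), s.head = ⊥ ∧ s.last = ⊤) ∧
  ∀ s : CompositionSeries (Submodule A M), s.head = ⊥ → s.last = ⊤ →
    Nat.card {t : Fin s.length //
      Nonempty ((s t.succ ⧸ (s t.castSucc).submoduleOf (s t.succ)) ≃ₗ[A] S)} = n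

end Modules

/-! ### Idempotents and blocks -/

section Blocks

/-- A nonzero idempotent that is not the sum of two nonzero orthogonal idempotents. -/
def IsPrimitiveIdempotent {R : Type*} [Ring R] (e : R) : Prop :=
  IsIdempotentElem e ∧ e ≠ 0 ∧
  ∀ f g : R, IsIdempotentElem f → IsIdempotentElem g → f * g = 0 → g * f = 0 →
    e = f + g → f = 0 ∨ g = 0

/-- A block idempotent of `A`: a primitive idempotent of the centre of `A`. -/
def IsBlockIdempotent {A : Type*} [Ring A] (e : A) : Prop :=
  ∃ z : Subring.center A, (z : A) = e ∧ IsPrimitiveIdempotent z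

/-- The blocks of `A`: the ideals `A e` with `e` a block idempotent. -/
def blocks (A : Type*) [Ring A] : Set (Ideal A) :=
  {B | ∃ e : A, IsBlockIdempotent e ∧ B = Ideal.span {e}}

end Blocks

/-! ### The groups `A₅` and `A₄` and their modules; the points `1, …, 5` are `0, …, 4 : Fin 5` -/

/-- The alternating group on five points. -/
abbrev A5 : Type := alternatingGroup (Fin 5)

/-- The alternating group on four points, as the stabiliser of the last point in `A₅`. -/
abbrev A4 : Subgroup A5 := MulAction.stabilizer A5 (4 : Fin 5)

/-- The cycle `(1,2,3)` as an element of `A₅`. -/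
def cycle123 : A5 :=
  ⟨Equiv.swap 0 1 * Equiv.swap 1 2, by rw [Equiv.Perm.mem_alternatingGroup]; decide⟩

/-- The cycle `(1,2,3)` as an element of `A₄`. -/
def cycle123' : A4 :=
  ⟨cycle123, by rw [MulAction.mem_stabilizer_iff]; decide⟩

section Representations

variable {k : Type*} [Field k]

/-- Spanning vectors of five lines in `k²`; for `ω` a primitive cube root of unity in
characteristic `2` they represent the five points of the projective line over `𝔽₄ = {0,1,ω,ω²}`. -/
def linePoint (ω : k) : Fin 5 → Fin 2 → k :=
  ![![1, 1], ![1, ω], ![1, ω ^ 2], ![1, 0], ![0, 1]]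

/-- `ρ` is the two-dimensional representation of `A₅` by matrices of determinant one that permute
the five lines spanned by `linePoint ω` in the way `A₅` permutes the five points. -/
def IsProjectiveLineRep (ω : k) (ρ : Representation k A5 (Fin 2 → k)) : Prop :=
  (∀ g : A5, LinearMap.det (ρ g) = 1) ∧
  ∀ (g : A5) (i : Fin 5), ∃ c : k,
    ρ g (linePoint ω i) = c • linePoint ω ((g : Equiv.Perm (Fin 5)) i)

variable (k) in
/-- The permutation representation of `A₅` on `k⁵`. -/
def permRep : Representation k A5 (Fin 5 → k) where
  toFun g := LinearMap.funLeft k k ((g⁻¹ : A5) : Equiv.Perm (Fin 5))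
  map_one' := by ext; simp
  map_mul' g h := by ext; simp [LinearMap.funLeft]

variable (k) in
/-- The vectors with coordinate sum zero, as a subrepresentation of the permutation
representation. -/
def sumZeroSubrep : Subrepresentation (permRep k) where
  toSubmodule := LinearMap.ker (∑ i : Fin 5, LinearMap.proj (R := k) (φ := fun _ => k) i)
  apply_mem_toSubmodule g v hv := by
    simp only [LinearMap.mem_ker, LinearMap.sum_apply, LinearMap.proj_apply] at hv ⊢
    rw [← hv]
    exact Equiv.sum_comp ((g⁻¹ : A5) : Equiv.Perm (Fin 5)) v

/-- The four representations `S₁` (trivial), `S₂`, `S₃` (given), `S₄` (coordinate sum zero). -/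
noncomputable def fourReps (ρ₂ ρ₃ : Representation k A5 (Fin 2 → k)) : Fin 4 → Rep k A5 :=
  ![Rep.of (Representation.trivial k A5 k), Rep.of ρ₂, Rep.of ρ₃,
    Rep.of (sumZeroSubrep k).toRepresentation]

/-- The `k A₅`-module induced from a representation of `A₄`. -/
abbrev IndA5 {V : Type*} [AddCommGroup V] [Module k V] (τ : Representation k A4 V) : Type _ :=
  (Representation.ind A4.subtype τ).asModule

end Representations

/-- The matrix of Cartan invariants of `k A₅` in characteristic two. -/
def cartanA5 : Matrix (Fin 4) (Fin 4) ℕ :=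
  !![4, 2, 2, 0;
     2, 2, 1, 0;
     2, 1, 2, 0;
     0, 0, 0, 1]

/-!
The proof exhibits in `k[A₅]` nine orthogonal idempotents with sum `1`, in four classes of sizes
`1, 2, 2, 4` under conjugation, and arrows `α, β, γ, δ` between their representatives such that
`αβ = 0`, `γδ = 0`, `βαδγ = δγβα`, while `δγβα`, `αδγβ` and `γβαδ` do not vanish. The nonvanishing
makes the nonzero paths linearly independent, so that the dimensions of the spaces `eᵢ A eⱼ` are
at least the Cartan invariants. Weighted with the sizes of the classes, the Cartan invariants add up
to `60 = dim A`, hence the paths are bases, and the submodule structure of the projective modules is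
read off from them. An induced module has dimension five and is generated by a homogeneous vector;
this determines it as a quotient of a uniserial projective module.

All the elements have coefficients in the subfield with four elements generated by `ω`, so that the
required identities are decided by computing with `60` pairs of binary digits.
-/

/-- A decomposition `1 = ∑ₚ uₚ vₚ` of the unit of a ring into orthogonal idempotents, where `uₚ vₚ`
is isomorphic to `e (σ p)` and the representatives `e i` are themselves among the summands. -/
structure IdempotentFrame (A : Type*) [Ring A] {P I : Type*} [Fintype P] [DecidableEq P]
    (σ : P → I) where
  e : I → A
  u : P → A
  v : P → A
  /-- the position of the representatives -/
  base : I → P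
  σ_base : ∀ i, σ (base i) = i
  u_base : ∀ i, u (base i) = e i
  v_base : ∀ i, v (base i) = e i
  v_mul_u : ∀ p q, v p * u q = if p = q then e (σ p) else 0
  sum_u_mul_v : ∑ p, u p * v p = 1

namespace IdempotentFrame

section Ring

variable {A : Type*} [Ring A] {P I : Type*} [Fintype P] [DecidableEq P] {σ : P → I}
  (F : IdempotentFrame A σ)

lemma u_mul_e (p : P) : F.u p * F.e (σ p) = F.u p := by
  conv_rhs => rw [← one_mul (F.u p), ← F.sum_u_mul_v, Finset.sum_mul]
  simp [mul_assoc, F.v_mul_u]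

lemma e_mul_v (p : P) : F.e (σ p) * F.v p = F.v p := by
  conv_rhs => rw [← mul_one (F.v p), ← F.sum_u_mul_v, Finset.mul_sum]
  simp [← mul_assoc, F.v_mul_u]

lemma e_mul_e (i : I) : F.e i * F.e i = F.e i := by
  simpa [F.u_base, F.σ_base] using F.u_mul_e (F.base i)

variable {M : Type*} [AddCommGroup M] [Module A M]

lemma sum_u_smul_v_smul (m : M) : ∑ p, F.u p • F.v p • m = m := by
  simp_rw [← mul_smul, ← Finset.sum_smul, F.sum_u_mul_v, one_smul]

lemma e_smul_v_smul (p : P) (m : M) : F.e (σ p) • F.v p • m = F.v p • m := by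
  rw [← mul_smul, F.e_mul_v]

lemma exists_v_smul_ne_zero {m : M} (hm : m ≠ 0) : ∃ p, F.v p • m ≠ 0 := by
  by_contra! h
  exact hm (by rw [← F.sum_u_smul_v_smul m]; simp [h])

lemma mem_of_v_smul_mem {N : Submodule A M} {m : M} (h : ∀ p, F.v p • m ∈ N) : m ∈ N := by
  rw [← F.sum_u_smul_v_smul m]
  exact N.sum_mem fun p _ => N.smul_mem _ (h p)

lemma mem_ideal_of_v_mul_mem {N : Ideal A} {a : A} (h : ∀ p, F.v p * a ∈ N) : a ∈ N :=
  F.mem_of_v_smul_mem h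

lemma exists_homogeneous [Nontrivial M] : ∃ (i : I) (x : M), x ≠ 0 ∧ F.e i • x = x := by
  obtain ⟨m, hm⟩ := exists_ne (0 : M)
  obtain ⟨p, hp⟩ := F.exists_v_smul_ne_zero hm
  exact ⟨σ p, F.v p • m, hp, F.e_smul_v_smul p m⟩

lemma exists_homogeneous_mem {N : Submodule A M} (hN : N ≠ ⊥) :
    ∃ (i : I) (x : M), x ∈ N ∧ x ≠ 0 ∧ F.e i • x = x := by
  obtain ⟨m, hm, hm0⟩ := N.exists_mem_ne_zero_of_ne_bot hN
  obtain ⟨p, hp⟩ := F.exists_v_smul_ne_zero hm0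
  exact ⟨σ p, F.v p • m, N.smul_mem _ hm, hp, F.e_smul_v_smul p m⟩

/-- `M` is simple and is not annihilated by `e i`. -/
def IsTop (i : I) (M : Type*) [AddCommGroup M] [Module A M] : Prop :=
  IsSimpleModule A M ∧ ∃ x : M, x ≠ 0 ∧ F.e i • x = x

variable {F} in
lemma IsTop.congr {i : I} {N : Type*} [AddCommGroup N] [Module A N]
    (h : F.IsTop i M) (f : M ≃ₗ[A] N) : F.IsTop i N := by
  obtain ⟨h, x, hx, hx'⟩ := h
  refine ⟨IsSimpleModule.congr f.symm, f x, by simpa using hx, ?_⟩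
  rw [← map_smul, hx']

lemma exists_isTop [IsSimpleModule A M] : ∃ i, F.IsTop i M := by
  have := IsSimpleModule.nontrivial A M
  obtain ⟨i, x, hx⟩ := F.exists_homogeneous (M := M)
  exact ⟨i, ‹_›, x, hx⟩

end Ring

section Dimension

variable {k A : Type*} [Field k] [Ring A] [Algebra k A] {P I : Type*} [Fintype P] [DecidableEq P]
  {σ : P → I} (F : IdempotentFrame A σ)
  {M : Type*} [AddCommGroup M] [Module k M] [Module A M]
  [IsScalarTower k A M]

variable (k M) in
/-- The subspace `e i • M`. -/
def part (i : I) : Submodule k M :=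
  have : SMulCommClass k A M := IsScalarTower.to_smulCommClass
  LinearMap.eqLocus (Module.toModuleEnd k (S := A) M (F.e i)) LinearMap.id

variable {F} in
lemma mem_part {i : I} {m : M} : m ∈ F.part k M i ↔ F.e i • m = m := Iff.rfl

lemma e_smul_mem_part (i : I) (m : M) : F.e i • m ∈ F.part k M i := by
  rw [mem_part, ← mul_smul, F.e_mul_e]

lemma v_smul_mem_part (p : P) (m : M) : F.v p • m ∈ F.part k M (σ p) := F.e_smul_v_smul p m

lemma v_smul_u_smul {p q : P} {m : M} (hm : m ∈ F.part k M (σ q)) :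
    F.v p • F.u q • m = if p = q then m else 0 := by
  rw [← mul_smul, F.v_mul_u]
  split_ifs with h
  · subst h; exact hm
  · exact zero_smul _ _

variable (k M) in
/-- A module is the direct sum of copies of its homogeneous parts. -/
def partEquiv : M ≃ₗ[k] (Π p, F.part k M (σ p)) :=
  have : SMulCommClass k A M := IsScalarTower.to_smulCommClass
  { toFun := fun m p => ⟨F.v p • m, F.v_smul_mem_part p m⟩
    map_add' := fun x y => by ext; simp
    map_smul' := fun c x => funext fun p => Subtype.ext (smul_comm (F.v p) c x)
    invFun := fun x => ∑ p, F.u p • (x p : M)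
    left_inv := F.sum_u_smul_v_smul
    right_inv := fun x => by
      ext p
      simp only [Finset.smul_sum]
      rw [Finset.sum_eq_single p]
      · rw [F.v_smul_u_smul (x p).2, if_pos rfl]
      · intro q _ hq
        rw [F.v_smul_u_smul (x q).2, if_neg hq.symm]
      · simp }

lemma finrank_eq_sum [Module.Finite k M] :
    Module.finrank k M = ∑ p, Module.finrank k (F.part k M (σ p)) := by
  rw [(F.partEquiv k M).finrank_eq, Module.finrank_pi_fintype]

lemma finrank_part_pos [Module.Finite k M] {i : I} {x : M} (hx : x ≠ 0) (hi : F.e i • x = x) :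
    0 < Module.finrank k (F.part k M i) := by
  rw [Module.finrank_pos_iff]
  exact ⟨⟨⟨x, hi⟩, 0, by simpa [Subtype.ext_iff] using hx⟩⟩

variable [DecidableEq I]

variable (σ) in
/-- The dimension of the simple module with label `i`. -/
def dim (i : I) : ℕ := Fintype.card {p // σ p = i}

lemma dim_pos (F : IdempotentFrame A σ) (i : I) : 0 < dim σ i :=
  Fintype.card_pos_iff.mpr ⟨⟨F.base i, F.σ_base i⟩⟩

variable (k M) in
lemma dim_mul_finrank_part (i : I) : dim σ i * Module.finrank k (F.part k M i) =
    ∑ p with σ p = i, Module.finrank k (F.part k M (σ p)) := by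
  rw [dim, Fintype.card_subtype, ← smul_eq_mul, ← Finset.sum_const]
  exact Finset.sum_congr rfl fun p hp => by rw [(Finset.mem_filter.mp hp).2]

variable (k M) in
lemma finrank_eq_sum_dim [Fintype I] [Module.Finite k M] :
    Module.finrank k M = ∑ i, dim σ i * Module.finrank k (F.part k M i) := by
  simp_rw [F.dim_mul_finrank_part k M]
  rw [F.finrank_eq_sum, ← Finset.sum_fiberwise (s := Finset.univ) (g := σ)]

lemma dim_le_finrank [Module.Finite k M] {i : I} {x : M} (hx : x ≠ 0) (hi : F.e i • x = x) :
    dim σ i ≤ Module.finrank k M := by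
  refine (Nat.le_mul_of_pos_right _ (F.finrank_part_pos (k := k) hx hi)).trans ?_
  rw [F.dim_mul_finrank_part k M, F.finrank_eq_sum]
  exact Finset.sum_le_sum_of_subset (Finset.subset_univ _)

lemma dim_add_dim_le_finrank [Module.Finite k M] {i j : I} (hij : i ≠ j) {x y : M}
    (hx : x ≠ 0) (hi : F.e i • x = x) (hy : y ≠ 0) (hj : F.e j • y = y) :
    dim σ i + dim σ j ≤ Module.finrank k M := by
  refine (Nat.add_le_add (Nat.le_mul_of_pos_right _ (F.finrank_part_pos (k := k) hx hi))
    (Nat.le_mul_of_pos_right _ (F.finrank_part_pos (k := k) hy hj))).trans ?_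
  rw [F.dim_mul_finrank_part k M, F.dim_mul_finrank_part k M, ← Finset.sum_union, F.finrank_eq_sum]
  · exact Finset.sum_le_sum_of_subset (Finset.subset_univ _)
  · rw [Finset.disjoint_filter]
    rintro p - rfl h
    exact hij h

end Dimension

end IdempotentFrame

section Tower

variable {k A M : Type*} [Field k] [Ring A] [Algebra k A] [AddCommGroup M] [Module k M] [Module A M]
  [IsScalarTower k A M] [Module.Finite k M]

variable (k)

lemma finite_of_tower (N : Submodule A M) : Module.Finite k N :=
  inferInstanceAs (Module.Finite k (N.restrictScalars k))

lemma eq_of_le_of_finrank_le_of_tower {N N' : Submodule A M} (h : N ≤ N')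
    (h' : Module.finrank k N' ≤ Module.finrank k N) : N = N' :=
  Submodule.restrictScalars_injective k A M <|
    Submodule.eq_of_le_of_finrank_le (S₁ := N.restrictScalars k) (S₂ := N'.restrictScalars k) h h'

lemma finrank_mono_of_tower {N N' : Submodule A M} (h : N ≤ N') :
    Module.finrank k N ≤ Module.finrank k N' :=
  Submodule.finrank_mono (s := N.restrictScalars k) (t := N'.restrictScalars k) h

lemma finrank_quotient_add_of_tower (N : Submodule A M) :
    Module.finrank k (M ⧸ N) + Module.finrank k N = Module.finrank k M :=
  Submodule.finrank_quotient_add_finrank (N.restrictScalars k)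

lemma finrank_submoduleOf_add {N N' : Submodule A M} (h : N ≤ N') :
    Module.finrank k (N' ⧸ N.submoduleOf N') + Module.finrank k N = Module.finrank k N' := by
  have := finite_of_tower k N'
  rw [← finrank_quotient_add_of_tower k (N.submoduleOf N')]
  congr 1
  exact ((Submodule.submoduleOfEquivOfLe h).restrictScalars k).symm.finrank_eq

end Tower

namespace IdempotentFrame

section Simple

variable {k A : Type*} [Field k] [Ring A] [Algebra k A] {P I : Type*} [Fintype P] [DecidableEq P]
  {σ : P → I} (F : IdempotentFrame A σ)
  {M : Type*} [AddCommGroup M] [Module k M] [Module A M]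
  [IsScalarTower k A M]

variable (k) in
lemma isTop_of_finrank_eq [DecidableEq I] [Module.Finite k M] {i : I} {x : M} (hx : x ≠ 0)
    (hi : F.e i • x = x) (h : Module.finrank k M = dim σ i) : F.IsTop i M := by
  refine ⟨?_, x, hx, hi⟩
  have : Nontrivial M := ⟨⟨x, 0, hx⟩⟩
  refine { eq_bot_or_eq_top := fun N => or_iff_not_imp_left.mpr fun hN => ?_ }
  obtain ⟨j, y, hyN, hy, hj⟩ := F.exists_homogeneous_mem hN
  have hij : j = i := by
    by_contra hij
    have := F.dim_add_dim_le_finrank (k := k) hij hy hj hx hi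
    have := F.dim_pos j
    omega
  subst hij
  refine eq_of_le_of_finrank_le_of_tower k le_top ?_
  rw [show Module.finrank k (⊤ : Submodule A M) = Module.finrank k M from
    (Submodule.topEquiv.restrictScalars k).finrank_eq, h]
  have := finite_of_tower k N
  exact F.dim_le_finrank (k := k) (M := N) (x := ⟨y, hyN⟩) (by simpa [Subtype.ext_iff] using hy)
    (by ext; simpa using hj)

lemma finrank_part_quotient_add [Module.Finite k M] (N : Submodule A M) (i : I) :
    Module.finrank k (F.part k (M ⧸ N) i) + Module.finrank k (F.part k N i) =
      Module.finrank k (F.part k M i) := by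
  let f : F.part k M i →ₗ[k] F.part k (M ⧸ N) i :=
    ((N.mkQ.restrictScalars k).domRestrict (F.part k M i)).codRestrict _ fun x => by
      rw [mem_part]
      simpa using congrArg N.mkQ x.2
  have hf : Function.Surjective f := by
    rintro ⟨y, hy⟩
    obtain ⟨m, rfl⟩ := N.mkQ_surjective y
    refine ⟨⟨F.e i • m, F.e_smul_mem_part i m⟩, Subtype.ext ?_⟩
    exact hy
  have g : F.part k N i ≃ₗ[k] LinearMap.ker f :=
    { toFun := fun x => ⟨⟨x, congrArg Subtype.val x.2⟩, by
        rw [LinearMap.mem_ker]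
        ext
        simp [f]⟩
      map_add' := fun _ _ => rfl
      map_smul' := fun _ _ => rfl
      invFun := fun x => ⟨⟨x, by
        exact (Submodule.Quotient.mk_eq_zero N).mp
          (congrArg Subtype.val (LinearMap.mem_ker.mp x.2))⟩, Subtype.ext x.1.2⟩
      left_inv := fun _ => rfl
      right_inv := fun _ => rfl }
  rw [g.finrank_eq, ← LinearMap.finrank_range_add_finrank_ker f, LinearMap.range_eq_top.mpr hf,
    finrank_top]

lemma finrank_part_congr {N : Type*} [AddCommGroup N] [Module k N] [Module A N]
    [IsScalarTower k A N] (f : M ≃ₗ[A] N) (i : I) :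
    Module.finrank k (F.part k M i) = Module.finrank k (F.part k N i) := by
  refine LinearEquiv.finrank_eq
    { toFun := fun x => ⟨f x, by rw [mem_part, ← map_smul, mem_part.mp x.2]⟩
      map_add' := fun _ _ => Subtype.ext (by simp)
      map_smul' := fun c x => Subtype.ext
        ((f.toLinearMap.restrictScalars k).map_smul c (x : M))
      invFun := fun x => ⟨f.symm x, by rw [mem_part, ← map_smul, mem_part.mp x.2]⟩
      left_inv := fun _ => Subtype.ext (by simp)
      right_inv := fun _ => Subtype.ext (by simp) }

lemma finrank_part_submodule_add [Module.Finite k M] {N N' : Submodule A M} (h : N ≤ N') (i : I) :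
    Module.finrank k (F.part k (N' ⧸ N.submoduleOf N') i) + Module.finrank k (F.part k N i) =
      Module.finrank k (F.part k N' i) := by
  have := finite_of_tower k N'
  rw [← F.finrank_part_quotient_add (N.submoduleOf N'),
    F.finrank_part_congr (Submodule.submoduleOfEquivOfLe h)]

end Simple

end IdempotentFrame

/-! ### The radical series -/

section Radical

variable {A : Type*} [Ring A] {M : Type*} [AddCommGroup M] [Module A M]

lemma smul_eq_zero_of_mem_jacobson [IsSemisimpleModule A M] {a : A} (ha : a ∈ Ring.jacobson A)
    (m : M) : a • m = 0 :=
  Module.mem_annihilator.mp (IsSemisimpleModule.jacobson_le_annihilator A M ha) m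

lemma mem_jacobson_of_forall_smul_eq_zero {a : A}
    (h : ∀ m : Ideal A, IsSimpleModule A (A ⧸ m) → ∀ x : A ⧸ m, a • x = 0) :
    a ∈ Ring.jacobson A := by
  refine Submodule.mem_sInf.mpr fun m hm => ?_
  have := h m (isSimpleModule_iff_isCoatom.mpr hm) (Submodule.Quotient.mk 1)
  rw [← Submodule.Quotient.mk_smul, Submodule.Quotient.mk_eq_zero] at this
  simpa using this

lemma le_of_le_sup_jacobson_smul {N N' : Submodule A M} (hN' : N'.FG)
    (h : N' ≤ N ⊔ Ring.jacobson A • N') : N' ≤ N := by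
  by_contra hle
  have h1 : N'.map N.mkQ ≠ ⊥ := by
    rw [Ne, ← le_bot_iff, Submodule.map_le_iff_le_comap, Submodule.comap_bot, Submodule.ker_mkQ]
    exact hle
  refine absurd ?_ (Submodule.FG.jacobson_smul_lt h1 (hN'.map _)).not_ge
  calc N'.map N.mkQ ≤ (N ⊔ Ring.jacobson A • N').map N.mkQ := Submodule.map_mono h
    _ = Ring.jacobson A • N'.map N.mkQ := by
      rw [Submodule.map_sup, Submodule.mkQ_map_self, bot_sup_eq, Submodule.map_smul'']

lemma notMem_jacobson_smul_span {m : M} (hm : m ≠ 0) :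
    m ∉ Ring.jacobson A • Submodule.span A {m} := fun h =>
  absurd ((Submodule.span_singleton_le_iff_mem _ _).mpr h)
    (Submodule.FG.jacobson_smul_lt (by simpa using hm) (Submodule.fg_span_singleton m)).not_ge

lemma smul_mem_jacobson_smul_span {a : A} (ha : a ∈ Ring.jacobson A) (m : M) :
    a • m ∈ Ring.jacobson A • Submodule.span A {m} :=
  Submodule.smul_mem_smul ha (Submodule.mem_span_singleton_self m)

lemma jacobson_smul_le_of_isSemisimple {N N' : Submodule A M}
    [IsSemisimpleModule A (N ⧸ N'.submoduleOf N)] : Ring.jacobson A • N ≤ N' := by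
  refine Submodule.smul_le.mpr fun a ha m hm => ?_
  have := smul_eq_zero_of_mem_jacobson ha
    (Submodule.Quotient.mk ⟨m, hm⟩ : N ⧸ N'.submoduleOf N)
  rw [← Submodule.Quotient.mk_smul, Submodule.Quotient.mk_eq_zero] at this
  exact this

lemma radSeries_succ_eq {n : ℕ} {N N' : Submodule A M} (hn : radSeries A M n = N)
    (h : N' ≤ N) (h' : N' ≤ Ring.jacobson A • N)
    (hs : IsSemisimpleModule A (N ⧸ N'.submoduleOf N)) : radSeries A M (n + 1) = N' := by
  subst hn
  change (Module.jacobson A (radSeries A M n)).map (radSeries A M n).subtype = N'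
  refine le_antisymm ?_ ?_
  · refine (Submodule.map_mono (Module.jacobson_le_of_eq_bot (N := N'.submoduleOf _)
      (IsSemisimpleModule.jacobson_eq_bot A _))).trans ?_
    rw [Submodule.map_le_iff_le_comap]
    exact le_rfl
  · refine h'.trans ?_
    have : Ring.jacobson A • radSeries A M n =
        (Ring.jacobson A • (⊤ : Submodule A (radSeries A M n))).map (radSeries A M n).subtype := by
      rw [Submodule.map_smul'', Submodule.map_subtype_top]
    rw [this]
    exact Submodule.map_mono (Ring.jacobson_smul_top_le A _)

end Radical

lemma IsIndecomposableModule.bijective_of_surjective {A M N : Type*} [Ring A] [AddCommGroup M]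
    [Module A M] [AddCommGroup N] [Module A N] [Module.Projective A N] [Nontrivial N]
    (hM : IsIndecomposableModule A M) {f : M →ₗ[A] N} (hf : Function.Surjective f) :
    Function.Bijective f := by
  obtain ⟨g, hg⟩ := Module.projective_lifting_property f LinearMap.id hf
  have f_g (y : N) : f (g y) = y := LinearMap.congr_fun hg y
  have isCompl_ker_range : IsCompl (LinearMap.ker f) (LinearMap.range g) := by
    refine ⟨Submodule.disjoint_def.mpr ?_, codisjoint_iff.mpr (eq_top_iff.mpr fun x _ => ?_)⟩
    · rintro _ hx ⟨y, rfl⟩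
      rw [← f_g y, LinearMap.mem_ker.mp hx, map_zero]
    · refine Submodule.mem_sup.mpr ⟨x - g (f x), ?_, g (f x), ⟨f x, rfl⟩, sub_add_cancel _ _⟩
      rw [LinearMap.mem_ker, map_sub, f_g, sub_self]
  rcases hM.2 _ _ isCompl_ker_range with hker | hrange
  · exact ⟨LinearMap.ker_eq_bot.mp hker, hf⟩
  · obtain ⟨y, hy⟩ := exists_ne (0 : N)
    refine absurd ?_ hy
    rw [← f_g y, LinearMap.range_eq_bot.mp hrange, LinearMap.zero_apply, map_zero]

lemma projective_span_of_isIdempotentElem {A : Type*} [Ring A] {f : A}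
    (hf : IsIdempotentElem f) : Module.Projective A (Ideal.span {f}) := by
  refine Module.Projective.of_split (Ideal.span {f}).subtype
    ((LinearMap.toSpanSingleton A A f).codRestrict (Ideal.span {f}) fun a =>
      Ideal.mul_mem_left _ _ (Ideal.subset_span rfl)) ?_
  ext x
  obtain ⟨b, hb⟩ := Ideal.mem_span_singleton'.mp x.2
  change (x : A) * f = x
  rw [← hb, mul_assoc, hf]

namespace IdempotentFrame

variable {k A : Type*} [Field k] [Ring A] [Algebra k A] {P I : Type*} [Fintype P] [DecidableEq P]
  {σ : P → I} (F : IdempotentFrame A σ)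

variable (k) in
/-- Modulo the Jacobson radical, the ring of a split frame is a product of matrix rings over `k`. -/
structure IsSplit : Prop where
  off : ∀ (i j : I) (a : A), i ≠ j → F.e j * a * F.e i ∈ Ring.jacobson A
  diag : ∀ (i : I) (a : A), ∃ c : k, F.e i * a * F.e i - c • F.e i ∈ Ring.jacobson A

/-- The projective module `A e`. -/
abbrev proj (i : I) : Ideal A := Ideal.span {F.e i}

/-- The generator of the projective module `A e`. -/
def gen (i : I) : F.proj i := ⟨F.e i, Ideal.subset_span rfl⟩

lemma mem_proj_iff {i : I} {a : A} : a ∈ F.proj i ↔ a * F.e i = a := by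
  rw [Ideal.mem_span_singleton']
  refine ⟨?_, fun h => ⟨a, h⟩⟩
  rintro ⟨b, rfl⟩
  rw [mul_assoc, F.e_mul_e]

lemma span_gen (i : I) : Submodule.span A {F.gen i} = ⊤ := by
  refine eq_top_iff.mpr fun x _ => Submodule.mem_span_singleton.mpr ⟨x, Subtype.ext ?_⟩
  exact F.mem_proj_iff.mp x.2

lemma e_smul_gen (i : I) : F.e i • F.gen i = F.gen i := Subtype.ext (F.e_mul_e i)

instance projective_proj (i : I) : Module.Projective A (F.proj i) :=
  projective_span_of_isIdempotentElem (F.e_mul_e i)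

section Hom

variable {M : Type*} [AddCommGroup M] [Module A M]

/-- The homomorphism `A e → M` that maps `e` to `e x`. -/
def homOfVector (i : I) (x : M) : F.proj i →ₗ[A] M :=
  (LinearMap.toSpanSingleton A M x).domRestrict (F.proj i)

@[simp]
lemma homOfVector_apply (i : I) (x : M) (a : F.proj i) : F.homOfVector i x a = (a : A) • x := rfl

lemma range_homOfVector {i : I} {x : M} (hx : F.e i • x = x) :
    LinearMap.range (F.homOfVector i x) = Submodule.span A {x} := by
  rw [LinearMap.range_eq_map, ← F.span_gen i, Submodule.map_span, Set.image_singleton]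
  congr 2

lemma homOfVector_surjective [IsSimpleModule A M] {i : I} {x : M} (h0 : x ≠ 0)
    (hx : F.e i • x = x) : Function.Surjective (F.homOfVector i x) := by
  rw [← LinearMap.range_eq_top, F.range_homOfVector hx]
  exact IsSimpleModule.span_singleton_eq_top A h0

variable {F} (hF : F.IsSplit k)

include hF

lemma IsSplit.smul_eq_zero_iff [IsSimpleModule A M] {i : I} {x : M} (h0 : x ≠ 0)
    (hx : F.e i • x = x) {a : A} (ha : a * F.e i = a) :
    a • x = 0 ↔ a ∈ Ring.jacobson A := by
  refine ⟨fun h => F.mem_ideal_of_v_mul_mem fun p => ?_,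
    fun h => smul_eq_zero_of_mem_jacobson h x⟩
  have hv : F.v p * a = F.e (σ p) * (F.v p * a) * F.e i := by
    rw [← mul_assoc, F.e_mul_v, mul_assoc, ha]
  by_cases hi : i = σ p
  · subst hi
    obtain ⟨c, hc⟩ := hF.diag (σ p) (F.v p * a)
    rw [← hv] at hc
    have h1 := smul_eq_zero_of_mem_jacobson hc x
    rw [sub_smul, mul_smul, h, smul_zero, zero_sub, neg_eq_zero] at h1
    have hc0 : c = 0 := by
      by_contra hc0
      apply h0
      rw [← hx]
      have : F.e (σ p) = algebraMap k A c⁻¹ * (c • F.e (σ p)) := by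
        rw [← Algebra.smul_def, smul_smul, inv_mul_cancel₀ hc0, one_smul]
      rw [this, mul_smul, h1, smul_zero]
    rwa [hc0, zero_smul, sub_zero] at hc
  · rw [hv]
    exact hF.off _ _ _ hi

lemma IsSplit.ker_homOfVector [IsSimpleModule A M] {i : I} {x : M} (h0 : x ≠ 0)
    (hx : F.e i • x = x) :
    LinearMap.ker (F.homOfVector i x) = (Ring.jacobson A).submoduleOf (F.proj i) := by
  ext a
  exact hF.smul_eq_zero_iff h0 hx (F.mem_proj_iff.mp a.2)

lemma IsSplit.nonempty_equiv {i : I} {M' : Type*} [AddCommGroup M'] [Module A M']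
    (h : F.IsTop i M) (h' : F.IsTop i M') : Nonempty (M ≃ₗ[A] M') := by
  obtain ⟨_, x, h0, hx⟩ := h
  obtain ⟨_, x', h0', hx'⟩ := h'
  exact ⟨((F.homOfVector i x).quotKerEquivOfSurjective (F.homOfVector_surjective h0 hx)).symm ≪≫ₗ
    Submodule.quotEquivOfEq _ _
      ((hF.ker_homOfVector h0 hx).trans (hF.ker_homOfVector h0' hx').symm) ≪≫ₗ
    (F.homOfVector i x').quotKerEquivOfSurjective (F.homOfVector_surjective h0' hx')⟩

lemma IsSplit.e_smul_eq_zero {i j : I} (h : F.IsTop i M) (hij : i ≠ j) (y : M) :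
    F.e j • y = 0 := by
  obtain ⟨_, x, h0, hx⟩ := h
  obtain ⟨a, rfl⟩ := F.homOfVector_surjective h0 hx y
  rw [homOfVector_apply, ← hx, ← mul_smul, ← mul_smul]
  exact smul_eq_zero_of_mem_jacobson (hF.off _ _ _ hij) x

lemma IsSplit.label_unique {i j : I} (h : F.IsTop i M) (h' : F.IsTop j M) : i = j := by
  by_contra hij
  obtain ⟨_, y, h0, hy⟩ := h'
  exact h0 (hy ▸ hF.e_smul_eq_zero h hij y)

lemma IsSplit.e_smul_eq_smul [Module k M] [IsScalarTower k A M] [IsSimpleModule A M] {i : I} {x : M}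
    (hx : F.e i • x = x) (a : A) : ∃ c : k, F.e i • a • x = c • x := by
  obtain ⟨c, hc⟩ := hF.diag i a
  refine ⟨c, ?_⟩
  have := smul_eq_zero_of_mem_jacobson hc x
  rwa [sub_smul, sub_eq_zero, mul_smul, hx, mul_smul, smul_assoc, hx] at this

end Hom

section Proj

variable {F} (hF : F.IsSplit k)

lemma fg_top_proj (i : I) : (⊤ : Submodule A (F.proj i)).FG := by
  rw [← F.span_gen i]
  exact Submodule.fg_span_singleton _

instance finite_proj (i : I) : Module.Finite A (F.proj i) := ⟨fg_top_proj i⟩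

include hF

lemma IsSplit.eq_of_isCoatom {i : I} {N : Submodule A (F.proj i)} (hN : IsCoatom N) :
    N = (Ring.jacobson A).submoduleOf (F.proj i) := by
  have := isSimpleModule_iff_isCoatom.mpr hN
  have hx : F.e i • N.mkQ (F.gen i) = N.mkQ (F.gen i) := by rw [← map_smul, F.e_smul_gen]
  have h0 : N.mkQ (F.gen i) ≠ 0 := by
    intro h
    apply hN.1
    rw [← top_le_iff, ← F.span_gen i, Submodule.span_singleton_le_iff_mem]
    simpa using h
  rw [← hF.ker_homOfVector h0 hx]
  ext a
  rw [LinearMap.mem_ker, homOfVector_apply, ← map_smul]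
  have : (a : A) • F.gen i = a := Subtype.ext (F.mem_proj_iff.mp a.2)
  rw [this]
  simp

lemma IsSplit.isCoatom {i : I} (hi : F.e i ≠ 0) :
    IsCoatom ((Ring.jacobson A).submoduleOf (F.proj i)) := by
  have : Nontrivial (F.proj i) := ⟨⟨F.gen i, 0, fun h => hi (congrArg Subtype.val h)⟩⟩
  obtain ⟨N, hN, -⟩ := (eq_top_or_exists_le_coatom (⊥ : Submodule A (F.proj i))).resolve_left
    bot_ne_top
  rwa [hF.eq_of_isCoatom hN] at hN

lemma IsSplit.le_of_ne_top {i : I} {N : Submodule A (F.proj i)} (hN : N ≠ ⊤) :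
    N ≤ (Ring.jacobson A).submoduleOf (F.proj i) := by
  obtain ⟨N', hN', h⟩ := (eq_top_or_exists_le_coatom N).resolve_left hN
  rwa [hF.eq_of_isCoatom hN'] at h

lemma IsSplit.gen_notMem {i : I} (hi : F.e i ≠ 0) :
    F.gen i ∉ (Ring.jacobson A).submoduleOf (F.proj i) := fun h =>
  (hF.isCoatom hi).1 (top_le_iff.mp (by
    rwa [← F.span_gen i, Submodule.span_singleton_le_iff_mem]))

lemma IsSplit.isTop_proj_quotient {i : I} (hi : F.e i ≠ 0) :
    F.IsTop i (F.proj i ⧸ (Ring.jacobson A).submoduleOf (F.proj i)) := by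
  refine ⟨isSimpleModule_iff_isCoatom.mpr (hF.isCoatom hi), Submodule.Quotient.mk (F.gen i), ?_, ?_⟩
  · rw [Ne, Submodule.Quotient.mk_eq_zero]
    exact hF.gen_notMem hi
  · rw [← Submodule.Quotient.mk_smul, F.e_smul_gen]

lemma IsSplit.isIndecomposableModule_proj {i : I} (hi : F.e i ≠ 0) :
    IsIndecomposableModule A (F.proj i) := by
  refine ⟨⟨⟨F.gen i, 0, fun h => hi (congrArg Subtype.val h)⟩⟩, fun N N' h => ?_⟩
  by_cases hN : N = ⊤
  · right
    simpa [hN] using h.disjoint.symm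
  by_cases hN' : N' = ⊤
  · left
    simpa [hN'] using h.disjoint
  exact absurd (top_le_iff.mp (h.sup_eq_top ▸ sup_le (hF.le_of_ne_top hN) (hF.le_of_ne_top hN')))
    (hF.isCoatom hi).1

lemma IsSplit.surjective_of_not_le {i : I} {M : Type*} [AddCommGroup M] [Module A M]
    {f : M →ₗ[A] F.proj i} {m : M} (hm : f m ∉ (Ring.jacobson A).submoduleOf (F.proj i)) :
    Function.Surjective f := by
  rw [← LinearMap.range_eq_top]
  by_contra h
  exact hm (hF.le_of_ne_top h ⟨m, rfl⟩)

lemma IsSplit.exists_equiv_proj {M : Type*} [AddCommGroup M] [Module A M]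
    [Module.Finite A M] [Module.Projective A M] (hM : IsIndecomposableModule A M) :
    ∃ i, Nonempty (M ≃ₗ[A] F.proj i) := by
  have := hM.1
  obtain ⟨N, hN, -⟩ := (eq_top_or_exists_le_coatom (⊥ : Submodule A M)).resolve_left bot_ne_top
  have := isSimpleModule_iff_isCoatom.mpr hN
  obtain ⟨i, -, x, h0, hx⟩ := F.exists_isTop (M := M ⧸ N)
  refine ⟨i, ?_⟩
  obtain ⟨f, hf⟩ := Module.projective_lifting_property (F.homOfVector i x) N.mkQ
    (F.homOfVector_surjective h0 hx)
  obtain ⟨m, hm⟩ := N.mkQ_surjective x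
  have hsurj : Function.Surjective f := by
    refine hF.surjective_of_not_le (m := m) ?_
    rw [← hF.ker_homOfVector h0 hx, LinearMap.mem_ker, ← LinearMap.comp_apply, hf, hm]
    exact h0
  have : Nontrivial (M ⧸ N) := ⟨⟨x, 0, h0⟩⟩
  have : Nontrivial (F.proj i) := (F.homOfVector_surjective h0 hx).nontrivial
  exact ⟨LinearEquiv.ofBijective f (hM.bijective_of_surjective hsurj)⟩

end Proj

section Chain

variable [DecidableEq I] {M : Type*} [AddCommGroup M] [Module k M] [Module A M]
  [IsScalarTower k A M]

variable (k) in
/-- Homogeneous vectors `m 0, …, m (n - 1)`, each obtained from the preceding one by an element of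
the radical, whose labels account for the whole dimension of the module generated by `m 0`. -/
structure IsRadChain (n : ℕ) (m : ℕ → M) (l : ℕ → I) : Prop where
  homogeneous : ∀ t < n, F.e (l t) • m t = m t
  ne_zero : ∀ t < n, m t ≠ 0
  eq_zero : m n = 0
  step : ∀ t < n, m (t + 1) ∈ Ring.jacobson A • Submodule.span A {m t}
  finrank_le : Module.finrank k (Submodule.span A {m 0}) ≤ ∑ t ∈ Finset.range n, dim σ (l t)

namespace IsRadChain

variable {F} {n : ℕ} {m : ℕ → M} {l : ℕ → I} (h : F.IsRadChain k n m l)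

include h

lemma span_le {t : ℕ} (ht : t < n) :
    Submodule.span A {m (t + 1)} ≤ Submodule.span A {m t} :=
  (Submodule.span_singleton_le_iff_mem _ _).mpr (Submodule.smul_le_right (h.step t ht))

lemma mk_ne_zero {t : ℕ} (ht : t < n) :
    (Submodule.Quotient.mk ⟨m t, Submodule.mem_span_singleton_self _⟩ :
      Submodule.span A {m t} ⧸
        (Submodule.span A {m (t + 1)}).submoduleOf (Submodule.span A {m t})) ≠ 0 := by
  rw [Ne, Submodule.Quotient.mk_eq_zero]
  intro hmem
  refine notMem_jacobson_smul_span (A := A) (h.ne_zero t ht) ?_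
  exact (Submodule.span_singleton_le_iff_mem _ _).mpr (h.step t ht) hmem

lemma mk_homogeneous {t : ℕ} (ht : t < n) :
    F.e (l t) • (Submodule.Quotient.mk ⟨m t, Submodule.mem_span_singleton_self _⟩ :
      Submodule.span A {m t} ⧸
        (Submodule.span A {m (t + 1)}).submoduleOf (Submodule.span A {m t})) =
      Submodule.Quotient.mk ⟨m t, Submodule.mem_span_singleton_self _⟩ := by
  rw [← Submodule.Quotient.mk_smul]
  congr 1
  exact Subtype.ext (h.homogeneous t ht)

lemma span_antitone {s t : ℕ} (hst : s ≤ t) (ht : t ≤ n) :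
    Submodule.span A {m t} ≤ Submodule.span A {m s} := by
  induction hst with
  | refl => exact le_rfl
  | step _ ih => exact (h.span_le ht).trans (ih (Nat.le_of_succ_le ht))

variable [Module.Finite k M]

include h

lemma finrank_add_le {t : ℕ} (ht : t < n) :
    Module.finrank k (Submodule.span A {m (t + 1)}) + dim σ (l t) ≤
      Module.finrank k (Submodule.span A {m t}) := by
  rw [← finrank_submoduleOf_add k (h.span_le ht), add_comm]
  have := finite_of_tower k (Submodule.span A {m t})
  gcongr
  exact F.dim_le_finrank (k := k) (h.mk_ne_zero ht) (h.mk_homogeneous ht)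

lemma finrank_add_sum_le {t : ℕ} (ht : t ≤ n) :
    Module.finrank k (Submodule.span A {m t}) + ∑ s ∈ Finset.range t, dim σ (l s) ≤
      Module.finrank k (Submodule.span A {m 0}) := by
  induction t with
  | zero => simp
  | succ t ih =>
    rw [Finset.sum_range_succ]
    have := h.finrank_add_le ht
    have := ih (by omega)
    omega

lemma le_finrank {t : ℕ} (ht : t ≤ n) :
    ∑ s ∈ Finset.Ico t n, dim σ (l s) ≤ Module.finrank k (Submodule.span A {m t}) := by
  induction ht using Nat.decreasingInduction with
  | self => simp
  | of_succ t ht ih =>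
    rw [Finset.sum_eq_sum_Ico_succ_bot ht, add_comm]
    exact (Nat.add_le_add_right ih _).trans (h.finrank_add_le ht)

lemma finrank_eq {t : ℕ} (ht : t ≤ n) :
    Module.finrank k (Submodule.span A {m t}) = ∑ s ∈ Finset.Ico t n, dim σ (l s) := by
  refine le_antisymm ?_ (h.le_finrank ht)
  have h1 := h.finrank_add_sum_le ht
  have h2 := h.finrank_le
  rw [← Finset.sum_range_add_sum_Ico _ ht] at h2
  omega

lemma isTop {t : ℕ} (ht : t < n) : F.IsTop (l t) (Submodule.span A {m t} ⧸
    (Submodule.span A {m (t + 1)}).submoduleOf (Submodule.span A {m t})) := by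
  have := finite_of_tower k (Submodule.span A {m t})
  refine F.isTop_of_finrank_eq k (h.mk_ne_zero ht) (h.mk_homogeneous ht) ?_
  have := finrank_submoduleOf_add k (h.span_le ht)
  rw [h.finrank_eq (t := t + 1) ht, h.finrank_eq ht.le, Finset.sum_eq_sum_Ico_succ_bot ht] at this
  omega

lemma jacobson_smul {t : ℕ} (ht : t < n) :
    Ring.jacobson A • Submodule.span A {m t} = Submodule.span A {m (t + 1)} := by
  have := (h.isTop ht).1
  exact le_antisymm jacobson_smul_le_of_isSemisimple
    ((Submodule.span_singleton_le_iff_mem _ _).mpr (h.step t ht))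

lemma exists_eq_span_of_le {t : ℕ} (ht : t ≤ n) {N : Submodule A M}
    (hN : N ≤ Submodule.span A {m t}) : ∃ s, t ≤ s ∧ s ≤ n ∧ N = Submodule.span A {m s} := by
  induction ht using Nat.decreasingInduction with
  | self => exact ⟨n, le_rfl, le_rfl, by simpa [h.eq_zero] using hN⟩
  | of_succ t ht ih =>
    have hcov := (covBy_iff_quot_is_simple (h.span_le ht)).mpr (h.isTop ht).1
    rcases hcov.eq_or_eq le_sup_right (sup_le hN (h.span_le ht)) with h1 | h1
    · obtain ⟨s, hs, hs', rfl⟩ := ih (sup_eq_right.mp h1)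
      exact ⟨s, by omega, hs', rfl⟩
    · refine ⟨t, le_rfl, ht.le, le_antisymm hN ?_⟩
      refine le_of_le_sup_jacobson_smul (Submodule.fg_span_singleton _) ?_
      rw [h.jacobson_smul ht, h1]

variable (h0 : Submodule.span A {m 0} = ⊤)

include h0

lemma isUniserialModule : IsUniserialModule A M := by
  intro N N'
  obtain ⟨s, -, hs, rfl⟩ := h.exists_eq_span_of_le (Nat.zero_le n) (N := N) (h0 ▸ le_top)
  obtain ⟨s', -, hs', rfl⟩ := h.exists_eq_span_of_le (Nat.zero_le n) (N := N') (h0 ▸ le_top)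
  rcases le_total s s' with hss | hss
  · exact Or.inr (h.span_antitone hss hs')
  · exact Or.inl (h.span_antitone hss hs)

lemma radSeries_eq {t : ℕ} (ht : t ≤ n) : radSeries A M t = Submodule.span A {m t} := by
  induction t with
  | zero => exact h0.symm
  | succ t ih =>
    have := (h.isTop ht).1
    exact radSeries_succ_eq (ih (by omega)) (h.span_le ht) (h.jacobson_smul ht).ge inferInstance

lemma radSeries_eq_bot : radSeries A M n = ⊥ := by
  rw [h.radSeries_eq h0 le_rfl, h.eq_zero, Submodule.span_zero_singleton]

lemma isTop_radLayer {t : ℕ} (ht : t < n) : F.IsTop (l t) (RadLayer A M t) := by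
  change F.IsTop (l t) (radSeries A M t ⧸ (radSeries A M (t + 1)).submoduleOf (radSeries A M t))
  rw [h.radSeries_eq h0 (t := t + 1) ht, h.radSeries_eq h0 ht.le]
  exact h.isTop ht

end IsRadChain

end Chain

/-! ### Multiplicities of composition factors -/

section Multiplicity

variable {F} (hF : F.IsSplit k)
  {M : Type*} [AddCommGroup M] [Module k M] [Module A M]
  [IsScalarTower k A M]

include hF

lemma IsSplit.finrank_part_isTop [Module.Finite k M] {i : I} (h : F.IsTop i M) :
    Module.finrank k (F.part k M i) = 1 := by
  obtain ⟨hs, x, h0, hx⟩ := h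
  refine (finrank_eq_one_iff_of_nonzero' (⟨x, hx⟩ : F.part k M i)
    (by simpa [Subtype.ext_iff] using h0)).mpr ?_
  rintro ⟨y, hy⟩
  obtain ⟨a, rfl⟩ := F.homOfVector_surjective h0 hx y
  obtain ⟨c, hc⟩ := hF.e_smul_eq_smul hx (a : A)
  refine ⟨c, Subtype.ext ?_⟩
  rw [homOfVector_apply] at hy
  exact hc.symm.trans hy

lemma IsSplit.finrank_part_eq_ite [Module.Finite k M] [IsSimpleModule A M] {S : Type*}
    [AddCommGroup S] [Module A S] {i : I} (hS : F.IsTop i S) [Decidable (Nonempty (M ≃ₗ[A] S))] :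
    Module.finrank k (F.part k M i) = if Nonempty (M ≃ₗ[A] S) then 1 else 0 := by
  split_ifs with h
  · obtain ⟨f⟩ := h
    exact hF.finrank_part_isTop (hS.congr f.symm)
  · obtain ⟨j, hj⟩ := F.exists_isTop (M := M)
    have hij : j ≠ i := by
      rintro rfl
      exact h (hF.nonempty_equiv hj hS)
    have : F.part k M i = ⊥ := by
      refine (Submodule.eq_bot_iff _).mpr fun x hx => ?_
      rw [← mem_part.mp hx, hF.e_smul_eq_zero hj hij]
    rw [this, finrank_bot]

lemma IsSplit.hasMultiplicity [Module.Finite k M] {S : Type*} [AddCommGroup S] [Module A S] {i : I}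
    (hS : F.IsTop i S) : HasMultiplicity A M S (Module.finrank k (F.part k M i)) := by
  classical
  have : IsNoetherian A M := isNoetherian_of_tower k inferInstance
  have : IsArtinian A M := isArtinian_of_tower k inferInstance
  refine ⟨exists_compositionSeries_of_isNoetherian_isArtinian A M, fun s hs hs' => ?_⟩
  let c (t : Fin s.length) : ℕ :=
    if Nonempty ((s t.succ ⧸ (s t.castSucc).submoduleOf (s t.succ)) ≃ₗ[A] S) then 1 else 0
  have key (n : ℕ) (hn : n < s.length + 1) :
      Module.finrank k (F.part k (s ⟨n, hn⟩) i) = ∑ t : Fin n, c ⟨t, by omega⟩ := by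
    induction n with
    | zero =>
      have h0 : s ⟨0, hn⟩ = ⊥ := hs
      have : Subsingleton (F.part k (s ⟨0, hn⟩) i) := by
        rw [h0]
        infer_instance
      exact Module.finrank_zero_of_subsingleton
    | succ n ih =>
      let t : Fin s.length := ⟨n, by omega⟩
      have hcov : s t.castSucc ⋖ s t.succ := s.step t
      have : IsSimpleModule A (s t.succ ⧸ (s t.castSucc).submoduleOf (s t.succ)) :=
        (covBy_iff_quot_is_simple hcov.le).mp hcov
      have hfin := finite_of_tower k (s t.succ)
      have h1 := F.finrank_part_submodule_add (k := k) hcov.le i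
      have h2 : Module.finrank k (F.part k (s t.castSucc) i) = _ := ih (by omega)
      rw [hF.finrank_part_eq_ite hS, h2] at h1
      rw [Fin.sum_univ_castSucc]
      exact h1.symm.trans (add_comm _ _)
  have h1 := key s.length (by omega)
  have h2 : s ⟨s.length, by omega⟩ = ⊤ := hs'
  rw [h2, F.finrank_part_congr Submodule.topEquiv] at h1
  rw [h1, Nat.card_eq_fintype_card, Fintype.card_subtype, Finset.card_filter]

end Multiplicity

end IdempotentFrame

namespace IdempotentFrame

variable {k A : Type*} [Field k] [Ring A] [Algebra k A] {P I : Type*} [Fintype P] [DecidableEq P]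
  {σ : P → I} (F : IdempotentFrame A σ)

variable (k) in
/-- The subspace `e i * A * e j`. -/
def corner (i j : I) : Submodule k A where
  carrier := {x | F.e i * x = x ∧ x * F.e j = x}
  add_mem' := fun ⟨ha, ha'⟩ ⟨hb, hb'⟩ => ⟨by rw [mul_add, ha, hb], by rw [add_mul, ha', hb']⟩
  zero_mem' := by simp
  smul_mem' := fun c x ⟨h, h'⟩ => ⟨by rw [mul_smul_comm, h], by rw [smul_mul_assoc, h']⟩

variable {F} in
lemma mem_corner {i j : I} {x : A} : x ∈ F.corner k i j ↔ F.e i * x = x ∧ x * F.e j = x := Iff.rfl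

lemma e_mul_mul_e_mem_corner (i j : I) (a : A) : F.e i * a * F.e j ∈ F.corner k i j :=
  ⟨by rw [← mul_assoc, ← mul_assoc, F.e_mul_e], by rw [mul_assoc, F.e_mul_e]⟩

lemma v_mul_mul_u_mem_corner (p q : P) (a : A) : F.v p * a * F.u q ∈ F.corner k (σ p) (σ q) :=
  ⟨by rw [← mul_assoc, ← mul_assoc, F.e_mul_v], by rw [mul_assoc, F.u_mul_e]⟩

variable (k) in
/-- An algebra is the direct sum of copies of its Peirce components. -/
def cornerEquiv : A ≃ₗ[k] (Π p q, F.corner k (σ p) (σ q)) where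
  toFun a p q := ⟨F.v p * a * F.u q, F.v_mul_mul_u_mem_corner p q a⟩
  map_add' x y := by ext; simp [mul_add, add_mul]
  map_smul' c x := by ext; simp
  invFun x := ∑ p, ∑ q, F.u p * x p q * F.v q
  left_inv a := by
    calc ∑ p, ∑ q, F.u p * (F.v p * a * F.u q) * F.v q
        = (∑ p, F.u p * F.v p) * a * ∑ q, F.u q * F.v q := by
          simp_rw [Finset.sum_mul, Finset.mul_sum, mul_assoc]
      _ = a := by rw [F.sum_u_mul_v, one_mul, mul_one]
  right_inv x := by
    ext p q
    have (p' q' : P) : F.v p * (F.u p' * x p' q' * F.v q') * F.u q =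
        if p = p' then if q' = q then (x p' q' : A) else 0 else 0 := by
      calc F.v p * (F.u p' * x p' q' * F.v q') * F.u q
          = (F.v p * F.u p') * x p' q' * (F.v q' * F.u q) := by simp_rw [mul_assoc]
        _ = _ := by
          rw [F.v_mul_u, F.v_mul_u]
          split_ifs with h h'
          · subst h
            rw [(x p q').2.1, (x p q').2.2]
          all_goals simp
    simp_rw [Finset.mul_sum, Finset.sum_mul, this]
    simp

lemma finrank_eq_sum_corner [Module.Finite k A] :
    Module.finrank k A = ∑ p, ∑ q, Module.finrank k (F.corner k (σ p) (σ q)) := by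
  rw [(F.cornerEquiv k).finrank_eq, Module.finrank_pi_fintype]
  exact Finset.sum_congr rfl fun p _ => Module.finrank_pi_fintype k

/-- The homogeneous parts of `A e` are Peirce components. -/
def partProjEquiv (i j : I) : F.part k (F.proj j) i ≃ₗ[k] F.corner k i j where
  toFun x := ⟨x, congrArg Subtype.val x.2, F.mem_proj_iff.mp x.1.2⟩
  map_add' _ _ := rfl
  map_smul' _ _ := rfl
  invFun x := ⟨⟨x, F.mem_proj_iff.mpr x.2.2⟩, Subtype.ext x.2.1⟩
  left_inv _ := rfl
  right_inv _ := rfl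

lemma finrank_part_proj (i j : I) :
    Module.finrank k (F.part k (F.proj j) i) = Module.finrank k (F.corner k i j) :=
  (F.partProjEquiv i j).finrank_eq

lemma mem_jacobson_of_isNilpotent {i j : I} {x : A} (hx : x * F.e i = x) (hx' : F.e j * x = x)
    (h : ∀ y ∈ F.corner k i j, IsNilpotent (y * x)) : x ∈ Ring.jacobson A := by
  refine mem_jacobson_of_forall_smul_eq_zero fun m hm w => ?_
  by_contra h0
  obtain ⟨y, hy⟩ := Submodule.mem_span_singleton.mp
    (IsSimpleModule.span_singleton_eq_top A h0 ▸ Submodule.mem_top : F.e i • w ∈ _)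
  have h1 : (F.e i * y * F.e j * x) • F.e i • w = F.e i • w := by
    rw [mul_assoc, hx', mul_smul, ← mul_smul x, hx, mul_smul, hy, ← mul_smul, F.e_mul_e]
  obtain ⟨n, hn⟩ := h _ (F.e_mul_mul_e_mem_corner i j y)
  have h2 (n : ℕ) : (F.e i * y * F.e j * x) ^ n • F.e i • w = F.e i • w := by
    induction n with
    | zero => simp
    | succ n ih => rw [pow_succ, mul_smul, h1, ih]
  have h3 := h2 n
  rw [hn, zero_smul] at h3
  apply h0
  rw [← hx, mul_smul, ← h3, smul_zero]

end IdempotentFrame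

/-! ### Frames with the quiver of the group algebra of `A₅` -/

/-- The labels of the nine summands of the regular module. -/
abbrev label : Fin 9 → Fin 4 := ![0, 1, 1, 2, 2, 3, 3, 3, 3]

/-- A frame together with arrows `α : 0 → 1`, `β : 1 → 0`, `γ : 0 → 2`, `δ : 2 → 0` subject to the
relations `αβ = 0`, `γδ = 0`, `βαδγ = δγβα`, and with nonzero socle elements. -/
structure QuiverFrame (A : Type*) [Ring A] extends IdempotentFrame A label where
  α : A
  β : A
  γ : A
  δ : A
  e_α : e 1 * α = α
  α_e : α * e 0 = α
  e_β : e 0 * β = β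
  β_e : β * e 1 = β
  e_γ : e 2 * γ = γ
  γ_e : γ * e 0 = γ
  e_δ : e 0 * δ = δ
  δ_e : δ * e 2 = δ
  α_β : α * β = 0
  γ_δ : γ * δ = 0
  β_α_δ_γ : β * (α * (δ * γ)) = δ * (γ * (β * α))
  δ_γ_β_α_ne_zero : δ * (γ * (β * α)) ≠ 0
  α_δ_γ_β_ne_zero : α * (δ * (γ * β)) ≠ 0
  γ_β_α_δ_ne_zero : γ * (β * (α * δ)) ≠ 0
  e_ne_zero : ∀ i, e i ≠ 0

namespace QuiverFrame

section Relations

variable {A : Type*} [Ring A] (Q : QuiverFrame A)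

attribute [simp] e_α α_e e_β β_e e_γ γ_e e_δ δ_e α_β γ_δ β_α_δ_γ

@[simp] lemma e_α_assoc (x : A) : Q.e 1 * (Q.α * x) = Q.α * x := by rw [← mul_assoc, e_α]
@[simp] lemma e_β_assoc (x : A) : Q.e 0 * (Q.β * x) = Q.β * x := by rw [← mul_assoc, e_β]
@[simp] lemma e_γ_assoc (x : A) : Q.e 2 * (Q.γ * x) = Q.γ * x := by rw [← mul_assoc, e_γ]
@[simp] lemma e_δ_assoc (x : A) : Q.e 0 * (Q.δ * x) = Q.δ * x := by rw [← mul_assoc, e_δ]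
@[simp] lemma α_β_assoc (x : A) : Q.α * (Q.β * x) = 0 := by rw [← mul_assoc, α_β, zero_mul]
@[simp] lemma γ_δ_assoc (x : A) : Q.γ * (Q.δ * x) = 0 := by rw [← mul_assoc, γ_δ, zero_mul]
@[simp] lemma e_e (i : Fin 4) : Q.e i * Q.e i = Q.e i := Q.e_mul_e i

@[simp] lemma β_α_δ_γ_assoc (x : A) :
    Q.β * (Q.α * (Q.δ * (Q.γ * x))) = Q.δ * (Q.γ * (Q.β * (Q.α * x))) := by
  have := congrArg (· * x) Q.β_α_δ_γ
  simpa only [mul_assoc] using this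

@[simp] lemma α_δ_γ_β_α : Q.α * (Q.δ * (Q.γ * (Q.β * Q.α))) = 0 := by
  rw [← β_α_δ_γ, α_β_assoc]

@[simp] lemma δ_γ_β_α_δ : Q.δ * (Q.γ * (Q.β * (Q.α * Q.δ))) = 0 := by
  rw [← β_α_δ_γ_assoc, γ_δ, mul_zero, mul_zero, mul_zero]

/-- The nonzero paths from `j` to `i`. -/
def path : (i j : Fin 4) → Fin (cartanA5 i j) → A
  | 0, 0 => (![Q.e 0, Q.β * Q.α, Q.δ * Q.γ, Q.δ * (Q.γ * (Q.β * Q.α))] : Fin 4 → A)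
  | 0, 1 => (![Q.β, Q.δ * (Q.γ * Q.β)] : Fin 2 → A)
  | 0, 2 => (![Q.δ, Q.β * (Q.α * Q.δ)] : Fin 2 → A)
  | 0, 3 => (![] : Fin 0 → A)
  | 1, 0 => (![Q.α, Q.α * (Q.δ * Q.γ)] : Fin 2 → A)
  | 1, 1 => (![Q.e 1, Q.α * (Q.δ * (Q.γ * Q.β))] : Fin 2 → A)
  | 1, 2 => (![Q.α * Q.δ] : Fin 1 → A)
  | 1, 3 => (![] : Fin 0 → A)
  | 2, 0 => (![Q.γ, Q.γ * (Q.β * Q.α)] : Fin 2 → A)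
  | 2, 1 => (![Q.γ * Q.β] : Fin 1 → A)
  | 2, 2 => (![Q.e 2, Q.γ * (Q.β * (Q.α * Q.δ))] : Fin 2 → A)
  | 2, 3 => (![] : Fin 0 → A)
  | 3, 0 => (![] : Fin 0 → A)
  | 3, 1 => (![] : Fin 0 → A)
  | 3, 2 => (![] : Fin 0 → A)
  | 3, 3 => (![Q.e 3] : Fin 1 → A)

end Relations

section Dimension

variable {k A : Type*} [Field k] [Ring A] [Algebra k A] (Q : QuiverFrame A)

variable (k) in
lemma path_mem_corner (i j : Fin 4) : ∀ t, Q.path i j t ∈ Q.corner k i j := by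
  fin_cases i <;> fin_cases j <;> simp only [path, IdempotentFrame.mem_corner]
  all_goals first
    | (change ∀ t : Fin 0, _; exact fun t => t.elim0)
    | (change ∀ t : Fin 1, _; simp [mul_assoc])
    | (change ∀ t : Fin 2, _; simp [Fin.forall_fin_succ, mul_assoc])
    | (change ∀ t : Fin 4, _; simp [Fin.forall_fin_succ, mul_assoc])

variable {Q} in
lemma loop_coeffs_eq_zero {a b c d : k} (h : a • Q.e 0 + b • (Q.β * Q.α) + c • (Q.δ * Q.γ) +
    d • (Q.δ * (Q.γ * (Q.β * Q.α))) = 0) : a = 0 ∧ b = 0 ∧ c = 0 ∧ d = 0 := by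
  have hs := Q.δ_γ_β_α_ne_zero
  have ha : a = 0 := by
    have := congrArg (· * (Q.δ * (Q.γ * (Q.β * Q.α)))) h
    simpa [add_mul, mul_assoc, hs] using this
  subst ha
  have hb : b = 0 := by
    have := congrArg (· * (Q.δ * Q.γ)) h
    simpa [add_mul, mul_assoc, hs] using this
  subst hb
  have hc : c = 0 := by
    have := congrArg (· * (Q.β * Q.α)) h
    simpa [add_mul, mul_assoc, hs] using this
  subst hc
  simpa [hs] using h

variable {Q} in
lemma β_α_coeffs_eq_zero {b d : k}
    (h : b • (Q.β * Q.α) + d • (Q.δ * (Q.γ * (Q.β * Q.α))) = 0) : b = 0 ∧ d = 0 := by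
  obtain ⟨-, hb, -, hd⟩ := loop_coeffs_eq_zero (Q := Q) (a := 0) (b := b) (c := 0) (d := d)
    (by simpa using h)
  exact ⟨hb, hd⟩

variable {Q} in
lemma δ_γ_coeffs_eq_zero {c d : k}
    (h : c • (Q.δ * Q.γ) + d • (Q.δ * (Q.γ * (Q.β * Q.α))) = 0) : c = 0 ∧ d = 0 := by
  obtain ⟨-, -, hc, hd⟩ := loop_coeffs_eq_zero (Q := Q) (a := 0) (b := 0) (c := c) (d := d)
    (by simpa using h)
  exact ⟨hc, hd⟩

variable {Q} in
lemma α_coeffs_eq_zero {a b : k} (h : a • Q.α + b • (Q.α * (Q.δ * Q.γ)) = 0) : a = 0 ∧ b = 0 :=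
  β_α_coeffs_eq_zero (Q := Q) (by simpa [mul_add] using congrArg (Q.β * ·) h)

variable {Q} in
lemma β_coeffs_eq_zero {a b : k} (h : a • Q.β + b • (Q.δ * (Q.γ * Q.β)) = 0) : a = 0 ∧ b = 0 :=
  β_α_coeffs_eq_zero (Q := Q) (by simpa [add_mul, mul_assoc] using congrArg (· * Q.α) h)

variable {Q} in
lemma γ_coeffs_eq_zero {a b : k} (h : a • Q.γ + b • (Q.γ * (Q.β * Q.α)) = 0) : a = 0 ∧ b = 0 :=
  δ_γ_coeffs_eq_zero (Q := Q) (by simpa [mul_add] using congrArg (Q.δ * ·) h)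

variable {Q} in
lemma δ_coeffs_eq_zero {a b : k} (h : a • Q.δ + b • (Q.β * (Q.α * Q.δ)) = 0) : a = 0 ∧ b = 0 :=
  δ_γ_coeffs_eq_zero (Q := Q) (by simpa [add_mul, mul_assoc] using congrArg (· * Q.γ) h)

variable {Q} in
lemma α_δ_γ_β_coeffs_eq_zero {a b : k}
    (h : a • Q.e 1 + b • (Q.α * (Q.δ * (Q.γ * Q.β))) = 0) : a = 0 ∧ b = 0 := by
  have hα := Q.α_δ_γ_β_ne_zero
  have ha : a = 0 := by
    simpa [add_mul, mul_assoc, hα] using congrArg (· * (Q.α * (Q.δ * (Q.γ * Q.β)))) h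
  exact ⟨ha, by simpa [ha, hα] using h⟩

variable {Q} in
lemma γ_β_α_δ_coeffs_eq_zero {a b : k}
    (h : a • Q.e 2 + b • (Q.γ * (Q.β * (Q.α * Q.δ))) = 0) : a = 0 ∧ b = 0 := by
  have hγ := Q.γ_β_α_δ_ne_zero
  have ha : a = 0 := by
    simpa [add_mul, mul_assoc, hγ] using congrArg (· * (Q.γ * (Q.β * (Q.α * Q.δ)))) h
  exact ⟨ha, by simpa [ha, hγ] using h⟩

variable (k) in
lemma linearIndependent_path (i j : Fin 4) : LinearIndependent k (Q.path i j) := by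
  have hγβ : Q.γ * Q.β ≠ 0 := fun h => Q.γ_β_α_δ_ne_zero (by rw [← mul_assoc, h, zero_mul])
  have hαδ : Q.α * Q.δ ≠ 0 := fun h => Q.α_δ_γ_β_ne_zero (by rw [← mul_assoc, h, zero_mul])
  fin_cases i <;> fin_cases j <;> simp only [path]
  · change LinearIndependent k (ι := Fin 4) _
    refine Fintype.linearIndependent_iff.mpr fun g hg => ?_
    simp only [Fin.sum_univ_four] at hg
    obtain ⟨h0, h1, h2, h3⟩ := loop_coeffs_eq_zero hg
    simp [Fin.forall_fin_succ, h0, h1, h2, h3]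
  · exact LinearIndependent.pair_iff.mpr fun _ _ => β_coeffs_eq_zero
  · exact LinearIndependent.pair_iff.mpr fun _ _ => δ_coeffs_eq_zero
  · exact linearIndependent_empty_type (ι := Fin 0)
  · exact LinearIndependent.pair_iff.mpr fun _ _ => α_coeffs_eq_zero
  · exact LinearIndependent.pair_iff.mpr fun _ _ => α_δ_γ_β_coeffs_eq_zero
  · exact (linearIndependent_unique_iff (ι := Fin 1)).mpr hαδ
  · exact linearIndependent_empty_type (ι := Fin 0)
  · exact LinearIndependent.pair_iff.mpr fun _ _ => γ_coeffs_eq_zero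
  · exact (linearIndependent_unique_iff (ι := Fin 1)).mpr hγβ
  · exact LinearIndependent.pair_iff.mpr fun _ _ => γ_β_α_δ_coeffs_eq_zero
  · exact linearIndependent_empty_type (ι := Fin 0)
  · exact linearIndependent_empty_type (ι := Fin 0)
  · exact linearIndependent_empty_type (ι := Fin 0)
  · exact linearIndependent_empty_type (ι := Fin 0)
  · exact (linearIndependent_unique_iff (ι := Fin 1)).mpr (Q.e_ne_zero 3)

lemma span_path_le (i j : Fin 4) : Submodule.span k (Set.range (Q.path i j)) ≤ Q.corner k i j := by
  rw [Submodule.span_le]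
  rintro _ ⟨t, rfl⟩
  exact Q.path_mem_corner k i j t

variable (hA : Module.finrank k A = 60)

include hA

lemma finrank_corner (i j : Fin 4) : Module.finrank k (Q.corner k i j) = cartanA5 i j := by
  have : Module.Finite k A := Module.finite_of_finrank_pos (by omega)
  have hle (i j : Fin 4) : cartanA5 i j ≤ Module.finrank k (Q.corner k i j) := by
    have := Submodule.finrank_mono (Q.span_path_le (k := k) i j)
    rwa [finrank_span_eq_card (Q.linearIndependent_path k i j), Fintype.card_fin] at this
  have hsum : ∑ p, ∑ q, cartanA5 (label p) (label q) =
      ∑ p, ∑ q, Module.finrank k (Q.corner k (label p) (label q)) := by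
    rw [← Q.finrank_eq_sum_corner, hA]
    decide
  rw [Finset.sum_eq_sum_iff_of_le fun p _ => Finset.sum_le_sum fun q _ => hle _ _] at hsum
  have h1 := hsum (Q.base i) (Finset.mem_univ _)
  rw [Finset.sum_eq_sum_iff_of_le fun q _ => hle _ _] at h1
  have h2 := h1 (Q.base j) (Finset.mem_univ _)
  rw [Q.σ_base, Q.σ_base] at h2
  exact h2.symm

lemma corner_eq_span (i j : Fin 4) :
    Q.corner k i j = Submodule.span k (Set.range (Q.path i j)) := by
  have : Module.Finite k A := Module.finite_of_finrank_pos (by omega)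
  refine (Submodule.eq_of_le_of_finrank_eq (Q.span_path_le i j) ?_).symm
  rw [finrank_span_eq_card (Q.linearIndependent_path k i j), Fintype.card_fin,
    Q.finrank_corner hA]

lemma corner_le_of_path_mem {i j : Fin 4} {N : Submodule k A} (h : ∀ t, Q.path i j t ∈ N) :
    Q.corner k i j ≤ N := by
  rw [Q.corner_eq_span hA, Submodule.span_le]
  rintro _ ⟨t, rfl⟩
  exact h t

lemma exists_eq_sum_path {i j : Fin 4} {x : A} (hx : x ∈ Q.corner k i j) :
    ∃ c : Fin (cartanA5 i j) → k, ∑ t, c t • Q.path i j t = x := by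
  rw [Q.corner_eq_span hA] at hx
  exact (Submodule.mem_span_range_iff_exists_fun k).mp hx

lemma exists_of_mem_corner_zero_zero {x : A} (hx : x ∈ Q.corner k 0 0) :
    ∃ a b c d : k, x = a • Q.e 0 + b • (Q.β * Q.α) + c • (Q.δ * Q.γ) +
      d • (Q.δ * (Q.γ * (Q.β * Q.α))) := by
  obtain ⟨c, rfl⟩ := Q.exists_eq_sum_path hA hx
  refine ⟨c (0 : Fin 4), c (1 : Fin 4), c (2 : Fin 4), c (3 : Fin 4), ?_⟩
  change (∑ t : Fin 4, _ : A) = _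
  simp [Fin.sum_univ_four, path]

lemma exists_of_mem_corner_one_zero {x : A} (hx : x ∈ Q.corner k 1 0) :
    ∃ a b : k, x = a • Q.α + b • (Q.α * (Q.δ * Q.γ)) := by
  obtain ⟨c, rfl⟩ := Q.exists_eq_sum_path hA hx
  refine ⟨c (0 : Fin 2), c (1 : Fin 2), ?_⟩
  change (∑ t : Fin 2, _ : A) = _
  simp [Fin.sum_univ_two, path]

lemma exists_of_mem_corner_two_zero {x : A} (hx : x ∈ Q.corner k 2 0) :
    ∃ a b : k, x = a • Q.γ + b • (Q.γ * (Q.β * Q.α)) := by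
  obtain ⟨c, rfl⟩ := Q.exists_eq_sum_path hA hx
  refine ⟨c (0 : Fin 2), c (1 : Fin 2), ?_⟩
  change (∑ t : Fin 2, _ : A) = _
  simp [Fin.sum_univ_two, path]

lemma eq_zero_of_mem_corner {i j : Fin 4} (hij : cartanA5 i j = 0) {x : A}
    (hx : x ∈ Q.corner k i j) : x = 0 := by
  have : Module.Finite k A := Module.finite_of_finrank_pos (by omega)
  have h := Q.finrank_corner hA i j
  rw [hij, Submodule.finrank_eq_zero] at h
  simpa [h] using hx

lemma α_mem_jacobson : Q.α ∈ Ring.jacobson A := by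
  refine Q.mem_jacobson_of_isNilpotent (k := k) Q.α_e Q.e_α fun y hy => ⟨2, ?_⟩
  obtain ⟨c, rfl⟩ := Q.exists_eq_sum_path hA hy
  change ((∑ t : Fin 2, _ : A) * _) ^ 2 = 0
  simp [Fin.sum_univ_two, path, add_mul, mul_add, pow_two, mul_assoc]

lemma β_mem_jacobson : Q.β ∈ Ring.jacobson A := by
  refine Q.mem_jacobson_of_isNilpotent (k := k) Q.β_e Q.e_β fun y hy => ⟨2, ?_⟩
  obtain ⟨c, rfl⟩ := Q.exists_eq_sum_path hA hy
  change ((∑ t : Fin 2, _ : A) * _) ^ 2 = 0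
  simp [Fin.sum_univ_two, path, add_mul, pow_two, mul_assoc]

lemma γ_mem_jacobson : Q.γ ∈ Ring.jacobson A := by
  refine Q.mem_jacobson_of_isNilpotent (k := k) Q.γ_e Q.e_γ fun y hy => ⟨2, ?_⟩
  obtain ⟨c, rfl⟩ := Q.exists_eq_sum_path hA hy
  change ((∑ t : Fin 2, _ : A) * _) ^ 2 = 0
  simp [Fin.sum_univ_two, path, add_mul, mul_add, pow_two, mul_assoc]

lemma δ_mem_jacobson : Q.δ ∈ Ring.jacobson A := by
  refine Q.mem_jacobson_of_isNilpotent (k := k) Q.δ_e Q.e_δ fun y hy => ⟨2, ?_⟩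
  obtain ⟨c, rfl⟩ := Q.exists_eq_sum_path hA hy
  change ((∑ t : Fin 2, _ : A) * _) ^ 2 = 0
  simp [Fin.sum_univ_two, path, add_mul, pow_two, mul_assoc]

lemma e_mul_mul_e_mem_jacobson {i j : Fin 4} (hij : i ≠ j) (a : A) :
    Q.e j * a * Q.e i ∈ Ring.jacobson A := by
  have hα (x : A) : Q.α * x ∈ Ring.jacobson A := Ideal.mul_mem_right _ _ (Q.α_mem_jacobson hA)
  have hβ (x : A) : Q.β * x ∈ Ring.jacobson A := Ideal.mul_mem_right _ _ (Q.β_mem_jacobson hA)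
  have hγ (x : A) : Q.γ * x ∈ Ring.jacobson A := Ideal.mul_mem_right _ _ (Q.γ_mem_jacobson hA)
  have hδ (x : A) : Q.δ * x ∈ Ring.jacobson A := Ideal.mul_mem_right _ _ (Q.δ_mem_jacobson hA)
  refine Q.corner_le_of_path_mem (k := k) hA (N := (Ring.jacobson A).restrictScalars k) ?_
    (Q.e_mul_mul_e_mem_corner j i a)
  revert hij
  fin_cases i <;> fin_cases j <;> intro hij <;> simp only [path]
  all_goals first
    | exact absurd rfl hij
    | (change ∀ t : Fin 0, _; exact fun t => t.elim0)
    | (change ∀ t : Fin 1, _; simp [hα, hγ])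
    | (change ∀ t : Fin 2, _
       simp [Fin.forall_fin_succ, hα, hβ, hγ, hδ, Q.α_mem_jacobson hA, Q.β_mem_jacobson hA,
        Q.γ_mem_jacobson hA, Q.δ_mem_jacobson hA])

lemma exists_sub_smul_e_mem_jacobson (i : Fin 4) (a : A) :
    ∃ c : k, Q.e i * a * Q.e i - c • Q.e i ∈ Ring.jacobson A := by
  have hsmul (c : k) {x y : A} (hx : x ∈ Ring.jacobson A) : c • (x * y) ∈ Ring.jacobson A :=
    Submodule.smul_of_tower_mem _ c (Ideal.mul_mem_right _ _ hx)
  have hα := Q.α_mem_jacobson hA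
  have hβ := Q.β_mem_jacobson hA
  have hγ := Q.γ_mem_jacobson hA
  have hδ := Q.δ_mem_jacobson hA
  obtain ⟨c, hc⟩ := Q.exists_eq_sum_path (k := k) hA (Q.e_mul_mul_e_mem_corner i i a)
  rw [← hc]
  clear hc
  fin_cases i <;> simp only [path] <;> revert c
  · change ∀ c : Fin 4 → k, _
    refine fun c => ⟨c 0, ?_⟩
    change (∑ t : Fin 4, _ : A) - _ ∈ _
    simpa [Fin.sum_univ_four, add_assoc] using
      add_mem (hsmul (c 1) hβ) (add_mem (hsmul (c 2) hδ) (hsmul (c 3) hδ))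
  · change ∀ c : Fin 2 → k, _
    refine fun c => ⟨c 0, ?_⟩
    change (∑ t : Fin 2, _ : A) - _ ∈ _
    simpa [Fin.sum_univ_two] using hsmul (c 1) hα
  · change ∀ c : Fin 2 → k, _
    refine fun c => ⟨c 0, ?_⟩
    change (∑ t : Fin 2, _ : A) - _ ∈ _
    simpa [Fin.sum_univ_two] using hsmul (c 1) hγ
  · change ∀ c : Fin 1 → k, _
    refine fun c => ⟨c 0, ?_⟩
    change (∑ t : Fin 1, _ : A) - _ ∈ _
    simp

lemma isSplit : Q.IsSplit k where
  off _ _ a hij := Q.e_mul_mul_e_mem_jacobson hA hij a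
  diag := Q.exists_sub_smul_e_mem_jacobson hA

lemma finrank_proj (j : Fin 4) : Module.finrank k (Q.proj j) = ![12, 8, 8, 4] j := by
  have : Module.Finite k A := Module.finite_of_finrank_pos (by omega)
  have := finite_of_tower k (Q.proj j)
  rw [Q.finrank_eq_sum_dim k]
  simp_rw [Q.finrank_part_proj, Q.finrank_corner hA]
  clear this
  revert j
  decide

end Dimension

end QuiverFrame

section SupQuotient

variable {A : Type*} [Ring A] {M : Type*} [AddCommGroup M] [Module A M]

lemma nonempty_sup_quotient_equiv {U U' V V' : Submodule A M} (hU : U' ≤ U) (hV : V' ≤ V)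
    (h : U ⊓ V ≤ U' ⊓ V') :
    Nonempty ((↥(U ⊔ V) ⧸ (U' ⊔ V').submoduleOf (U ⊔ V)) ≃ₗ[A]
      (U ⧸ U'.submoduleOf U) × (V ⧸ V'.submoduleOf V)) := by
  let f : (U ⧸ U'.submoduleOf U) →ₗ[A] (↥(U ⊔ V) ⧸ (U' ⊔ V').submoduleOf (U ⊔ V)) :=
    Submodule.mapQ _ _ (Submodule.inclusion le_sup_left) fun x hx => Submodule.mem_sup_left hx
  let g : (V ⧸ V'.submoduleOf V) →ₗ[A] (↥(U ⊔ V) ⧸ (U' ⊔ V').submoduleOf (U ⊔ V)) :=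
    Submodule.mapQ _ _ (Submodule.inclusion le_sup_right) fun x hx => Submodule.mem_sup_right hx
  refine ⟨(LinearEquiv.ofBijective (f.coprod g) ⟨?_, ?_⟩).symm⟩
  · rw [← LinearMap.ker_eq_bot, LinearMap.ker_eq_bot']
    rintro ⟨x, y⟩ hxy
    obtain ⟨x, rfl⟩ := Submodule.Quotient.mk_surjective _ x
    obtain ⟨y, rfl⟩ := Submodule.Quotient.mk_surjective _ y
    have hmem : (x : M) + y ∈ U' ⊔ V' := by
      rw [LinearMap.coprod_apply] at hxy
      exact (Submodule.Quotient.mk_eq_zero ((U' ⊔ V').submoduleOf (U ⊔ V))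
        (x := Submodule.inclusion le_sup_left x + Submodule.inclusion le_sup_right y)).mp hxy
    obtain ⟨u, hu, v, hv, huv⟩ := Submodule.mem_sup.mp hmem
    have hx : (x : M) - u ∈ U' ⊓ V' := h ⟨U.sub_mem x.2 (hU hu), by
      have : (x : M) - u = v - y := by rw [sub_eq_sub_iff_add_eq_add, ← huv, add_comm]
      rw [this]
      exact V.sub_mem (hV hv) y.2⟩
    have hy : (y : M) = v - (x - u) := by
      rw [eq_sub_iff_add_eq, add_comm, sub_add_eq_add_sub, sub_eq_iff_eq_add, ← huv, add_comm]
    refine Prod.ext ((Submodule.Quotient.mk_eq_zero _).mpr ?_)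
      ((Submodule.Quotient.mk_eq_zero _).mpr ?_)
    · change (x : M) ∈ U'
      simpa using U'.add_mem hx.1 hu
    · change (y : M) ∈ V'
      rw [hy]
      exact V'.sub_mem hv hx.2
  · intro z
    obtain ⟨⟨z, hz⟩, rfl⟩ := Submodule.Quotient.mk_surjective _ z
    obtain ⟨x, hx, y, hy, rfl⟩ := Submodule.mem_sup.mp hz
    exact ⟨(Submodule.Quotient.mk ⟨x, hx⟩, Submodule.Quotient.mk ⟨y, hy⟩), rfl⟩

lemma isSemisimpleModule_prod {N : Type*} [AddCommGroup N] [Module A N] [IsSemisimpleModule A M]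
    [IsSemisimpleModule A N] : IsSemisimpleModule A (M × N) := by
  have : IsSemisimpleModule A (⊤ : Submodule A (M × N)) := by
    rw [← LinearMap.sup_range_inl_inr]
    exact .sup (.range _) (.range _)
  exact IsSemisimpleModule.congr Submodule.topEquiv.symm

lemma radSeries_one : radSeries A M 1 = Module.jacobson A M :=
  Module.map_jacobson_of_bijective (f := (⊤ : Submodule A M).subtype)
    ⟨Subtype.val_injective, fun x => ⟨⟨x, Submodule.mem_top⟩, rfl⟩⟩

end SupQuotient

namespace QuiverFrame

section Swap

variable {A : Type*} [Ring A] (Q : QuiverFrame A)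

/-- The permutation of the summands that interchanges the labels `1` and `2`. -/
def swapIndex : Equiv.Perm (Fin 9) where
  toFun := ![0, 3, 4, 1, 2, 5, 6, 7, 8]
  invFun := ![0, 3, 4, 1, 2, 5, 6, 7, 8]
  left_inv := by decide
  right_inv := by decide

/-- The permutation that interchanges the labels `1` and `2`. -/
def swapLabel : Fin 4 → Fin 4 := ![0, 2, 1, 3]

lemma label_swapIndex : ∀ p, label (swapIndex p) = swapLabel (label p) := by decide

lemma swapLabel_swapLabel : ∀ i, swapLabel (swapLabel i) = i := by decide

lemma swapIndex_swapIndex : ∀ p, swapIndex (swapIndex p) = p := by decide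

/-- The frame in which the roles of the labels `1` and `2` are interchanged. -/
def swap : QuiverFrame A where
  e i := Q.e (swapLabel i)
  u p := Q.u (swapIndex p)
  v p := Q.v (swapIndex p)
  base i := swapIndex (Q.base (swapLabel i))
  σ_base i := by rw [label_swapIndex, Q.σ_base, swapLabel_swapLabel]
  u_base i := by rw [swapIndex_swapIndex, Q.u_base]
  v_base i := by rw [swapIndex_swapIndex, Q.v_base]
  v_mul_u p q := by
    rw [Q.v_mul_u, label_swapIndex]
    simp only [EmbeddingLike.apply_eq_iff_eq]
  sum_u_mul_v := by
    rw [← Q.sum_u_mul_v]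
    exact Equiv.sum_comp swapIndex fun p => Q.u p * Q.v p
  α := Q.γ
  β := Q.δ
  γ := Q.α
  δ := Q.β
  e_α := Q.e_γ
  α_e := Q.γ_e
  e_β := Q.e_δ
  β_e := Q.δ_e
  e_γ := Q.e_α
  γ_e := Q.α_e
  e_δ := Q.e_β
  δ_e := Q.β_e
  α_β := Q.γ_δ
  γ_δ := Q.α_β
  β_α_δ_γ := Q.β_α_δ_γ.symm
  δ_γ_β_α_ne_zero := Q.β_α_δ_γ ▸ Q.δ_γ_β_α_ne_zero
  α_δ_γ_β_ne_zero := Q.γ_β_α_δ_ne_zero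
  γ_β_α_δ_ne_zero := Q.α_δ_γ_β_ne_zero
  e_ne_zero i := Q.e_ne_zero _

end Swap

/-! ### The uniserial modules -/

section Arm

variable {A : Type*} [Ring A] (Q : QuiverFrame A)

/-- The initial segments of the path `αδγβ`. -/
def word : ℕ → A
  | 0 => Q.e 1
  | 1 => Q.β
  | 2 => Q.γ * Q.β
  | 3 => Q.δ * (Q.γ * Q.β)
  | 4 => Q.α * (Q.δ * (Q.γ * Q.β))
  | _ => 0

/-- The endpoints of the initial segments of the path `αδγβ`. -/
def wordLabel : ℕ → Fin 4
  | 0 => 1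
  | 1 => 0
  | 2 => 2
  | 3 => 0
  | _ => 1

lemma e_mul_word (t : ℕ) (ht : t < 5) : Q.e (wordLabel t) * Q.word t = Q.word t := by
  interval_cases t <;> simp [word, wordLabel]

lemma word_ne_zero (t : ℕ) (ht : t < 5) : Q.word t ≠ 0 := by
  have h := Q.α_δ_γ_β_ne_zero
  interval_cases t <;> simp only [word]
  · exact Q.e_ne_zero 1
  all_goals
    intro h'
    simp [h'] at h

lemma word_mul_e (t : ℕ) : Q.word t * Q.e 1 = Q.word t := by
  unfold word
  split <;> simp [mul_assoc]

lemma span_word_zero_smul_gen : Submodule.span A {Q.word 0 • Q.gen 1} = ⊤ := by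
  rw [show Q.word 0 • Q.gen 1 = Q.gen 1 from Q.e_smul_gen 1, Q.span_gen]

variable {k : Type*} [Field k] [Algebra k A] (hA : Module.finrank k A = 60)
  {M : Type*} [AddCommGroup M] [Module A M]

include hA

lemma exists_word_succ (t : ℕ) (ht : t < 5) :
    ∃ a ∈ Ring.jacobson A, Q.word (t + 1) = a * Q.word t := by
  interval_cases t
  · exact ⟨Q.β, Q.β_mem_jacobson hA, Q.β_e.symm⟩
  · exact ⟨Q.γ, Q.γ_mem_jacobson hA, rfl⟩
  · exact ⟨Q.δ, Q.δ_mem_jacobson hA, rfl⟩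
  · exact ⟨Q.α, Q.α_mem_jacobson hA, rfl⟩
  · exact ⟨0, Ideal.zero_mem _, by simp [word]⟩

variable [Module k M] [IsScalarTower k A M]

lemma isRadChain {n : ℕ} (hn : n ≤ 5) {x : M} (hx : Q.e 1 • x = x)
    (hne : ∀ t < n, Q.word t • x ≠ 0) (h0 : Q.word n • x = 0)
    (hfin : Module.finrank k (Submodule.span A {x}) ≤
      ∑ t ∈ Finset.range n, IdempotentFrame.dim label (wordLabel t)) :
    Q.IsRadChain k n (fun t => Q.word t • x) wordLabel where
  homogeneous t ht := by rw [← mul_smul, Q.e_mul_word t (by omega)]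
  ne_zero := hne
  eq_zero := h0
  step t ht := by
    obtain ⟨a, ha, h⟩ := Q.exists_word_succ hA t (by omega)
    simp only [h, mul_smul]
    exact smul_mem_jacobson_smul_span ha _
  finrank_le := by
    rwa [show Q.word 0 • x = x from hx]

lemma isRadChain_proj :
    Q.IsRadChain k 5 (fun t => Q.word t • Q.gen 1) wordLabel := by
  refine Q.isRadChain hA le_rfl (Q.e_smul_gen 1) (fun t ht h => Q.word_ne_zero t ht ?_)
    (by simp [word]) ?_
  · rw [← Q.word_mul_e]
    exact congrArg Subtype.val h
  · rw [Q.span_gen, show Module.finrank k (⊤ : Submodule A (Q.proj 1)) = Module.finrank k (Q.proj 1)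
      from (Submodule.topEquiv.restrictScalars k).finrank_eq, Q.finrank_proj hA]
    decide

lemma ker_homOfVector_eq {x : M} (hx : Q.e 1 • x = x)
    (hspan : Submodule.span A {x} = ⊤)
    (hM : Module.finrank k M = 5) :
    LinearMap.ker (Q.homOfVector 1 x) = Submodule.span A {Q.word 3 • Q.gen 1} := by
  have : Module.Finite k A := Module.finite_of_finrank_pos (by omega)
  have := finite_of_tower k (Q.proj 1)
  have h := Q.isRadChain_proj hA
  obtain ⟨s, -, hs, hker⟩ := h.exists_eq_span_of_le (Nat.zero_le 5)
    (N := LinearMap.ker (Q.homOfVector 1 x)) (by rw [Q.span_word_zero_smul_gen]; exact le_top)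
  rw [hker]
  have h1 := h.finrank_eq hs
  rw [← hker] at h1
  have hsurj : Function.Surjective (Q.homOfVector 1 x) := by
    rw [← LinearMap.range_eq_top, Q.range_homOfVector hx, hspan]
  have h2 := finrank_quotient_add_of_tower k (LinearMap.ker (Q.homOfVector 1 x))
  rw [(((Q.homOfVector 1 x).quotKerEquivOfSurjective hsurj).restrictScalars k).finrank_eq, hM,
    Q.finrank_proj hA, h1] at h2
  have : s = 3 := by
    revert h2
    clear h1 hker
    revert s
    decide
  rw [this]

lemma isRadChain_of_finrank_eq [Module.Finite k M] {x : M} (hx : Q.e 1 • x = x)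
    (hspan : Submodule.span A {x} = ⊤)
    (hM : Module.finrank k M = 5) :
    Q.IsRadChain k 3 (fun t => Q.word t • x) wordLabel := by
  have : Module.Finite k A := Module.finite_of_finrank_pos (by omega)
  have := finite_of_tower k (Q.proj 1)
  have h := Q.isRadChain_proj hA
  have hker := Q.ker_homOfVector_eq hA hx hspan hM
  have hiff (t : ℕ) : Q.word t • x = 0 ↔
      Q.word t • Q.gen 1 ∈ Submodule.span A {Q.word 3 • Q.gen 1} := by
    rw [← hker, LinearMap.mem_ker, map_smul, Q.homOfVector_apply]
    change _ ↔ Q.word t • Q.e 1 • x = 0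
    rw [hx]
  refine Q.isRadChain hA (by norm_num) hx (fun t ht h0 => ?_)
    ((hiff 3).mpr (Submodule.mem_span_singleton_self _)) ?_
  · have h1 := (Submodule.span_singleton_le_iff_mem _ _).mpr ((hiff t).mp h0)
    have h2 := finrank_mono_of_tower k h1
    rw [h.finrank_eq (t := t) (by omega), h.finrank_eq (t := 3) (by omega)] at h2
    revert h2
    clear h0 h1
    revert t
    decide
  · rw [hspan, (Submodule.topEquiv.restrictScalars k).finrank_eq, hM]
    decide

lemma nonempty_equiv_of_finrank_eq {x : M} (hx : Q.e 1 • x = x)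
    (hspan : Submodule.span A {x} = ⊤) (hM : Module.finrank k M = 5)
    {M' : Type*} [AddCommGroup M'] [Module A M'] [Module k M'] [IsScalarTower k A M']
    {x' : M'} (hx' : Q.e 1 • x' = x') (hspan' : Submodule.span A {x'} = ⊤)
    (hM' : Module.finrank k M' = 5) : Nonempty (M ≃ₗ[A] M') := by
  have hsurj : Function.Surjective (Q.homOfVector 1 x) := by
    rw [← LinearMap.range_eq_top, Q.range_homOfVector hx, hspan]
  have hsurj' : Function.Surjective (Q.homOfVector 1 x') := by
    rw [← LinearMap.range_eq_top, Q.range_homOfVector hx', hspan']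
  exact ⟨((Q.homOfVector 1 x).quotKerEquivOfSurjective hsurj).symm ≪≫ₗ
    Submodule.quotEquivOfEq _ _ ((Q.ker_homOfVector_eq hA hx hspan hM).trans
      (Q.ker_homOfVector_eq hA hx' hspan' hM').symm) ≪≫ₗ
    (Q.homOfVector 1 x').quotKerEquivOfSurjective hsurj'⟩

end Arm

end QuiverFrame

namespace QuiverFrame

/-! ### The projective module with label `0` -/

section Trivial

variable {k A : Type*} [Field k] [Ring A] [Algebra k A] (Q : QuiverFrame A)

/-- The arrow `α` as a vector of the projective module with label `0`. -/
def αVec : Q.proj 0 := ⟨Q.α, Q.mem_proj_iff.mpr Q.α_e⟩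

/-- The `t`-th term of the radical series of the submodule generated by `α`. -/
def arm (t : ℕ) : Submodule A (Q.proj 0) := Submodule.span A {Q.word t • Q.αVec}

/-- The `t`-th term of the radical series of the submodule generated by `γ`. -/
def coarm (t : ℕ) : Submodule A (Q.proj 0) := Q.swap.arm t

/-- A vector that spans the socle of the projective module with label `0`. -/
def socVec : Q.proj 0 :=
  ⟨Q.δ * (Q.γ * (Q.β * Q.α)), Q.mem_proj_iff.mpr (by simp [mul_assoc])⟩

lemma arm_three : Q.arm 3 = Submodule.span A {Q.socVec} := by
  rw [arm]
  congr 2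
  exact Subtype.ext (by simp [αVec, word, socVec, mul_assoc])

lemma swap_socVec : (Q.swap.socVec : Q.proj 0) = Q.socVec := Subtype.ext Q.β_α_δ_γ

lemma coarm_three : Q.coarm 3 = Submodule.span A {Q.socVec} :=
  Q.swap.arm_three.trans (congrArg (fun x : Q.proj 0 => Submodule.span A {x}) Q.swap_socVec)

lemma arm_four : Q.arm 4 = ⊥ := by
  rw [arm, Submodule.span_singleton_eq_bot]
  exact Subtype.ext (by simp [αVec, word, mul_assoc])

lemma e_smul_αVec : Q.e 1 • Q.αVec = Q.αVec := Subtype.ext Q.e_α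

variable (hA : Module.finrank k A = 60)

include hA

lemma finrank_span_αVec_le : Module.finrank k (Submodule.span A {Q.αVec}) ≤ 6 := by
  have : Module.Finite k A := Module.finite_of_finrank_pos (by omega)
  have := finite_of_tower k (Q.proj 1)
  have h1 : Submodule.span A {Q.word 4 • Q.gen 1} ≤ LinearMap.ker (Q.homOfVector 1 Q.αVec) := by
    rw [Submodule.span_singleton_le_iff_mem, LinearMap.mem_ker]
    exact Subtype.ext (by simp [IdempotentFrame.gen, word, αVec, mul_assoc])
  have h2 := finrank_mono_of_tower k h1
  rw [(Q.isRadChain_proj hA).finrank_eq (t := 4) (by norm_num)] at h2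
  have h3 := finrank_quotient_add_of_tower k (LinearMap.ker (Q.homOfVector 1 Q.αVec))
  rw [((Q.homOfVector 1 Q.αVec).quotKerEquivRange.restrictScalars k).finrank_eq,
    Q.range_homOfVector Q.e_smul_αVec, Q.finrank_proj hA] at h3
  rw [show ∑ s ∈ Finset.Ico 4 5, IdempotentFrame.dim label (wordLabel s) = 2 by decide] at h2
  simp only [Matrix.cons_val] at h3
  omega

lemma isRadChain_arm : Q.IsRadChain k 4 (fun t => Q.word t • Q.αVec) wordLabel := by
  refine Q.isRadChain hA (by norm_num) Q.e_smul_αVec (fun t ht h => ?_) ?_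
    ((Q.finrank_span_αVec_le hA).trans (by decide))
  · have h := congrArg Subtype.val h
    have hs := Q.δ_γ_β_α_ne_zero
    interval_cases t <;> simp [αVec, word, mul_assoc] at h <;> simp [h] at hs
  · exact Subtype.ext (by simp [αVec, word, mul_assoc])

lemma finrank_arm {t : ℕ} (ht : t ≤ 4) : Module.finrank k (Q.arm t) =
    ∑ s ∈ Finset.Ico t 4, IdempotentFrame.dim label (wordLabel s) := by
  have : Module.Finite k A := Module.finite_of_finrank_pos (by omega)
  have := finite_of_tower k (Q.proj 0)
  exact (Q.isRadChain_arm hA).finrank_eq ht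

lemma arm_succ_le {t : ℕ} (ht : t < 4) : Q.arm (t + 1) ≤ Q.arm t :=
  (Q.isRadChain_arm hA).span_le ht

lemma arm_antitone {s t : ℕ} (hst : s ≤ t) (ht : t ≤ 4) : Q.arm t ≤ Q.arm s :=
  (Q.isRadChain_arm hA).span_antitone hst ht

lemma isTop_arm {t : ℕ} (ht : t < 4) :
    Q.IsTop (wordLabel t) (Q.arm t ⧸ (Q.arm (t + 1)).submoduleOf (Q.arm t)) := by
  have : Module.Finite k A := Module.finite_of_finrank_pos (by omega)
  have := finite_of_tower k (Q.proj 0)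
  exact (Q.isRadChain_arm hA).isTop ht

lemma jacobson_smul_arm {t : ℕ} (ht : t < 4) : Ring.jacobson A • Q.arm t = Q.arm (t + 1) := by
  have : Module.Finite k A := Module.finite_of_finrank_pos (by omega)
  have := finite_of_tower k (Q.proj 0)
  exact (Q.isRadChain_arm hA).jacobson_smul ht

lemma exists_eq_arm {N : Submodule A (Q.proj 0)} (hN : N ≤ Q.arm 0) :
    ∃ t ≤ 4, N = Q.arm t := by
  have : Module.Finite k A := Module.finite_of_finrank_pos (by omega)
  have := finite_of_tower k (Q.proj 0)
  obtain ⟨t, -, h⟩ := (Q.isRadChain_arm hA).exists_eq_span_of_le (Nat.zero_le 4) hN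
  exact ⟨t, h⟩

lemma finrank_coarm {t : ℕ} (ht : t ≤ 4) : Module.finrank k (Q.coarm t) =
    ∑ s ∈ Finset.Ico t 4, IdempotentFrame.dim label (wordLabel s) := Q.swap.finrank_arm hA ht

lemma coarm_antitone {s t : ℕ} (hst : s ≤ t) (ht : t ≤ 4) : Q.coarm t ≤ Q.coarm s :=
  Q.swap.arm_antitone hA hst ht

lemma isTop_coarm {t : ℕ} (ht : t < 4) :
    Q.IsTop (swapLabel (wordLabel t)) (Q.coarm t ⧸ (Q.coarm (t + 1)).submoduleOf (Q.coarm t)) :=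
  Q.swap.isTop_arm hA ht

lemma jacobson_smul_coarm {t : ℕ} (ht : t < 4) :
    Ring.jacobson A • Q.coarm t = Q.coarm (t + 1) := Q.swap.jacobson_smul_arm hA ht

lemma exists_eq_coarm {N : Submodule A (Q.proj 0)} (hN : N ≤ Q.coarm 0) :
    ∃ t ≤ 4, N = Q.coarm t := Q.swap.exists_eq_arm hA hN

lemma coarm_inf_arm : Q.coarm 0 ⊓ Q.arm 0 = Submodule.span A {Q.socVec} := by
  obtain ⟨s, hs, h⟩ := Q.exists_eq_arm hA (N := Q.coarm 0 ⊓ Q.arm 0) inf_le_right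
  rw [h, ← arm_three]
  have h3 : Q.arm 3 ≤ Q.arm s := by
    rw [← h]
    refine le_inf ?_ (Q.arm_antitone hA (by norm_num) (by norm_num))
    rw [arm_three, ← coarm_three]
    exact Q.coarm_antitone hA (by norm_num) (by norm_num)
  refine le_antisymm ?_ h3
  by_cases hs2 : s ≤ 2
  · exfalso
    have h2 : Q.arm 2 ≤ Q.coarm 0 := by
      refine (Q.arm_antitone hA hs2 (by norm_num)).trans ?_
      rw [← h]
      exact inf_le_left
    obtain ⟨t, ht, h2⟩ := Q.exists_eq_coarm hA h2
    have hfin := congrArg (fun N : Submodule A (Q.proj 0) => Module.finrank k N) h2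
    have ht2 : t = 2 := by
      simp only [Q.finrank_arm hA (t := 2) (by norm_num), Q.finrank_coarm hA ht] at hfin
      clear h2
      revert t
      decide
    subst ht2
    have h4 : Q.arm 3 = Q.coarm 3 := by rw [arm_three, coarm_three]
    have top1 := Q.isTop_arm hA (t := 2) (by norm_num)
    have top2 := Q.isTop_coarm hA (t := 2) (by norm_num)
    rw [← h4, ← h2] at top2
    exact absurd ((Q.isSplit hA).label_unique top1 top2) (by decide)
  · exact Q.arm_antitone hA (by omega) hs

lemma coarm_inf_arm_le {s t : ℕ} (hs : s ≤ 4) (ht : t ≤ 3) :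
    Q.coarm s ⊓ Q.arm s ≤ Q.coarm t ⊓ Q.arm t := by
  refine (inf_le_inf (Q.coarm_antitone hA (Nat.zero_le s) hs)
    (Q.arm_antitone hA (Nat.zero_le s) hs)).trans ?_
  rw [Q.coarm_inf_arm hA]
  refine le_inf ?_ ?_
  · rw [← coarm_three]
    exact Q.coarm_antitone hA ht (by norm_num)
  · rw [← arm_three]
    exact Q.arm_antitone hA ht (by norm_num)

lemma nonempty_arms_quotient_equiv {s t : ℕ} (hst : s ≤ t) (ht : t ≤ 3) :
    Nonempty ((↥(Q.coarm s ⊔ Q.arm s) ⧸ (Q.coarm t ⊔ Q.arm t).submoduleOf (Q.coarm s ⊔ Q.arm s))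
      ≃ₗ[A] (Q.coarm s ⧸ (Q.coarm t).submoduleOf (Q.coarm s)) ×
        (Q.arm s ⧸ (Q.arm t).submoduleOf (Q.arm s))) :=
  nonempty_sup_quotient_equiv (Q.coarm_antitone hA hst (by omega))
    (Q.arm_antitone hA hst (by omega)) (Q.coarm_inf_arm_le hA (by omega) ht)

lemma finrank_arms : Module.finrank k ↥(Q.coarm 0 ⊔ Q.arm 0) = 11 := by
  have : Module.Finite k A := Module.finite_of_finrank_pos (by omega)
  have := finite_of_tower k (Q.proj 0)
  have h := Submodule.finrank_sup_add_finrank_inf_eq ((Q.coarm 0).restrictScalars k)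
    ((Q.arm 0).restrictScalars k)
  rw [← Submodule.restrictScalars_sup, ← Submodule.restrictScalars_inf, Q.coarm_inf_arm hA,
    ← arm_three] at h
  change Module.finrank k ↥(Q.coarm 0 ⊔ Q.arm 0) + Module.finrank k (Q.arm 3) =
    Module.finrank k (Q.coarm 0) + Module.finrank k (Q.arm 0) at h
  rw [Q.finrank_arm hA (by norm_num), Q.finrank_arm hA (by norm_num),
    Q.finrank_coarm hA (by norm_num)] at h
  have h1 : ∑ s ∈ Finset.Ico 3 4, IdempotentFrame.dim label (wordLabel s) = 1 := by decide
  have h2 : ∑ s ∈ Finset.Ico 0 4, IdempotentFrame.dim label (wordLabel s) = 6 := by decide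
  omega

lemma arms_le_jacobson_smul_top :
    Q.coarm 0 ⊔ Q.arm 0 ≤ Ring.jacobson A • (⊤ : Submodule A (Q.proj 0)) := by
  have hle {x : A} (hx : x ∈ Ring.jacobson A) (y : Q.proj 0) (hy : x * Q.e 0 = y) :
      y ∈ Ring.jacobson A • (⊤ : Submodule A (Q.proj 0)) := by
    have : y = x • Q.gen 0 := Subtype.ext hy.symm
    rw [this]
    exact Submodule.smul_mem_smul hx Submodule.mem_top
  refine sup_le ?_ ?_
  · refine (Submodule.span_singleton_le_iff_mem _ _).mpr (Submodule.smul_mem _ _ ?_)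
    exact hle (Q.γ_mem_jacobson hA) Q.swap.αVec Q.γ_e
  · refine (Submodule.span_singleton_le_iff_mem _ _).mpr (Submodule.smul_mem _ _ ?_)
    exact hle (Q.α_mem_jacobson hA) Q.αVec Q.α_e

lemma radSeries_proj_zero_one : radSeries A (Q.proj 0) 1 = Q.coarm 0 ⊔ Q.arm 0 := by
  have : Module.Finite k A := Module.finite_of_finrank_pos (by omega)
  have := finite_of_tower k (Q.proj 0)
  have := finite_of_tower k (⊤ : Submodule A (Q.proj 0))
  have h11 := Q.finrank_arms hA
  have h1 : Module.finrank k ((⊤ : Submodule A (Q.proj 0)) ⧸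
      (Q.coarm 0 ⊔ Q.arm 0).submoduleOf ⊤) = 1 := by
    have h := finrank_submoduleOf_add k (le_top (a := Q.coarm 0 ⊔ Q.arm 0))
    rw [(Submodule.topEquiv.restrictScalars k).finrank_eq, Q.finrank_proj hA, h11] at h
    simp only [Matrix.cons_val] at h
    omega
  have : Q.IsTop 0 ((⊤ : Submodule A (Q.proj 0)) ⧸ (Q.coarm 0 ⊔ Q.arm 0).submoduleOf ⊤) := by
    refine Q.isTop_of_finrank_eq k (x := Submodule.Quotient.mk ⟨Q.gen 0, Submodule.mem_top⟩)
      ?_ ?_ h1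
    · rw [Ne, Submodule.Quotient.mk_eq_zero]
      intro h
      have : (⊤ : Submodule A (Q.proj 0)) ≤ Q.coarm 0 ⊔ Q.arm 0 := by
        rw [← Q.span_gen, Submodule.span_singleton_le_iff_mem]
        exact h
      rw [top_le_iff.mp this, (Submodule.topEquiv.restrictScalars k).finrank_eq,
        Q.finrank_proj hA] at h11
      simp at h11
    · rw [← Submodule.Quotient.mk_smul]
      congr 1
      exact Subtype.ext (Q.e_smul_gen 0)
  have := this.1
  exact radSeries_succ_eq (N := ⊤) rfl le_top (Q.arms_le_jacobson_smul_top hA) inferInstance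

lemma isSemisimple_arms_quotient {t : ℕ} (ht : t ≤ 2) :
    IsSemisimpleModule A (↥(Q.coarm t ⊔ Q.arm t) ⧸
      (Q.coarm (t + 1) ⊔ Q.arm (t + 1)).submoduleOf (Q.coarm t ⊔ Q.arm t)) := by
  obtain ⟨f⟩ := Q.nonempty_arms_quotient_equiv hA (s := t) (t := t + 1) (by omega) (by omega)
  have := (Q.isTop_arm hA (t := t) (by omega)).1
  have := (Q.isTop_coarm hA (t := t) (by omega)).1
  have := isSemisimpleModule_prod (A := A)
    (M := Q.coarm t ⧸ (Q.coarm (t + 1)).submoduleOf (Q.coarm t))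
    (N := Q.arm t ⧸ (Q.arm (t + 1)).submoduleOf (Q.arm t))
  exact IsSemisimpleModule.congr f

lemma radSeries_proj_zero_succ {t : ℕ} (ht : t ≤ 3) :
    radSeries A (Q.proj 0) (t + 1) = Q.coarm t ⊔ Q.arm t := by
  induction t with
  | zero => exact Q.radSeries_proj_zero_one hA
  | succ t ih =>
    refine radSeries_succ_eq (ih (by omega)) (sup_le_sup (Q.coarm_antitone hA (by omega) (by omega))
      (Q.arm_antitone hA (by omega) (by omega))) ?_ (Q.isSemisimple_arms_quotient hA (by omega))
    rw [Submodule.smul_sup, Q.jacobson_smul_arm hA (by omega), Q.jacobson_smul_coarm hA (by omega)]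

lemma radSeries_proj_zero_four : radSeries A (Q.proj 0) 4 = Q.arm 3 := by
  rw [Q.radSeries_proj_zero_succ hA le_rfl, coarm_three, arm_three, sup_idem]

lemma radSeries_proj_zero_five : radSeries A (Q.proj 0) 5 = ⊥ := by
  have := (Q.isTop_arm hA (t := 3) (by omega)).1
  rw [← Q.arm_four]
  exact radSeries_succ_eq (Q.radSeries_proj_zero_four hA) (Q.arm_succ_le hA (by norm_num))
    (Q.jacobson_smul_arm hA (by norm_num)).ge inferInstance

lemma isTop_radLayer_proj_zero_four : Q.IsTop 0 (RadLayer A (Q.proj 0) 4) := by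
  change Q.IsTop 0 (radSeries A (Q.proj 0) 4 ⧸
    (radSeries A (Q.proj 0) 5).submoduleOf (radSeries A (Q.proj 0) 4))
  rw [Q.radSeries_proj_zero_five hA, Q.radSeries_proj_zero_four hA, ← Q.arm_four]
  exact Q.isTop_arm hA (t := 3) (by norm_num)

lemma nonempty_radLayer_proj_zero_equiv {t : ℕ} (ht : t ≤ 2) :
    Nonempty (RadLayer A (Q.proj 0) (t + 1) ≃ₗ[A]
      (Q.coarm t ⧸ (Q.coarm (t + 1)).submoduleOf (Q.coarm t)) ×
        (Q.arm t ⧸ (Q.arm (t + 1)).submoduleOf (Q.arm t))) := by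
  change Nonempty ((radSeries A (Q.proj 0) (t + 1) ⧸
    (radSeries A (Q.proj 0) (t + 2)).submoduleOf (radSeries A (Q.proj 0) (t + 1))) ≃ₗ[A] _)
  rw [Q.radSeries_proj_zero_succ hA (t := t + 1) (by omega),
    Q.radSeries_proj_zero_succ hA (t := t) (by omega)]
  exact Q.nonempty_arms_quotient_equiv hA (Nat.le_succ t) (by omega)

lemma jacobson_proj_zero : Module.jacobson A (Q.proj 0) = Q.coarm 0 ⊔ Q.arm 0 := by
  rw [← radSeries_one, Q.radSeries_proj_zero_one hA]

lemma isTop_arm_three : Q.IsTop 0 (Q.arm 3) := by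
  have : Module.Finite k A := Module.finite_of_finrank_pos (by omega)
  have := finite_of_tower k (Q.proj 0)
  have := finite_of_tower k (Q.arm 3)
  refine Q.isTop_of_finrank_eq k (x := ⟨Q.socVec, by
    rw [arm_three]; exact Submodule.mem_span_singleton_self _⟩) ?_ ?_ ?_
  · intro h
    exact Q.δ_γ_β_α_ne_zero (congrArg (fun x : Q.arm 3 => ((x : Q.proj 0) : A)) h)
  · exact Subtype.ext (Subtype.ext (Q.e_δ_assoc _))
  · rw [Q.finrank_arm hA (by norm_num)]
    decide

lemma mem_arm_three {i : Fin 4} {x : Q.proj 0} (hx : Q.e i • x = x)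
    (hJ : ∀ a ∈ Ring.jacobson A, a • x = 0) : x ∈ Q.arm 3 := by
  have hc : (x : A) ∈ Q.corner k i 0 := ⟨congrArg Subtype.val hx, Q.mem_proj_iff.mp x.2⟩
  have hJ' (a : A) (ha : a ∈ Ring.jacobson A) : a * (x : A) = 0 := congrArg Subtype.val (hJ a ha)
  have hmem (h : ∃ d : k, (x : A) = d • (Q.δ * (Q.γ * (Q.β * Q.α)))) : x ∈ Q.arm 3 := by
    obtain ⟨d, hd⟩ := h
    rw [arm_three, Submodule.mem_span_singleton]
    exact ⟨algebraMap k A d, Subtype.ext (by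
      rw [hd, Algebra.smul_def]
      rfl)⟩
  apply hmem
  clear hmem hJ hx
  generalize (x : A) = x at *
  fin_cases i
  · obtain ⟨a, b, c, d, rfl⟩ := Q.exists_of_mem_corner_zero_zero hA hc
    have h1 := hJ' _ (Ideal.mul_mem_right Q.γ _ (Q.δ_mem_jacobson hA))
    obtain ⟨rfl, rfl⟩ := δ_γ_coeffs_eq_zero (Q := Q) (by simpa [mul_add, mul_assoc] using h1)
    have h2 := hJ' _ (Ideal.mul_mem_right Q.α _ (Q.β_mem_jacobson hA))
    have hc : c = 0 := by simpa [mul_add, mul_assoc, Q.δ_γ_β_α_ne_zero] using h2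
    exact ⟨d, by simp [hc]⟩
  · obtain ⟨a, b, rfl⟩ := Q.exists_of_mem_corner_one_zero hA hc
    obtain ⟨rfl, rfl⟩ := β_α_coeffs_eq_zero (Q := Q) (by
      simpa [mul_add, mul_assoc] using hJ' _ (Q.β_mem_jacobson hA))
    exact ⟨0, by simp⟩
  · obtain ⟨a, b, rfl⟩ := Q.exists_of_mem_corner_two_zero hA hc
    obtain ⟨rfl, rfl⟩ := δ_γ_coeffs_eq_zero (Q := Q) (by
      simpa [mul_add, mul_assoc] using hJ' _ (Q.δ_mem_jacobson hA))
    exact ⟨0, by simp⟩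
  · exact ⟨0, by simpa using Q.eq_zero_of_mem_corner hA (by decide) hc⟩

lemma moduleSocle_proj_zero : moduleSocle A (Q.proj 0) = Q.arm 3 := by
  refine le_antisymm (sSup_le fun N hN => ?_) (le_sSup (Q.isTop_arm_three hA).1)
  have hN : IsSimpleModule A N := hN
  have := IsSimpleModule.nontrivial A N
  obtain ⟨i, x, h0, hx⟩ := Q.exists_homogeneous (M := N)
  have hmem : (x : Q.proj 0) ∈ Q.arm 3 := Q.mem_arm_three hA (congrArg Subtype.val hx)
    fun a ha => congrArg Subtype.val (smul_eq_zero_of_mem_jacobson ha x)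
  intro y hy
  obtain ⟨a, ha⟩ := Submodule.mem_span_singleton.mp
    (IsSimpleModule.span_singleton_eq_top A h0 ▸ Submodule.mem_top : (⟨y, hy⟩ : N) ∈ _)
  rw [show y = a • (x : Q.proj 0) from (congrArg Subtype.val ha).symm]
  exact Submodule.smul_mem _ _ hmem

lemma nonempty_moduleHeart_equiv : Nonempty (ModuleHeart A (Q.proj 0) ≃ₗ[A]
    (Q.coarm 0 ⧸ (Q.coarm 3).submoduleOf (Q.coarm 0)) ×
      (Q.arm 0 ⧸ (Q.arm 3).submoduleOf (Q.arm 0))) := by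
  change Nonempty ((Module.jacobson A (Q.proj 0) ⧸
    (moduleSocle A (Q.proj 0)).submoduleOf (Module.jacobson A (Q.proj 0))) ≃ₗ[A] _)
  have := Q.nonempty_arms_quotient_equiv hA (Nat.zero_le 3) le_rfl
  rwa [show Q.coarm 3 ⊔ Q.arm 3 = moduleSocle A (Q.proj 0) by
    rw [Q.moduleSocle_proj_zero hA, coarm_three, arm_three, sup_idem],
    ← Q.jacobson_proj_zero hA] at this

lemma moduleSocle_le_jacobson : moduleSocle A (Q.proj 0) ≤ Module.jacobson A (Q.proj 0) := by
  rw [Q.moduleSocle_proj_zero hA, Q.jacobson_proj_zero hA]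
  exact (Q.arm_antitone hA (by norm_num) (by norm_num)).trans le_sup_right

lemma nonempty_equiv_arm_quotient {M : Type*} [AddCommGroup M] [Module A M] [Module k M]
    [IsScalarTower k A M] {x : M} (hx : Q.e 1 • x = x)
    (hspan : Submodule.span A {x} = ⊤)
    (hM : Module.finrank k M = 5) :
    Nonempty ((Q.arm 0 ⧸ (Q.arm 3).submoduleOf (Q.arm 0)) ≃ₗ[A] M) := by
  have : Module.Finite k A := Module.finite_of_finrank_pos (by omega)
  have := finite_of_tower k (Q.proj 0)
  have h0 : Q.arm 0 = Submodule.span A {Q.αVec} := by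
    rw [arm, show Q.word 0 • Q.αVec = Q.αVec from Q.e_smul_αVec]
  have hα : Q.αVec ∈ Q.arm 0 := h0 ▸ Submodule.mem_span_singleton_self _
  refine Q.nonempty_equiv_of_finrank_eq hA (k := k)
    (x := Submodule.Quotient.mk (⟨Q.αVec, hα⟩ : Q.arm 0)) ?_ ?_ ?_ hx hspan hM
  · rw [← Submodule.Quotient.mk_smul]
    congr 1
    exact Subtype.ext Q.e_smul_αVec
  · refine eq_top_iff.mpr fun y _ => ?_
    obtain ⟨⟨y, hy⟩, rfl⟩ := Submodule.Quotient.mk_surjective _ y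
    obtain ⟨a, ha⟩ := Submodule.mem_span_singleton.mp (h0 ▸ hy)
    refine Submodule.mem_span_singleton.mpr ⟨a, ?_⟩
    rw [← Submodule.Quotient.mk_smul]
    congr 1
    exact Subtype.ext ha
  · have h := finrank_submoduleOf_add k
      (Q.arm_antitone hA (s := 0) (t := 3) (by norm_num) (by norm_num))
    rw [Q.finrank_arm hA (by norm_num), Q.finrank_arm hA (by norm_num)] at h
    have h1 : ∑ s ∈ Finset.Ico 3 4, IdempotentFrame.dim label (wordLabel s) = 1 := by decide
    have h2 : ∑ s ∈ Finset.Ico 0 4, IdempotentFrame.dim label (wordLabel s) = 6 := by decide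
    omega

end Trivial

end QuiverFrame

section Primitive

variable {A : Type*} [Ring A]

lemma eq_zero_of_isIdempotentElem_of_mem_jacobson {f : A} (hf : IsIdempotentElem f)
    (hJ : f ∈ Ring.jacobson A) : f = 0 := by
  by_contra h0
  refine notMem_jacobson_smul_span (A := A) h0 ?_
  have := smul_mem_jacobson_smul_span hJ f
  change f * f ∈ _ at this
  rwa [hf.eq] at this

lemma eq_and_eq_of_add_eq_add_of_disjoint {M : Type*} [AddCommGroup M] [Module A M]
    {N N' : Submodule A M} (h : Disjoint N N') {a a' b b' : M} (ha : a ∈ N) (ha' : a' ∈ N)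
    (hb : b ∈ N') (hb' : b' ∈ N') (hab : a + b = a' + b') : a = a' ∧ b = b' := by
  have hsub : a - a' = b' - b := by rw [sub_eq_sub_iff_add_eq_add, hab, add_comm]
  have hzero := Submodule.disjoint_def.mp h (a - a') (N.sub_mem ha ha')
    (hsub ▸ N'.sub_mem hb' hb)
  exact ⟨sub_eq_zero.mp hzero, (sub_eq_zero.mp (hsub ▸ hzero)).symm⟩

lemma IsPrimitiveIdempotent.isIndecomposableModule {f : A} (hf : IsPrimitiveIdempotent f) :
    IsIndecomposableModule A (Ideal.span {f}) := by
  obtain ⟨hidem, h0, hprim⟩ := hf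
  have hmem {a : A} (ha : a ∈ Ideal.span {f}) : a * f = a := by
    obtain ⟨b, rfl⟩ := Ideal.mem_span_singleton'.mp ha
    rw [mul_assoc, hidem]
  let g : Ideal.span {f} := ⟨f, Ideal.subset_span rfl⟩
  have hg (y : Ideal.span {f}) : y = (y : A) • g := Subtype.ext (hmem y.2).symm
  have hspan (N : Submodule A (Ideal.span {f})) (hN : g ∈ N) : N = ⊤ :=
    eq_top_iff.mpr fun y _ => by
      rw [hg y]
      exact N.smul_mem _ hN
  refine ⟨⟨⟨g, 0, fun h => h0 (congrArg Subtype.val h)⟩⟩, fun N N' hN => ?_⟩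
  obtain ⟨x, hx, y, hy, hxy⟩ := Submodule.mem_sup.mp
    (hN.sup_eq_top ▸ Submodule.mem_top : g ∈ N ⊔ N')
  have hsum : (x : A) + y = f := congrArg Subtype.val hxy
  obtain ⟨hxx, hxy'⟩ := eq_and_eq_of_add_eq_add_of_disjoint hN.disjoint
    (N.smul_mem (x : A) hx) hx (N'.smul_mem (x : A) hy) N'.zero_mem
    (by rw [← smul_add, hxy, ← hg, add_zero])
  obtain ⟨hyx, hyy⟩ := eq_and_eq_of_add_eq_add_of_disjoint hN.disjoint
    (N.smul_mem (y : A) hx) N.zero_mem (N'.smul_mem (y : A) hy) hy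
    (by rw [← smul_add, hxy, ← hg, zero_add])
  rcases hprim x y (congrArg Subtype.val hxx) (congrArg Subtype.val hyy)
    (congrArg Subtype.val hxy') (congrArg Subtype.val hyx) hsum.symm with h | h
  · left
    have hx0 : x = 0 := Subtype.ext h
    rw [hx0, zero_add] at hxy
    have := hspan N' (hxy ▸ hy)
    simpa [this] using hN.disjoint
  · right
    have hy0 : y = 0 := Subtype.ext h
    rw [hy0, add_zero] at hxy
    have := hspan N (hxy ▸ hx)
    simpa [this] using hN.disjoint.symm

lemma IsPrimitiveIdempotent.eq_of_mul_eq {R : Type*} [CommRing R] {x y : R}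
    (hx : IsPrimitiveIdempotent x) (hy : IsIdempotentElem y) (hy0 : y ≠ 0) (hxy : x * y = y) :
    y = x := by
  have hsub : IsIdempotentElem (x - y) := by
    rw [IsIdempotentElem]
    linear_combination hx.1.eq - 2 * hxy + hy.eq
  refine (sub_eq_zero.mp ((hx.2.2 y (x - y) hy hsub ?_ ?_ ?_).resolve_left hy0)).symm
  · rw [mul_sub, hy, mul_comm, hxy, sub_self]
  · rw [sub_mul, hy, hxy, sub_self]
  · rw [add_sub_cancel]

lemma IsPrimitiveIdempotent.eq_or_eq_of_add_eq_one {R : Type*} [CommRing R] {x y z : R}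
    (hx : IsPrimitiveIdempotent x) (hy : IsPrimitiveIdempotent y) (hmul : x * y = 0)
    (hadd : x + y = 1) (hz : IsPrimitiveIdempotent z) : z = x ∨ z = y := by
  have hdec : z = z * x + z * y := by rw [← mul_add, hadd, mul_one]
  rcases hz.2.2 (z * x) (z * y) (hz.1.mul hx.1) (hz.1.mul hy.1)
    (by linear_combination z * z * hmul) (by linear_combination z * z * hmul) hdec with h | h
  · exact .inr (hy.eq_of_mul_eq hz.1 hz.2.1 (by linear_combination -hdec - h))
  · exact .inl (hx.eq_of_mul_eq hz.1 hz.2.1 (by linear_combination -hdec - h))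

lemma eq_or_eq_of_isBlockIdempotent {e₁ e₂ f : A} (h₁ : IsBlockIdempotent e₁)
    (h₂ : IsBlockIdempotent e₂) (hmul : e₁ * e₂ = 0) (hadd : e₁ + e₂ = 1)
    (hf : IsBlockIdempotent f) : f = e₁ ∨ f = e₂ := by
  obtain ⟨z₁, rfl, h₁⟩ := h₁
  obtain ⟨z₂, rfl, h₂⟩ := h₂
  obtain ⟨z, rfl, hz⟩ := hf
  exact (h₁.eq_or_eq_of_add_eq_one h₂ (Subtype.ext hmul) (Subtype.ext hadd) hz).imp
    (congrArg Subtype.val) (congrArg Subtype.val)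

lemma isBlockIdempotent_of_forall {b : A} (hb : IsIdempotentElem b) (h0 : b ≠ 0)
    (hcomm : ∀ a, b * a = a * b)
    (h : ∀ z : A, IsIdempotentElem z → (∀ a, z * a = a * z) → z * b = 0 ∨ (1 - z) * b = 0) :
    IsBlockIdempotent b := by
  refine ⟨⟨b, Subring.mem_center_iff.mpr fun a => (hcomm a).symm⟩, rfl, Subtype.ext hb,
    fun h => h0 (congrArg Subtype.val h), fun f g hf _ hfg _ hsum => ?_⟩
  have hb' : b = f + g := congrArg Subtype.val hsum
  have hff : (f : A) * f = f := congrArg Subtype.val hf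
  have hfg : (f : A) * g = 0 := congrArg Subtype.val hfg
  have hfb : (f : A) * b = f := by rw [hb', mul_add, hff, hfg, add_zero]
  rcases h f hff fun a => (Subring.mem_center_iff.mp f.2 a).symm with h | h
  · exact .inl (Subtype.ext (hfb.symm.trans h))
  · refine .inr (Subtype.ext ?_)
    rw [sub_mul, one_mul, hfb, hb', add_sub_cancel_left] at h
    exact h

lemma blocks_eq_pair {e₁ e₂ : A} (h₁ : IsBlockIdempotent e₁)
    (h₂ : IsBlockIdempotent e₂) (hmul : e₁ * e₂ = 0) (hadd : e₁ + e₂ = 1) :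
    blocks A = {Ideal.span {e₁}, Ideal.span {e₂}} := by
  ext B
  simp only [blocks, Set.mem_ofPred_eq, Set.mem_insert_iff, Set.mem_singleton_iff]
  constructor
  · rintro ⟨e, he, rfl⟩
    rcases eq_or_eq_of_isBlockIdempotent h₁ h₂ hmul hadd he with rfl | rfl
    · exact Or.inl rfl
    · exact Or.inr rfl
  · rintro (rfl | rfl)
    · exact ⟨e₁, h₁, rfl⟩
    · exact ⟨e₂, h₂, rfl⟩

lemma isCompl_span_of_add_eq_one {e₁ e₂ : A} (h₁ : e₁ * e₁ = e₁)
    (h' : e₂ * e₁ = 0) (hadd : e₁ + e₂ = 1) :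
    IsCompl (Ideal.span {e₁}) (Ideal.span {e₂}) := by
  constructor
  · rw [Submodule.disjoint_def]
    intro x hx hx'
    obtain ⟨a, rfl⟩ := Ideal.mem_span_singleton'.mp hx
    obtain ⟨b, hb⟩ := Ideal.mem_span_singleton'.mp hx'
    have := congrArg (· * e₁) hb
    simp only [mul_assoc, h', h₁, mul_zero] at this
    exact this.symm
  · rw [codisjoint_iff, Ideal.eq_top_iff_one, ← hadd]
    exact Submodule.add_mem_sup (Ideal.subset_span rfl) (Ideal.subset_span rfl)

end Primitive

namespace QuiverFrame

variable {k A : Type*} [Field k] [Ring A] [Algebra k A] (Q : QuiverFrame A)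

/-! ### The two blocks -/

/-- The idempotent of the principal block. -/
def blockOne : A := ∑ p with label p ≠ 3, Q.u p * Q.v p

/-- The idempotent of the block of the simple projective module. -/
def blockTwo : A := ∑ p with label p = 3, Q.u p * Q.v p

lemma blockOne_add_blockTwo : Q.blockOne + Q.blockTwo = 1 := by
  rw [blockOne, blockTwo, add_comm, Finset.sum_filter_add_sum_filter_not, Q.sum_u_mul_v]

lemma v_mul_blockOne (p : Fin 9) : Q.v p * Q.blockOne = if label p = 3 then 0 else Q.v p := by
  simp_rw [blockOne, Finset.mul_sum, ← mul_assoc, Q.v_mul_u, ite_mul, zero_mul,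
    Finset.sum_ite_eq, Finset.mem_filter, Finset.mem_univ, true_and, Q.e_mul_v, ite_not]

lemma v_mul_blockTwo (p : Fin 9) : Q.v p * Q.blockTwo = if label p = 3 then Q.v p else 0 := by
  simp_rw [blockTwo, Finset.mul_sum, ← mul_assoc, Q.v_mul_u, ite_mul, zero_mul,
    Finset.sum_ite_eq, Finset.mem_filter, Finset.mem_univ, true_and, Q.e_mul_v]

lemma blockOne_mul_self : Q.blockOne * Q.blockOne = Q.blockOne := by
  conv_lhs => rw [blockOne, Finset.sum_mul]
  rw [blockOne]
  refine Finset.sum_congr rfl fun p hp => ?_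
  rw [mul_assoc, ← blockOne, v_mul_blockOne, if_neg (Finset.mem_filter.mp hp).2]

lemma blockOne_mul_blockTwo : Q.blockOne * Q.blockTwo = 0 := by
  rw [blockOne, Finset.sum_mul]
  refine Finset.sum_eq_zero fun p hp => ?_
  rw [mul_assoc, v_mul_blockTwo, if_neg (Finset.mem_filter.mp hp).2, mul_zero]

lemma blockTwo_mul_blockOne : Q.blockTwo * Q.blockOne = 0 := by
  rw [blockTwo, Finset.sum_mul]
  refine Finset.sum_eq_zero fun p hp => ?_
  rw [mul_assoc, v_mul_blockOne, if_pos (Finset.mem_filter.mp hp).2, mul_zero]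

lemma blockTwo_mul_self : Q.blockTwo * Q.blockTwo = Q.blockTwo := by
  have := congrArg (· * Q.blockTwo) Q.blockOne_add_blockTwo
  simpa [add_mul, Q.blockOne_mul_blockTwo] using this

lemma e_mul_blockOne (i : Fin 4) (hi : i ≠ 3) : Q.e i * Q.blockOne = Q.e i := by
  have := Q.v_mul_blockOne (Q.base i)
  rwa [Q.σ_base, if_neg hi, Q.v_base] at this

lemma e_mul_blockTwo : Q.e 3 * Q.blockTwo = Q.e 3 := by
  have := Q.v_mul_blockTwo (Q.base 3)
  rwa [Q.σ_base, if_pos rfl, Q.v_base] at this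

lemma central_mul_blockOne_eq_zero {z : A} (hcomm : ∀ a, z * a = a * z)
    (h : ∀ i ≠ 3, z * Q.e i = 0) : z * Q.blockOne = 0 := by
  rw [blockOne, Finset.mul_sum]
  refine Finset.sum_eq_zero fun p hp => ?_
  rw [← Q.u_mul_e, mul_assoc, ← mul_assoc, hcomm, mul_assoc, ← mul_assoc z,
    h _ (Finset.mem_filter.mp hp).2, zero_mul, mul_zero]

lemma central_mul_blockTwo_eq_zero {z : A} (hcomm : ∀ a, z * a = a * z)
    (h : z * Q.e 3 = 0) : z * Q.blockTwo = 0 := by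
  rw [blockTwo, Finset.mul_sum]
  refine Finset.sum_eq_zero fun p hp => ?_
  rw [← Q.u_mul_e, mul_assoc, ← mul_assoc, hcomm, mul_assoc, ← mul_assoc z,
    (Finset.mem_filter.mp hp).2, h, zero_mul, mul_zero]

lemma eq_zero_of_forall_mul_u {a : A} (h : ∀ p, a * Q.u p = 0) : a = 0 := by
  rw [← mul_one a, ← Q.sum_u_mul_v, Finset.mul_sum]
  simp_rw [← mul_assoc, h, zero_mul, Finset.sum_const_zero]

/-- Right multiplication by `u p`: the projection of the regular module onto its `p`-th summand,
identified with a module `A e`. -/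
def mulU (i : Fin 4) (p : Fin 9) (h : label p = i) : A →ₗ[A] Q.proj i :=
  (LinearMap.toSpanSingleton A A (Q.u p)).codRestrict (Q.proj i) fun a => Q.mem_proj_iff.mpr (by
    subst h
    rw [LinearMap.toSpanSingleton_apply, smul_eq_mul, mul_assoc, Q.u_mul_e])

variable (hA : Module.finrank k A = 60)

include hA

lemma blockOne_mul_mul_blockTwo (a : A) : Q.blockOne * a * Q.blockTwo = 0 := by
  simp_rw [blockOne, blockTwo, Finset.sum_mul, Finset.mul_sum]
  refine Finset.sum_eq_zero fun p hp => Finset.sum_eq_zero fun q hq => ?_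
  have h : Q.v p * a * Q.u q = 0 := by
    refine Q.eq_zero_of_mem_corner (k := k) hA ?_ (Q.v_mul_mul_u_mem_corner p q a)
    have hp := (Finset.mem_filter.mp hp).2
    rw [(Finset.mem_filter.mp hq).2]
    revert hp
    generalize label p = i
    revert i
    decide
  calc Q.u p * Q.v p * a * (Q.u q * Q.v q) = Q.u p * (Q.v p * a * Q.u q) * Q.v q := by
        simp_rw [mul_assoc]
    _ = 0 := by rw [h, mul_zero, zero_mul]

lemma blockTwo_mul_mul_blockOne (a : A) : Q.blockTwo * a * Q.blockOne = 0 := by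
  simp_rw [blockOne, blockTwo, Finset.sum_mul, Finset.mul_sum]
  refine Finset.sum_eq_zero fun p hp => Finset.sum_eq_zero fun q hq => ?_
  have h : Q.v p * a * Q.u q = 0 := by
    refine Q.eq_zero_of_mem_corner (k := k) hA ?_ (Q.v_mul_mul_u_mem_corner p q a)
    have hq := (Finset.mem_filter.mp hq).2
    rw [(Finset.mem_filter.mp hp).2]
    revert hq
    generalize label q = i
    revert i
    decide
  calc Q.u p * Q.v p * a * (Q.u q * Q.v q) = Q.u p * (Q.v p * a * Q.u q) * Q.v q := by
        simp_rw [mul_assoc]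
    _ = 0 := by rw [h, mul_zero, zero_mul]

lemma blockOne_comm (a : A) : Q.blockOne * a = a * Q.blockOne := by
  have h1 : Q.blockOne * a = Q.blockOne * a * Q.blockOne := by
    conv_lhs => rw [← mul_one (Q.blockOne * a), ← Q.blockOne_add_blockTwo, mul_add,
      Q.blockOne_mul_mul_blockTwo hA, add_zero]
  have h2 : a * Q.blockOne = Q.blockOne * a * Q.blockOne := by
    conv_lhs => rw [← one_mul (a * Q.blockOne), ← Q.blockOne_add_blockTwo, add_mul, ← mul_assoc,
      ← mul_assoc, Q.blockTwo_mul_mul_blockOne hA, add_zero]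
  rw [h1, h2]

lemma blockTwo_comm (a : A) : Q.blockTwo * a = a * Q.blockTwo := by
  have h : Q.blockTwo = 1 - Q.blockOne := by rw [← Q.blockOne_add_blockTwo, add_sub_cancel_left]
  rw [h, sub_mul, mul_sub, one_mul, mul_one, Q.blockOne_comm hA]

lemma blockOne_mul_of_mem_proj {i : Fin 4} (hi : i ≠ 3) {x : A} (hx : x ∈ Q.proj i) :
    Q.blockOne * x = x := by
  rw [← Q.mem_proj_iff.mp hx, Q.blockOne_comm hA, mul_assoc, Q.e_mul_blockOne i hi]

lemma blockTwo_mul_of_mem_proj {x : A} (hx : x ∈ Q.proj 3) : Q.blockTwo * x = x := by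
  rw [← Q.mem_proj_iff.mp hx, Q.blockTwo_comm hA, mul_assoc, Q.e_mul_blockTwo]

lemma eq_zero_or_eq_e {i : Fin 4} {f : A} (hf : f * f = f) (hl : Q.e i * f = f)
    (hr : f * Q.e i = f) : f = 0 ∨ f = Q.e i := by
  obtain ⟨c, hc⟩ := (Q.isSplit hA).diag i f
  rw [hl, hr] at hc
  by_cases hc0 : c = 0
  · left
    refine eq_zero_of_isIdempotentElem_of_mem_jacobson hf ?_
    simpa [hc0] using hc
  · right
    have h1 : (Q.e i - f) * f = 0 := by rw [sub_mul, hl, hf, sub_self]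
    have h2 : (Q.e i - f) * (Q.e i - f) = Q.e i - f := by
      rw [mul_sub, h1, sub_zero, sub_mul, hr, Q.e_mul_e]
    have h3 := Ideal.mul_mem_left (Ring.jacobson A) (Q.e i - f) hc
    rw [mul_sub, h1, zero_sub, neg_mem_iff, mul_smul_comm, sub_mul, hr, Q.e_mul_e] at h3
    have h4 := Submodule.smul_of_tower_mem (Ring.jacobson A) c⁻¹ h3
    rw [smul_smul, inv_mul_cancel₀ hc0, one_smul] at h4
    exact (sub_eq_zero.mp (eq_zero_of_isIdempotentElem_of_mem_jacobson h2 h4)).symm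

lemma central_mul_e {z : A} (hz : z * z = z) (hcomm : ∀ a, z * a = a * z) (i : Fin 4) :
    z * Q.e i = 0 ∨ z * Q.e i = Q.e i := by
  refine Q.eq_zero_or_eq_e hA ?_ ?_ ?_
  · rw [mul_assoc, ← mul_assoc (Q.e i), ← hcomm, mul_assoc z (Q.e i), Q.e_mul_e, ← mul_assoc, hz]
  · rw [hcomm, ← mul_assoc, Q.e_mul_e]
  · rw [mul_assoc, Q.e_mul_e]

lemma central_mul_e_eq_zero {z : A} (hz : z * z = z) (hcomm : ∀ a, z * a = a * z)
    (h : z * Q.e 0 = 0) : ∀ i ≠ 3, z * Q.e i = 0 := by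
  have key {i : Fin 4} {x : A} (hx0 : x ≠ 0) (hx : Q.e 0 * x = x) (hx' : x * Q.e i = x) :
      z * Q.e i = 0 := by
    refine (Q.central_mul_e hA hz hcomm i).resolve_right fun h' => hx0 ?_
    rw [← hx', ← h', ← mul_assoc, ← hcomm, ← hx, ← mul_assoc, h, zero_mul, zero_mul]
  intro i hi
  fin_cases i
  · exact h
  · exact key (fun h => Q.δ_γ_β_α_ne_zero (by simp [h])) Q.e_β Q.β_e
  · exact key (fun h => Q.δ_γ_β_α_ne_zero (by simp [h])) Q.e_δ Q.δ_e
  · exact absurd rfl hi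

lemma isBlockIdempotent_blockOne : IsBlockIdempotent Q.blockOne := by
  refine isBlockIdempotent_of_forall Q.blockOne_mul_self (fun h => Q.e_ne_zero 0 ?_)
    (Q.blockOne_comm hA) fun z hz hcomm => ?_
  · rw [← Q.e_mul_blockOne 0 (by decide), h, mul_zero]
  · refine (Q.central_mul_e hA hz hcomm 0).imp
      (fun h => Q.central_mul_blockOne_eq_zero hcomm (Q.central_mul_e_eq_zero hA hz hcomm h))
      fun h => ?_
    have hcomm' (a : A) : (1 - z) * a = a * (1 - z) := by
      rw [sub_mul, mul_sub, hcomm, one_mul, mul_one]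
    exact Q.central_mul_blockOne_eq_zero hcomm' (Q.central_mul_e_eq_zero hA hz.one_sub hcomm'
      (by rw [sub_mul, one_mul, h, sub_self]))

lemma isBlockIdempotent_blockTwo : IsBlockIdempotent Q.blockTwo := by
  refine isBlockIdempotent_of_forall Q.blockTwo_mul_self (fun h => Q.e_ne_zero 3 ?_)
    (Q.blockTwo_comm hA) fun z hz hcomm => ?_
  · rw [← Q.e_mul_blockTwo, h, mul_zero]
  · refine (Q.central_mul_e hA hz hcomm 3).imp (Q.central_mul_blockTwo_eq_zero hcomm) fun h => ?_
    refine Q.central_mul_blockTwo_eq_zero (fun a => ?_) (by rw [sub_mul, one_mul, h, sub_self])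
    rw [sub_mul, mul_sub, hcomm, one_mul, mul_one]

lemma blockOne_smul {M : Type*} [AddCommGroup M] [Module A M] (hM : Q.IsTop 0 M) (x : M) :
    Q.blockOne • x = x := by
  have h : Q.blockTwo • x = 0 := by
    rw [blockTwo, Finset.sum_smul]
    refine Finset.sum_eq_zero fun p hp => ?_
    rw [← Q.e_mul_v, (Finset.mem_filter.mp hp).2, mul_smul, mul_smul,
      (Q.isSplit hA).e_smul_eq_zero hM (by decide), smul_zero]
  have h1 := congrArg (· • x) Q.blockOne_add_blockTwo
  simpa [add_smul, h] using h1

lemma blockOne_mul_of_equiv {f : A} {i : Fin 4} (hi : i ≠ 3)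
    (φ : Ideal.span {f} ≃ₗ[A] Q.proj i) : Q.blockOne * f = f := by
  let g : Ideal.span {f} := ⟨f, Ideal.subset_span rfl⟩
  have : Q.blockOne • g = g := by
    apply φ.injective
    rw [map_smul]
    exact Subtype.ext (Q.blockOne_mul_of_mem_proj hA hi (φ g).2)
  exact congrArg Subtype.val this

lemma blockTwo_mul_of_equiv {f : A} (φ : Ideal.span {f} ≃ₗ[A] Q.proj 3) : Q.blockTwo * f = f := by
  let g : Ideal.span {f} := ⟨f, Ideal.subset_span rfl⟩
  have : Q.blockTwo • g = g := by
    apply φ.injective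
    rw [map_smul]
    exact Subtype.ext (Q.blockTwo_mul_of_mem_proj hA (φ g).2)
  exact congrArg Subtype.val this

lemma exists_equiv_of_isPrimitiveIdempotent {f : A} (hf : IsPrimitiveIdempotent f) :
    ∃ i, Nonempty (Ideal.span {f} ≃ₗ[A] Q.proj i) := by
  have := projective_span_of_isIdempotentElem hf.1
  have : Module.Finite A (Ideal.span {f}) :=
    Module.Finite.iff_fg.mpr (Submodule.fg_span_singleton f)
  exact (Q.isSplit hA).exists_equiv_proj hf.isIndecomposableModule

lemma blockOne_eq_finsum {n : ℕ} {f : Fin n → A} (hf : CompleteOrthogonalIdempotents f)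
    (hprim : ∀ t, IsPrimitiveIdempotent (f t)) :
    Q.blockOne = ∑ᶠ (t) (_ : ∃ i, i ≠ 3 ∧ Nonempty (Ideal.span {f t} ≃ₗ[A] Q.proj i)), f t := by
  classical
  rw [← mul_one Q.blockOne, ← hf.complete, Finset.mul_sum, finsum_eq_sum_of_fintype]
  refine Finset.sum_congr rfl fun t _ => ?_
  by_cases h : ∃ i, i ≠ 3 ∧ Nonempty (Ideal.span {f t} ≃ₗ[A] Q.proj i)
  · obtain ⟨i, hi, ⟨φ⟩⟩ := id h
    rw [finsum_eq_if, if_pos h, Q.blockOne_mul_of_equiv hA hi φ]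
  · obtain ⟨i, ⟨φ⟩⟩ := Q.exists_equiv_of_isPrimitiveIdempotent hA (hprim t)
    have hi : i = 3 := by
      by_contra hi
      exact h ⟨i, hi, ⟨φ⟩⟩
    subst hi
    rw [finsum_eq_if, if_neg h, ← Q.blockTwo_mul_of_equiv hA φ, ← mul_assoc,
      Q.blockOne_mul_blockTwo, zero_mul]

lemma blockTwo_eq_finsum {n : ℕ} {f : Fin n → A} (hf : CompleteOrthogonalIdempotents f)
    (hprim : ∀ t, IsPrimitiveIdempotent (f t)) :
    Q.blockTwo = ∑ᶠ (t) (_ : Nonempty (Ideal.span {f t} ≃ₗ[A] Q.proj 3)), f t := by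
  classical
  rw [← mul_one Q.blockTwo, ← hf.complete, Finset.mul_sum, finsum_eq_sum_of_fintype]
  refine Finset.sum_congr rfl fun t _ => ?_
  by_cases h : Nonempty (Ideal.span {f t} ≃ₗ[A] Q.proj 3)
  · obtain ⟨φ⟩ := id h
    rw [finsum_eq_if, if_pos h, Q.blockTwo_mul_of_equiv hA φ]
  · obtain ⟨i, ⟨φ⟩⟩ := Q.exists_equiv_of_isPrimitiveIdempotent hA (hprim t)
    have hi : i ≠ 3 := by
      rintro rfl
      exact h ⟨φ⟩
    rw [finsum_eq_if, if_neg h, ← Q.blockOne_mul_of_equiv hA hi φ, ← mul_assoc,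
      Q.blockTwo_mul_blockOne, zero_mul]

lemma nonempty_regular_equiv : Nonempty (A ≃ₗ[A]
    (Q.proj 0 × (Fin 2 → Q.proj 1) × (Fin 2 → Q.proj 2) × (Fin 4 → Q.proj 3))) := by
  have : Module.Finite k A := Module.finite_of_finrank_pos (by omega)
  have hfin (i : Fin 4) := finite_of_tower k (Q.proj i)
  let f : A →ₗ[A] (Q.proj 0 × (Fin 2 → Q.proj 1) × (Fin 2 → Q.proj 2) × (Fin 4 → Q.proj 3)) :=
    (Q.mulU 0 0 rfl).prod ((LinearMap.pi ![Q.mulU 1 1 rfl, Q.mulU 1 2 rfl]).prod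
      ((LinearMap.pi ![Q.mulU 2 3 rfl, Q.mulU 2 4 rfl]).prod
        (LinearMap.pi ![Q.mulU 3 5 rfl, Q.mulU 3 6 rfl, Q.mulU 3 7 rfl, Q.mulU 3 8 rfl])))
  have hinj : Function.Injective f := by
    rw [← LinearMap.ker_eq_bot, LinearMap.ker_eq_bot']
    intro a ha
    have h (g : (Q.proj 0 × (Fin 2 → Q.proj 1) × (Fin 2 → Q.proj 2) × (Fin 4 → Q.proj 3)) → A) :
        g (f a) = g 0 := congrArg g ha
    refine Q.eq_zero_of_forall_mul_u fun p => ?_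
    fin_cases p
    · exact h fun y => y.1
    · exact h fun y => y.2.1 0
    · exact h fun y => y.2.1 1
    · exact h fun y => y.2.2.1 0
    · exact h fun y => y.2.2.1 1
    · exact h fun y => y.2.2.2 0
    · exact h fun y => y.2.2.2 1
    · exact h fun y => y.2.2.2 2
    · exact h fun y => y.2.2.2 3
  have hsurj : Function.Surjective f := by
    refine (LinearMap.injective_iff_surjective_of_finrank_eq_finrank
      (f := f.restrictScalars k) ?_).mp hinj
    simp [Module.finrank_prod, Module.finrank_pi_fintype, Q.finrank_proj hA, hA]
  exact ⟨LinearEquiv.ofBijective f ⟨hinj, hsurj⟩⟩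

end QuiverFrame

namespace IdempotentFrame.IsSplit

variable {k A : Type*} [Field k] [Ring A] [Algebra k A] {P I : Type*} [Fintype P] [DecidableEq P]
  {σ : P → I} {F : IdempotentFrame A σ}

lemma isTop_radLayer_zero (h : F.IsSplit k) {i : I} (hi : F.e i ≠ 0) :
    F.IsTop i (RadLayer A (F.proj i) 0) := by
  have radSeries_eq : radSeries A (F.proj i) 1 = (Ring.jacobson A).submoduleOf (F.proj i) := by
    rw [radSeries_one]
    exact le_antisymm (sInf_le (h.isCoatom hi)) (le_sInf fun N hN => (h.eq_of_isCoatom hN).ge)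
  refine (h.isTop_proj_quotient hi).congr ?_
  refine (Submodule.Quotient.equiv _ _ Submodule.topEquiv ?_).symm
  ext x
  simp only [zero_add, radSeries_eq]
  constructor
  · rintro ⟨y, hy, rfl⟩
    exact hy
  · exact fun hx => ⟨⟨x, Submodule.mem_top⟩, hx, rfl⟩

lemma nonempty_equiv_prod (h : F.IsSplit k) {i j : I} {L M N M' N' : Type*}
    [AddCommGroup L] [Module A L] [AddCommGroup M] [Module A M] [AddCommGroup N] [Module A N]
    [AddCommGroup M'] [Module A M'] [AddCommGroup N'] [Module A N']
    (hL : Nonempty (L ≃ₗ[A] M × N)) (hM : F.IsTop i M) (hN : F.IsTop j N)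
    (hM' : F.IsTop i M') (hN' : F.IsTop j N') : Nonempty (L ≃ₗ[A] M' × N') := by
  obtain ⟨f⟩ := hL
  obtain ⟨g⟩ := h.nonempty_equiv hM hM'
  obtain ⟨g'⟩ := h.nonempty_equiv hN hN'
  exact ⟨f.trans (g.prodCongr g')⟩

lemma uniserial_layers_equiv (h : F.IsSplit k) {S : I → Type*} [∀ i, AddCommGroup (S i)]
    [∀ i, Module A (S i)] (hS : ∀ i, F.IsTop i (S i)) {M : Type*} [AddCommGroup M] [Module A M]
    {l n : ℕ} {c : Fin n → I} (hM : IsUniserialModule A M ∧ radSeries A M l = ⊥ ∧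
      ∀ t : Fin n, F.IsTop (c t) (RadLayer A M t)) :
    IsUniserialModule A M ∧ radSeries A M l = ⊥ ∧
      ∀ t : Fin n, Nonempty (RadLayer A M t ≃ₗ[A] S (c t)) :=
  ⟨hM.1, hM.2.1, fun t => h.nonempty_equiv (hM.2.2 t) (hS (c t))⟩

end IdempotentFrame.IsSplit

namespace QuiverFrame

lemma span_blockOne_ne_span_blockTwo {A : Type*} [Ring A] (Q : QuiverFrame A) :
    Ideal.span {Q.blockOne} ≠ Ideal.span {Q.blockTwo} := by
  intro h
  obtain ⟨a, ha⟩ := Ideal.mem_span_singleton'.mp (h ▸ Ideal.subset_span rfl :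
    Q.blockOne ∈ Ideal.span {Q.blockTwo})
  have blockOne_eq_zero : Q.blockOne = 0 := by
    rw [← Q.blockOne_mul_self]
    nth_rw 1 [← ha]
    rw [mul_assoc, Q.blockTwo_mul_blockOne, mul_zero]
  refine Q.e_ne_zero 0 ?_
  rw [← Q.e_mul_blockOne 0 (by decide), blockOne_eq_zero, mul_zero]

variable {k A : Type*} [Field k] [Ring A] [Algebra k A] (Q : QuiverFrame A)
  (hA : Module.finrank k A = 60)

include hA

lemma uniserial_proj_one : IsUniserialModule A (Q.proj 1) ∧ radSeries A (Q.proj 1) 5 = ⊥ ∧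
    ∀ n : Fin 5, Q.IsTop (![1, 0, 2, 0, 1] n) (RadLayer A (Q.proj 1) n) := by
  have : Module.Finite k A := Module.finite_of_finrank_pos (by omega)
  have : Module.Finite k (Q.proj 1) := finite_of_tower k (Q.proj 1)
  have h := Q.isRadChain_proj hA
  refine ⟨h.isUniserialModule Q.span_word_zero_smul_gen,
    h.radSeries_eq_bot Q.span_word_zero_smul_gen, fun n => ?_⟩
  have hn := h.isTop_radLayer Q.span_word_zero_smul_gen n.2
  fin_cases n <;> exact hn

lemma uniserial_proj_two : IsUniserialModule A (Q.proj 2) ∧ radSeries A (Q.proj 2) 5 = ⊥ ∧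
    ∀ n : Fin 5, Q.IsTop (![2, 0, 1, 0, 2] n) (RadLayer A (Q.proj 2) n) := by
  obtain ⟨huni, hbot, htop⟩ := Q.swap.uniserial_proj_one hA
  refine ⟨huni, hbot, fun n => ?_⟩
  have hn := htop n
  fin_cases n <;> exact hn

section Generated

variable {M : Type*} [AddCommGroup M] [Module A M] [Module k M] [IsScalarTower k A M]

lemma uniserial_of_e_one {x : M} (hx : Q.e 1 • x = x)
    (hspan : Submodule.span A {x} = ⊤)
    (hM : Module.finrank k M = 5) : IsUniserialModule A M ∧ radSeries A M 3 = ⊥ ∧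
    ∀ n : Fin 3, Q.IsTop (![1, 0, 2] n) (RadLayer A M n) := by
  have : Module.Finite k M := Module.finite_of_finrank_pos (by omega)
  have h := Q.isRadChain_of_finrank_eq hA hx hspan hM
  have span_word_zero : Submodule.span A {Q.word 0 • x} = ⊤ := by
    rwa [show Q.word 0 • x = x from hx]
  refine ⟨h.isUniserialModule span_word_zero, h.radSeries_eq_bot span_word_zero, fun n => ?_⟩
  have hn := h.isTop_radLayer span_word_zero n.2
  fin_cases n <;> exact hn

lemma uniserial_of_e_two {x : M} (hx : Q.e 2 • x = x)
    (hspan : Submodule.span A {x} = ⊤)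
    (hM : Module.finrank k M = 5) : IsUniserialModule A M ∧ radSeries A M 3 = ⊥ ∧
    ∀ n : Fin 3, Q.IsTop (![2, 0, 1] n) (RadLayer A M n) := by
  obtain ⟨huni, hbot, htop⟩ := Q.swap.uniserial_of_e_one hA hx hspan hM
  refine ⟨huni, hbot, fun n => ?_⟩
  have hn := htop n
  fin_cases n <;> exact hn

lemma nonempty_moduleHeart_equiv_of_generated {M' : Type*} [AddCommGroup M'] [Module A M']
    [Module k M'] [IsScalarTower k A M'] {x : M} {x' : M'} (hx : Q.e 2 • x = x)
    (hspan : Submodule.span A {x} = ⊤) (hM : Module.finrank k M = 5) (hx' : Q.e 1 • x' = x')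
    (hspan' : Submodule.span A {x'} = ⊤) (hM' : Module.finrank k M' = 5) :
    Nonempty (ModuleHeart A (Q.proj 0) ≃ₗ[A] M × M') := by
  obtain ⟨f⟩ := Q.nonempty_moduleHeart_equiv hA
  obtain ⟨g⟩ := Q.swap.nonempty_equiv_arm_quotient hA hx hspan hM
  obtain ⟨g'⟩ := Q.nonempty_equiv_arm_quotient hA hx' hspan' hM'
  exact ⟨f.trans (g.prodCongr g')⟩

end Generated

lemma eq_of_nonempty_proj_equiv {i j : Fin 4} (h : Nonempty (Q.proj i ≃ₗ[A] Q.proj j)) :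
    i = j := by
  obtain ⟨f⟩ := h
  have cartan_column_eq (l : Fin 4) : cartanA5 l i = cartanA5 l j := by
    rw [← Q.finrank_corner hA, ← Q.finrank_corner hA, ← Q.finrank_part_proj,
      ← Q.finrank_part_proj, Q.finrank_part_congr f]
  clear f
  revert i j
  decide

lemma isTop_proj_three : Q.IsTop 3 (Q.proj 3) := by
  have : Module.Finite k A := Module.finite_of_finrank_pos (by omega)
  have : Module.Finite k (Q.proj 3) := finite_of_tower k (Q.proj 3)
  refine Q.isTop_of_finrank_eq k (x := Q.gen 3)
    (fun h => Q.e_ne_zero 3 (congrArg Subtype.val h)) (Q.e_smul_gen 3) ?_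
  rw [Q.finrank_proj hA]
  decide

section Simples

variable {S : Fin 4 → Type*} [∀ i, AddCommGroup (S i)] [∀ i, Module A (S i)]
  (hS : ∀ i, Q.IsTop i (S i))

include hS

lemma simples_classification : (∀ i, IsSimpleModule A (S i)) ∧
    (∀ i j, Nonempty (S i ≃ₗ[A] S j) → i = j) ∧
    ∀ (M : Type v) [AddCommGroup M] [Module A M], IsSimpleModule A M →
      ∃ i, Nonempty (M ≃ₗ[A] S i) := by
  have hQ := Q.isSplit hA
  refine ⟨fun i => (hS i).1, fun i j ⟨f⟩ => hQ.label_unique ((hS i).congr f) (hS j), ?_⟩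
  intro M _ _ _
  obtain ⟨i, hi⟩ := Q.exists_isTop (M := M)
  exact ⟨i, hQ.nonempty_equiv hi (hS i)⟩

lemma projectives_classification :
    (∀ i, Module.Projective A (Q.proj i) ∧ IsIndecomposableModule A (Q.proj i)) ∧
    (∀ i, Nonempty (RadLayer A (Q.proj i) 0 ≃ₗ[A] S i)) ∧
    (∀ i, Module.finrank k (Q.proj i) = ![12, 8, 8, 4] i) ∧
    (∀ i j, Nonempty (Q.proj i ≃ₗ[A] Q.proj j) → i = j) ∧
    ∀ (M : Type v) [AddCommGroup M] [Module A M], Module.Finite A M → Module.Projective A M →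
      IsIndecomposableModule A M → ∃ i, Nonempty (M ≃ₗ[A] Q.proj i) := by
  have hQ := Q.isSplit hA
  exact ⟨fun i => ⟨Q.projective_proj i, hQ.isIndecomposableModule_proj (Q.e_ne_zero i)⟩,
    fun i => hQ.nonempty_equiv (hQ.isTop_radLayer_zero (Q.e_ne_zero i)) (hS i),
    Q.finrank_proj hA, fun _ _ => Q.eq_of_nonempty_proj_equiv hA,
    fun M _ _ _ _ hM => hQ.exists_equiv_proj hM⟩

lemma nonempty_radLayer_proj_zero_equiv_simples : radSeries A (Q.proj 0) 5 = ⊥ ∧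
    Nonempty (RadLayer A (Q.proj 0) 1 ≃ₗ[A] S 2 × S 1) ∧
    Nonempty (RadLayer A (Q.proj 0) 2 ≃ₗ[A] S 0 × S 0) ∧
    Nonempty (RadLayer A (Q.proj 0) 3 ≃ₗ[A] S 1 × S 2) ∧
    Nonempty (RadLayer A (Q.proj 0) 4 ≃ₗ[A] S 0) := by
  have hQ := Q.isSplit hA
  have layer {t : ℕ} (ht : t ≤ 2) : Nonempty (RadLayer A (Q.proj 0) (t + 1) ≃ₗ[A]
      S (swapLabel (wordLabel t)) × S (wordLabel t)) :=
    hQ.nonempty_equiv_prod (Q.nonempty_radLayer_proj_zero_equiv hA ht)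
      (Q.isTop_coarm hA (by omega)) (Q.isTop_arm hA (by omega)) (hS _) (hS _)
  exact ⟨Q.radSeries_proj_zero_five hA, layer (t := 0) (by omega), layer (t := 1) (by omega),
    layer (t := 2) le_rfl, hQ.nonempty_equiv (Q.isTop_radLayer_proj_zero_four hA) (hS 0)⟩

lemma nonempty_moduleSocle_proj_zero_equiv :
    Nonempty (moduleSocle A (Q.proj 0) ≃ₗ[A] S 0) :=
  Q.moduleSocle_proj_zero hA ▸ (Q.isSplit hA).nonempty_equiv (Q.isTop_arm_three hA) (hS 0)

lemma hasMultiplicity_proj (i j : Fin 4) :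
    HasMultiplicity A (Q.proj j) (S i) (cartanA5 i j) := by
  have : Module.Finite k A := Module.finite_of_finrank_pos (by omega)
  have : Module.Finite k (Q.proj j) := finite_of_tower k (Q.proj j)
  have := (Q.isSplit hA).hasMultiplicity (M := Q.proj j) (hS i)
  rwa [Q.finrank_part_proj, Q.finrank_corner hA] at this

end Simples

lemma blocks_classification {S : Type*} [AddCommGroup S] [Module A S] (hS : Q.IsTop 0 S) :
    (blocks A).ncard = 2 ∧
    ∃ e₁ e₂ : A, IsBlockIdempotent e₁ ∧ IsBlockIdempotent e₂ ∧ e₁ * e₂ = 0 ∧ e₁ + e₂ = 1 ∧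
      blocks A = {Ideal.span {e₁}, Ideal.span {e₂}} ∧
      IsCompl (Ideal.span {e₁}) (Ideal.span {e₂}) ∧
      (∀ i, i ≠ 3 → ∀ x ∈ Q.proj i, e₁ * x = x) ∧ (∀ x ∈ Q.proj 3, e₂ * x = x) ∧
      (∀ x : S, e₁ • x = x) ∧
      ∀ (n : ℕ) (f : Fin n → A), CompleteOrthogonalIdempotents f →
        (∀ t, IsPrimitiveIdempotent (f t)) →
        e₁ = ∑ᶠ (t) (_ : ∃ i, i ≠ 3 ∧ Nonempty (Ideal.span {f t} ≃ₗ[A] Q.proj i)), f t ∧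
        e₂ = ∑ᶠ (t) (_ : Nonempty (Ideal.span {f t} ≃ₗ[A] Q.proj 3)), f t := by
  have one := Q.isBlockIdempotent_blockOne hA
  have two := Q.isBlockIdempotent_blockTwo hA
  have pair := blocks_eq_pair one two Q.blockOne_mul_blockTwo Q.blockOne_add_blockTwo
  exact ⟨pair ▸ Set.ncard_pair Q.span_blockOne_ne_span_blockTwo, Q.blockOne, Q.blockTwo, one, two,
    Q.blockOne_mul_blockTwo, Q.blockOne_add_blockTwo, pair,
    isCompl_span_of_add_eq_one Q.blockOne_mul_self Q.blockTwo_mul_blockOne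
      Q.blockOne_add_blockTwo,
    fun i hi x hx => Q.blockOne_mul_of_mem_proj hA hi hx,
    fun x hx => Q.blockTwo_mul_of_mem_proj hA hx, Q.blockOne_smul hA hS,
    fun n f hf hprim => ⟨Q.blockOne_eq_finsum hA hf hprim, Q.blockTwo_eq_finsum hA hf hprim⟩⟩

end QuiverFrame

/-! ### Modules over group algebras and induction of characters -/

section GroupAlgebraModules

variable {k G V M : Type*} [Field k] [Monoid G]

section Semimodules

variable [AddCommMonoid V] [Module k V] [AddCommMonoid M] [Module k M] [Module k[G] M]
  [IsScalarTower k k[G] M]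

/-- The linear map over the group algebra given by a linear map that commutes with the group
elements. -/
def linearMapOfCommutes (ρ : Representation k G V) (f : V →ₗ[k] M)
    (hf : ∀ g x, f (ρ g x) = MonoidAlgebra.of k G g • f x) : ρ.asModule →ₗ[k[G]] M where
  toFun x := f (ρ.asModuleEquiv x)
  map_add' x y := by simp only [map_add]
  map_smul' a x := by
    induction a using MonoidAlgebra.induction_on with
    | of g => rw [ρ.asModuleEquiv_map_smul, ρ.asAlgebraHom_of, hf, RingHom.id_apply]
    | add a b ha hb => simp only [add_smul, map_add, ha, hb, RingHom.id_apply]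
    | smul r a ha => simp only [smul_assoc, map_smul, ha, RingHom.id_apply]

end Semimodules

variable [AddCommGroup V] [Module k V] [AddCommGroup M] [Module k M] [Module k[G] M]
  [IsScalarTower k k[G] M]

/-- The range of `f` is stable under `G` as soon as it is stable under generators of `G`, and so
it carries a representation, which is transported to `V`. -/
lemma exists_representation_of_injective {s : Set G} (hs : Submonoid.closure s = ⊤)
    {f : V →ₗ[k] M} (hf : Function.Injective f)
    (hrange : ∀ g ∈ s, ∀ x, MonoidAlgebra.of k G g • f x ∈ LinearMap.range f) :
    ∃ ρ : Representation k G V, ∀ g x, f (ρ g x) = MonoidAlgebra.of k G g • f x := by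
  have hstable (g : G) (x : V) : ∃ y, f y = MonoidAlgebra.of k G g • f x := by
    have hg : g ∈ Submonoid.closure s := hs ▸ Submonoid.mem_top g
    induction hg using Submonoid.closure_induction generalizing x with
    | mem g hg => exact hrange g hg x
    | one => exact ⟨x, by rw [map_one, one_smul]⟩
    | mul g h _ _ ihg ihh =>
      obtain ⟨y, hy⟩ := ihh x
      obtain ⟨z, hz⟩ := ihg y
      exact ⟨z, by rw [hz, hy, map_mul, mul_smul]⟩
  choose L hL using hstable
  refine ⟨⟨⟨fun g => ⟨⟨L g, fun x y => hf ?_⟩, fun r x => hf ?_⟩, ?_⟩, fun g h => ?_⟩, hL⟩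
  · simp only [hL, map_add, smul_add]
  · simp only [LinearMap.map_smul, hL, RingHom.id_apply]
    exact (smul_algebra_smul_comm r (MonoidAlgebra.of k G g) (f x))
  · exact LinearMap.ext fun x => hf ((hL 1 x).trans (by rw [map_one, one_smul]; rfl))
  · exact LinearMap.ext fun x => hf ((hL _ x).trans (by
      rw [map_mul, mul_smul, ← hL, ← hL]; rfl))

end GroupAlgebraModules

section InducedCharacters

variable {k G : Type*} [Field k] [Group G] {H : Subgroup G}

/-- The one-dimensional representation with a given character. -/
def characterRep (χ : H →* k) : Representation k H k := (Algebra.lsmul k k k).toMonoidHom.comp χ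

lemma characterRep_apply (χ : H →* k) (h : H) (a : k) : characterRep χ h a = χ h * a := rfl

variable (χ : H →* k)

/-- The module induced from a character of a subgroup. -/
abbrev IndCharacter : Type _ := (Representation.ind H.subtype (characterRep χ)).asModule

/-- The canonical generator of the module induced from a character. -/
noncomputable def indGen : IndCharacter χ :=
  (Representation.ind H.subtype (characterRep χ)).asModuleEquiv.symm
    (Representation.IndV.mk H.subtype (characterRep χ) 1 1)

lemma smul_of_smul_indGen (g : G) (a : k) : a • MonoidAlgebra.of k G g • indGen χ =
    (Representation.ind H.subtype (characterRep χ)).asModuleEquiv.symm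
      (Representation.IndV.mk H.subtype (characterRep χ) g⁻¹ a) := by
  rw [LinearEquiv.eq_symm_apply, map_smul, Representation.asModuleEquiv_map_smul,
    Representation.asAlgebraHom_of, indGen, LinearEquiv.apply_symm_apply, Representation.ind_mk,
    one_mul, ← map_smul, smul_eq_mul, mul_one]

lemma indV_mk_mul (h : H) (g : G) (a : k) :
    Representation.IndV.mk H.subtype (characterRep χ) (h * g) (χ h * a) =
      Representation.IndV.mk H.subtype (characterRep χ) g a := by
  have := Representation.Coinvariants.mk_self_apply
    (Representation.tprod ((Representation.leftRegular k G).comp H.subtype) (characterRep χ)) h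
    (TensorProduct.tmul k (MonoidAlgebra.single g 1) a)
  simp only [Representation.tprod_apply, TensorProduct.map_tmul, characterRep_apply,
    MonoidHom.comp_apply, Representation.ofMulAction_single, smul_eq_mul] at this
  exact this

lemma of_smul_indGen (h : H) : MonoidAlgebra.of k G h • indGen χ = χ h • indGen χ := by
  have hg := smul_of_smul_indGen χ (h : G) 1
  have h1 := smul_of_smul_indGen χ 1 (χ h)
  rw [one_smul] at hg
  rw [map_one, one_smul] at h1
  rw [hg, h1, ← indV_mk_mul χ h, mul_inv_cancel, inv_one, mul_one]

lemma span_range_of_smul_indGen :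
    Submodule.span k (Set.range fun g : G => MonoidAlgebra.of k G g • indGen χ) = ⊤ := by
  set N := Submodule.span k (Set.range fun g : G => MonoidAlgebra.of k G g • indGen χ)
  have h : N.mkQ ∘ₗ
      (Representation.ind H.subtype (characterRep χ)).asModuleEquiv.symm.toLinearMap = 0 := by
    refine Representation.IndV.hom_ext _ _ fun g => LinearMap.ext_ring ?_
    have hg := smul_of_smul_indGen χ g⁻¹ 1
    rw [inv_inv, one_smul] at hg
    exact (Submodule.Quotient.mk_eq_zero N).mpr (hg ▸ Submodule.subset_span ⟨_, rfl⟩)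
  exact eq_top_iff.mpr fun x _ => (Submodule.Quotient.mk_eq_zero N).mp
    (LinearMap.congr_fun h ((Representation.ind H.subtype (characterRep χ)).asModuleEquiv x))

lemma span_indGen : Submodule.span k[G] {indGen χ} = ⊤ := by
  rw [← Submodule.restrictScalars_eq_top_iff k, ← top_le_iff, ← span_range_of_smul_indGen χ,
    Submodule.span_le]
  rintro _ ⟨g, rfl⟩
  exact Submodule.smul_mem _ _ (Submodule.mem_span_singleton_self _)

lemma span_range_transversal_smul_indGen {ι : Type*} {r : ι → G} (hr : ∀ g, ∃ i, (r i)⁻¹ * g ∈ H) :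
    Submodule.span k (Set.range fun i => MonoidAlgebra.of k G (r i) • indGen χ) = ⊤ := by
  rw [← top_le_iff, ← span_range_of_smul_indGen, Submodule.span_le]
  rintro _ ⟨g, rfl⟩
  obtain ⟨i, hi⟩ := hr g
  have h := of_smul_indGen χ ⟨_, hi⟩
  have hg : MonoidAlgebra.of k G g • indGen χ =
      χ ⟨_, hi⟩ • MonoidAlgebra.of k G (r i) • indGen χ := by
    rw [smul_comm, ← h, smul_smul, ← map_mul, mul_inv_cancel_left]
  change MonoidAlgebra.of k G g • indGen χ ∈ Submodule.span k _
  exact hg ▸ Submodule.smul_mem _ _ (Submodule.subset_span ⟨i, rfl⟩)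

variable {χ} {M : Type*} [AddCommGroup M] [Module k M] [Module k[G] M] [IsScalarTower k k[G] M]

lemma exists_linearMap_indGen_eq {m : M} (hm : ∀ h : H, MonoidAlgebra.of k G h • m = χ h • m) :
    ∃ f : IndCharacter χ →ₗ[k[G]] M, f (indGen χ) = m := by
  let toM : k[G] →ₗ[k] k →ₗ[k] M := (MonoidAlgebra.basis G k).constr k fun g =>
    LinearMap.toSpanSingleton k M (MonoidAlgebra.of k G g⁻¹ • m)
  have toM_single (g : G) (a : k) :
      toM (MonoidAlgebra.single g 1) a = a • MonoidAlgebra.of k G g⁻¹ • m := by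
    have h := (MonoidAlgebra.basis G k).constr_basis k (fun g =>
      LinearMap.toSpanSingleton k M (MonoidAlgebra.of k G g⁻¹ • m)) g
    rw [MonoidAlgebra.basis_apply] at h
    exact LinearMap.congr_fun h a
  let f : Representation.IndV H.subtype (characterRep χ) →ₗ[k] M :=
    Representation.Coinvariants.lift _ (TensorProduct.lift toM) fun h => by
      refine TensorProduct.ext (MonoidAlgebra.lhom_ext' fun g => LinearMap.ext_ring ?_)
      ext
      have key : toM (MonoidAlgebra.single ((h : G) * g) 1) (χ h * 1) =
          toM (MonoidAlgebra.single g 1) 1 := by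
        rw [toM_single, toM_single, mul_inv_rev, map_mul, ← smul_smul _ _ m,
          ← Subgroup.coe_inv, hm h⁻¹, smul_comm _ (χ h⁻¹) m, smul_smul, mul_one, ← map_mul,
          mul_inv_cancel, map_one]
      simpa [characterRep_apply] using key
  have f_mk (g : G) (a : k) : f (Representation.IndV.mk H.subtype (characterRep χ) g a) =
      a • MonoidAlgebra.of k G g⁻¹ • m := toM_single g a
  refine ⟨linearMapOfCommutes _ f fun g x => ?_, ?_⟩
  · have h : f ∘ₗ Representation.ind H.subtype (characterRep χ) g =
        Algebra.lsmul k k M (MonoidAlgebra.of k G g) ∘ₗ f := by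
      refine Representation.IndV.hom_ext _ _ fun g' => LinearMap.ext_ring ?_
      change f (Representation.ind H.subtype _ g (Representation.IndV.mk H.subtype _ g' 1)) =
        MonoidAlgebra.of k G g • f (Representation.IndV.mk H.subtype _ g' 1)
      rw [Representation.ind_mk, f_mk, f_mk, one_smul, one_smul, smul_smul, ← map_mul, mul_inv_rev,
        inv_inv]
    exact LinearMap.congr_fun h x
  · exact (f_mk 1 1).trans (by rw [inv_one, map_one, one_smul, one_smul])

section Transversal

variable {ι : Type*} {r : ι → G} (hr : ∀ g, ∃ i, (r i)⁻¹ * g ∈ H)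
  {f : IndCharacter χ →ₗ[k[G]] M}
  (hf : LinearIndependent k fun i => MonoidAlgebra.of k G (r i) • f (indGen χ))

include hr hf

lemma exists_basis_transversal_smul_indGen :
    ∃ b : Module.Basis ι k (IndCharacter χ), ∀ i, b i = MonoidAlgebra.of k G (r i) • indGen χ := by
  have hli : LinearIndependent k fun i => MonoidAlgebra.of k G (r i) • indGen χ :=
    LinearIndependent.of_comp (f.restrictScalars k) (by
      simpa only [Function.comp_def, LinearMap.restrictScalars_apply, map_smul] using hf)
  exact ⟨.mk hli (span_range_transversal_smul_indGen χ hr).ge, Module.Basis.mk_apply _ _⟩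

lemma finrank_indCharacter [Fintype ι] : Module.finrank k (IndCharacter χ) = Fintype.card ι := by
  obtain ⟨b, -⟩ := exists_basis_transversal_smul_indGen hr hf
  exact Module.finrank_eq_card_basis b

lemma injective_of_linearIndependent_smul_indGen [Finite ι] : Function.Injective f := by
  cases nonempty_fintype ι
  obtain ⟨b, hb⟩ := exists_basis_transversal_smul_indGen hr hf
  refine (injective_iff_map_eq_zero f).mpr fun x hx => ?_
  rw [← b.sum_repr x, map_sum] at hx
  have h := Fintype.linearIndependent_iff.mp hf (b.repr x) (by
    rw [← hx]
    refine Finset.sum_congr rfl fun i _ => ?_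
    rw [hb, ← map_smul, ← LinearMap.restrictScalars_apply k f, ← map_smul,
      LinearMap.restrictScalars_apply])
  exact b.ext_elem fun i => by rw [h i, map_zero, Finsupp.zero_apply]

end Transversal

end InducedCharacters

/-! ### Computation in the group algebra of `A₅` -/

/-- The cycle `(1,2,3,4,5)`. -/
def cycle12345 : A5 := ⟨finRotate 5, by rw [Equiv.Perm.mem_alternatingGroup]; decide⟩

/-- The double transposition `(1,2)(3,4)`. -/
def swaps1234 : A5 :=
  ⟨Equiv.swap 0 1 * Equiv.swap 2 3, by rw [Equiv.Perm.mem_alternatingGroup]; decide⟩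

/-- The elements of the Klein four-group of `A₄`. -/
def klein : Fin 4 → A5 :=
  ![1, swaps1234, cycle123 * swaps1234 * cycle123⁻¹, cycle123⁻¹ * swaps1234 * cycle123]

/-- An enumeration of `A₅` by the factorisation `A₅ = ⟨(1,2,3,4,5)⟩ · ⟨(1,2,3)⟩ · V₄`. -/
def elt (l : Fin 60) : A5 :=
  cycle12345 ^ (l / 12 : ℕ) * cycle123 ^ (l / 4 % 3 : ℕ) * klein (Fin.ofNat 4 l)

/-- The group elements from which the elements of the group algebra are written down. -/
inductive Letter
  | c | cInv | t | w

namespace Letter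

/-- The element of `A₅` denoted by a letter. -/
def toA5 : Letter → A5
  | c => cycle12345
  | cInv => cycle12345⁻¹
  | t => cycle123
  | w => swaps1234

/-- The `l`-th entry for the letter `s` is the index of `s⁻¹ * elt l`. -/
def source : Letter → List ℕ
  | c => (List.range 60).map fun l => (l + 48) % 60
  | cInv => (List.range 60).map fun l => (l + 12) % 60
  | t => [8, 9, 10, 11, 0, 1, 2, 3, 4, 5, 6, 7, 39, 38, 37, 36, 42, 43, 40, 41, 45, 44, 47, 46,
      21, 20, 23, 22, 15, 14, 13, 12, 18, 19, 16, 17, 28, 29, 30, 31, 32, 33, 34, 35, 24, 25, 26,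
      27, 55, 54, 53, 52, 58, 59, 56, 57, 49, 48, 51, 50]
  | w => [1, 0, 3, 2, 7, 6, 5, 4, 10, 11, 8, 9, 34, 35, 32, 33, 25, 24, 27, 26, 31, 30, 29, 28, 17,
      16, 19, 18, 23, 22, 21, 20, 14, 15, 12, 13, 54, 55, 52, 53, 57, 56, 59, 58, 51, 50, 49, 48,
      47, 46, 45, 44, 38, 39, 36, 37, 41, 40, 43, 42]

lemma length_source (s : Letter) : s.source.length = 60 := by cases s <;> rfl

/-- The index of `s⁻¹ * elt l`. -/
def sourceFin (s : Letter) (l : Fin 60) : Fin 60 := Fin.ofNat 60 (s.source.getD l 0)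

lemma toA5_mul_elt_sourceFin (s : Letter) : ∀ l, s.toA5 * elt (s.sourceFin l) = elt l := by
  cases s <;> decide +kernel

lemma sourceFin_injective (s : Letter) : Function.Injective s.sourceFin := by
  cases s <;> decide +kernel

end Letter

lemma elt_injective : Function.Injective elt := by decide +kernel

/-- Expressions for elements of `k[A₅]`, where `ω : k` is a root of `X² + X + 1`. -/
inductive AlgTerm
  | zero | one | omega
  | letter (s : Letter)
  | add (p q : AlgTerm)
  | mul (p q : AlgTerm)

namespace AlgTerm

instance : Zero AlgTerm := ⟨zero⟩
instance : One AlgTerm := ⟨one⟩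
instance : Add AlgTerm := ⟨add⟩
instance : Mul AlgTerm := ⟨mul⟩

section Bits

/-- `f x`, arranged so that the kernel evaluates `x` to a numeral before it substitutes `x` in `f`;
without this the cost of `AlgTerm.apply` is exponential. -/
def force {α : Type*} (x : ℕ) (f : ℕ → α) : α :=
  match x with
  | 0 => f 0
  | y + 1 => f (y + 1)

lemma force_eq {α : Type*} (x : ℕ) (f : ℕ → α) : force x f = f x := by cases x <;> rfl

/-- The number whose `l`-th binary digit is the digit of `x` at the position given by the `l`-th
entry of the list. -/
def permuteBits : List ℕ → ℕ → ℕ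
  | [], _ => 0
  | m :: L, x => Nat.bit (x.testBit m) (permuteBits L x)

lemma testBit_permuteBits (x : ℕ) : ∀ (L : List ℕ) (l : ℕ), l < L.length →
    (permuteBits L x).testBit l = x.testBit (L.getD l 0)
  | m :: L, 0, _ => by rw [permuteBits, Nat.testBit_bit_zero, List.getD_cons_zero]
  | m :: L, l + 1, h => by
    rw [permuteBits, Nat.testBit_bit_succ, testBit_permuteBits x L l (Nat.lt_of_succ_lt_succ h),
      List.getD_cons_succ]

/-- Multiplication by `ω` on coefficient vectors. -/
def mulOmega (x : ℕ) : ℕ :=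
  (x >>> 60) % 2 ^ 60 ^^^ (x % 2 ^ 60 ^^^ (x >>> 60) % 2 ^ 60) <<< 60

/-- Multiplication by a letter on coefficient vectors. -/
def mulLetter (s : Letter) (x : ℕ) : ℕ := permuteBits (s.source ++ s.source.map (· + 60)) x

end Bits

/-- Multiplication by an expression on coefficient vectors. The vector of
`∑ l, (aₗ + bₗ ω) • elt l`, where `aₗ, bₗ ∈ {0, 1}`, is the number with binary digits `aₗ` at the
positions `l < 60` and `bₗ` at the positions `60 + l`. -/
def apply : AlgTerm → ℕ → ℕ
  | zero, _ => 0
  | one, x => x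
  | omega, x => force x mulOmega
  | letter s, x => force x (mulLetter s)
  | add p q, x => force x fun x => apply p x ^^^ apply q x
  | mul p q, x => apply p (apply q x)

section Eval

variable {k : Type*} [Field k] (ω : k)

/-- The element of the group algebra denoted by an expression. -/
noncomputable def eval : AlgTerm → k[A5]
  | zero => 0
  | one => 1
  | omega => MonoidAlgebra.single 1 ω
  | letter s => MonoidAlgebra.of k A5 s.toA5
  | add p q => eval p + eval q
  | mul p q => eval p * eval q

@[simp] lemma eval_zero : eval ω 0 = 0 := rfl
@[simp] lemma eval_one : eval ω 1 = 1 := rfl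
@[simp] lemma eval_add (p q : AlgTerm) : eval ω (p + q) = eval ω p + eval ω q := rfl
@[simp] lemma eval_mul (p q : AlgTerm) : eval ω (p * q) = eval ω p * eval ω q := rfl

/-- The coefficient at `elt l` of a coefficient vector. -/
def coeff (x l : ℕ) : k := (x.testBit l).toNat + ω * (x.testBit (60 + l)).toNat

/-- The element of the group algebra with a given coefficient vector. -/
noncomputable def value (x : ℕ) : k[A5] :=
  ∑ l : Fin 60, MonoidAlgebra.single (elt l) (coeff ω x l)

lemma value_zero : value ω 0 = 0 := by simp [value, coeff]

lemma value_one : value ω 1 = 1 := by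
  have testBit_one : ∀ l : Fin 60, Nat.testBit 1 l = decide (l = 0) ∧
      Nat.testBit 1 (60 + l) = false := by decide
  rw [value, Finset.sum_eq_single 0]
  · have : Nat.testBit 1 60 = false := (testBit_one 0).2
    simp [coeff, this, elt, klein, MonoidAlgebra.one_def]
  · intro l _ hl
    simp [coeff, testBit_one l, hl]
  · simp

lemma coeff_value (x : ℕ) (l : Fin 60) : (value ω x).coeff (elt l) = coeff ω x l := by
  rw [value, MonoidAlgebra.coeff_sum, Finsupp.finsetSum_apply, Finset.sum_eq_single l]
  · simp
  · intro m _ hm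
    simp [elt_injective.ne hm]
  · simp

lemma coeff_mulLetter (s : Letter) (x : ℕ) (l : Fin 60) :
    coeff ω (mulLetter s x) l = coeff ω x (s.sourceFin l) := by
  have table : ∀ l : Fin 60,
      (s.source ++ s.source.map (· + 60)).getD l 0 = (s.sourceFin l).val ∧
      (s.source ++ s.source.map (· + 60)).getD (60 + l) 0 = 60 + (s.sourceFin l).val := by
    cases s <;> decide +kernel
  have length_table : (s.source ++ s.source.map (· + 60)).length = 120 := by
    rw [List.length_append, List.length_map, s.length_source]
  rw [coeff, mulLetter, testBit_permuteBits _ _ _ (by omega), testBit_permuteBits _ _ _ (by omega),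
    (table l).1, (table l).2]
  rfl

lemma value_mulLetter (s : Letter) (x : ℕ) :
    value ω (mulLetter s x) = MonoidAlgebra.of k A5 s.toA5 * value ω x := by
  have sourceFin_bijective := Finite.injective_iff_bijective.mp s.sourceFin_injective
  calc value ω (mulLetter s x)
    _ = ∑ l, MonoidAlgebra.single (s.toA5 * elt (s.sourceFin l)) (coeff ω x (s.sourceFin l)) := by
      simp only [value, coeff_mulLetter, s.toA5_mul_elt_sourceFin]
    _ = ∑ l, MonoidAlgebra.single (s.toA5 * elt l) (coeff ω x l) :=
      sourceFin_bijective.sum_comp fun l => MonoidAlgebra.single (s.toA5 * elt l) (coeff ω x l)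
    _ = MonoidAlgebra.of k A5 s.toA5 * value ω x := by
      simp only [value, Finset.mul_sum, MonoidAlgebra.of_apply, MonoidAlgebra.single_mul_single,
        one_mul]

variable [CharP k 2]

lemma toNat_xor_cast (a b : Bool) : ((a ^^ b).toNat : k) = a.toNat + b.toNat := by
  cases a <;> cases b <;> simp [CharTwo.add_self_eq_zero]

lemma value_xor (x y : ℕ) : value ω (x ^^^ y) = value ω x + value ω y := by
  simp only [value, ← Finset.sum_add_distrib, ← MonoidAlgebra.single_add, coeff, Nat.testBit_xor,
    toNat_xor_cast]
  congr! 2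
  ring

variable {ω}

lemma value_mulOmega (hω : ω ^ 2 + ω + 1 = 0) (x : ℕ) :
    value ω (mulOmega x) = MonoidAlgebra.single 1 ω * value ω x := by
  have coeff_mulOmega (l : Fin 60) : coeff ω (mulOmega x) l = ω * coeff ω x l := by
    have low : (mulOmega x).testBit l = x.testBit (60 + l) := by
      have := l.isLt
      rw [mulOmega, Nat.testBit_xor, Nat.testBit_shiftLeft, Nat.testBit_mod_two_pow,
        Nat.testBit_shiftRight]
      simp [this, this.not_ge]
    have high : (mulOmega x).testBit (60 + l) = (x.testBit l ^^ x.testBit (60 + l)) := by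
      rw [mulOmega, Nat.testBit_xor, Nat.testBit_shiftLeft, Nat.testBit_mod_two_pow,
        Nat.testBit_xor, Nat.add_sub_cancel_left, Nat.testBit_mod_two_pow,
        Nat.testBit_mod_two_pow, Nat.testBit_shiftRight, Nat.testBit_shiftRight]
      simp
    rw [coeff, low, high, toNat_xor_cast, coeff]
    linear_combination - ((x.testBit (60 + l)).toNat : k) * hω +
      ((1 + ω) * (x.testBit (60 + l)).toNat : k) * CharTwo.two_eq_zero (R := k)
  simp only [value, coeff_mulOmega, Finset.mul_sum, MonoidAlgebra.single_mul_single, one_mul]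

lemma value_apply (hω : ω ^ 2 + ω + 1 = 0) (p : AlgTerm) (x : ℕ) :
    value ω (apply p x) = eval ω p * value ω x := by
  induction p generalizing x with
  | zero => rw [apply, eval, zero_mul, value_zero]
  | one => rw [apply, eval, one_mul]
  | omega => rw [apply, force_eq, value_mulOmega hω, eval]
  | letter s => rw [apply, force_eq, value_mulLetter, eval]
  | add p q hp hq => rw [apply, force_eq, value_xor, hp, hq, eval, add_mul]
  | mul p q hp hq => rw [apply, hp, hq, eval, mul_assoc]

lemma eval_eq_value (hω : ω ^ 2 + ω + 1 = 0) (p : AlgTerm) : eval ω p = value ω (apply p 1) := by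
  rw [value_apply hω, value_one, mul_one]

lemma eval_eq_of_apply_eq (hω : ω ^ 2 + ω + 1 = 0) {p q : AlgTerm}
    (h : apply p 1 = apply q 1) : eval ω p = eval ω q := by
  rw [eval_eq_value hω, eval_eq_value hω, h]

lemma coeff_eval (hω : ω ^ 2 + ω + 1 = 0) (p : AlgTerm) (l : Fin 60) :
    (eval ω p).coeff (elt l) = coeff ω (apply p 1) l := by
  rw [eval_eq_value hω, coeff_value]

lemma eval_ne_zero (hω : ω ^ 2 + ω + 1 = 0) {p : AlgTerm}
    (h : ∃ l : Fin 60, (apply p 1).testBit l = true ∧ (apply p 1).testBit (60 + l) = false) :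
    eval ω p ≠ 0 := by
  obtain ⟨l, h1, hω'⟩ := h
  intro h0
  have := coeff_eval hω p l
  simp [h0, coeff, h1, hω'] at this

end Eval

end AlgTerm

namespace AlgTerm

section Elements

/-- The letter `c = (1,2,3,4,5)` as an expression. -/
def c : AlgTerm := letter .c
/-- The inverse of `c` as an expression. -/
def c' : AlgTerm := letter .cInv
/-- The letter `t = (1,2,3)` as an expression. -/
def t : AlgTerm := letter .t
/-- The letter `w = (1,2)(3,4)` as an expression. -/
def w : AlgTerm := letter .w
/-- The involution `c w c⁻¹ = (2,3)(4,5)`, which inverts `t`. -/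
def n : AlgTerm := c * w * c'

/-- The idempotents `∑ i, ω⁻ⁱʲ tⁱ` of the group algebra of `⟨t⟩`, on which `t` acts as `ωʲ`. -/
def eps : Fin 3 → AlgTerm :=
  ![1 + t + t * t, 1 + omega * omega * t + omega * t * t, 1 + omega * t + omega * omega * t * t]

/-- The sum of the elements of the Klein four-group of `A₄`. -/
def sumKlein : AlgTerm := (1 + w) * (1 + t * w * t * t)

/-- The sum of the elements of `A₄`. -/
def sumA4 : AlgTerm := eps 0 * sumKlein

/-- The idempotents of the basic algebra. -/
def idem : Fin 4 → AlgTerm :=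
  let e₂ := omega * eps 1 * c * eps 1 * c * eps 1
  ![eps 0 * c * c * eps 0 * c * c * eps 0,
    eps 1 + eps 1 * c * sumA4 * c' * eps 1 + e₂,
    e₂,
    (1 + n) * n * sumA4 * n]

/-- Involutions conjugating the representatives of the idempotents to the nine idempotents of the
regular module. -/
def conjugator : Fin 9 → AlgTerm := ![1, 1, n, 1, n, 1, w, t * w * t * t, t * t * w * t]

/-- The arrows of the quiver of the basic algebra. -/
def arrow : Fin 4 → AlgTerm :=
  ![idem 1 * c' * t * t * c * idem 0, idem 0 * c' * idem 1, idem 2 * c * idem 0,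
    idem 0 * c' * t * c * idem 2]
end Elements

lemma apply_idem_mul_conjugator_mul : ∀ p q : Fin 9,
    apply (idem (label p) * conjugator p * (conjugator q * idem (label q))) 1 =
      apply (if p = q then idem (label p) else 0) 1 := by
  decide +kernel

lemma apply_sum_conjugator_mul_idem :
    apply ((List.finRange 9).foldr
      (fun p x => conjugator p * idem (label p) * (idem (label p) * conjugator p) + x) 0) 1 =
      apply 1 1 := by
  decide +kernel

section Frame

variable {k : Type*} [Field k] [CharP k 2] {ω : k} (hω : ω ^ 2 + ω + 1 = 0)

include hω

lemma sum_eval_conjugator_mul_idem : ∑ p, eval ω (conjugator p * idem (label p)) *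
    eval ω (idem (label p) * conjugator p) = 1 := by
  have h := eval_eq_of_apply_eq hω apply_sum_conjugator_mul_idem
  simpa [Fin.sum_univ_def, List.finRange, List.ofFn, Fin.foldr_succ] using h

/-- The idempotents and arrows of `k[A₅]`. -/
noncomputable def quiverFrame : QuiverFrame k[A5] where
  e i := eval ω (idem i)
  u p := eval ω (conjugator p * idem (label p))
  v p := eval ω (idem (label p) * conjugator p)
  base := ![0, 1, 3, 5]
  σ_base := by decide
  u_base i := by fin_cases i <;> exact one_mul _
  v_base i := by fin_cases i <;> exact mul_one _
  v_mul_u p q := by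
    have h := eval_eq_of_apply_eq hω (apply_idem_mul_conjugator_mul p q)
    rw [apply_ite (eval ω)] at h
    exact h
  sum_u_mul_v := sum_eval_conjugator_mul_idem hω
  α := eval ω (arrow 0)
  β := eval ω (arrow 1)
  γ := eval ω (arrow 2)
  δ := eval ω (arrow 3)
  e_α := eval_eq_of_apply_eq hω (p := idem 1 * arrow 0) (by decide +kernel)
  α_e := eval_eq_of_apply_eq hω (p := arrow 0 * idem 0) (by decide +kernel)
  e_β := eval_eq_of_apply_eq hω (p := idem 0 * arrow 1) (by decide +kernel)
  β_e := eval_eq_of_apply_eq hω (p := arrow 1 * idem 1) (by decide +kernel)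
  e_γ := eval_eq_of_apply_eq hω (p := idem 2 * arrow 2) (by decide +kernel)
  γ_e := eval_eq_of_apply_eq hω (p := arrow 2 * idem 0) (by decide +kernel)
  e_δ := eval_eq_of_apply_eq hω (p := idem 0 * arrow 3) (by decide +kernel)
  δ_e := eval_eq_of_apply_eq hω (p := arrow 3 * idem 2) (by decide +kernel)
  α_β := eval_eq_of_apply_eq hω (p := arrow 0 * arrow 1) (q := 0) (by decide +kernel)
  γ_δ := eval_eq_of_apply_eq hω (p := arrow 2 * arrow 3) (q := 0) (by decide +kernel)
  β_α_δ_γ := eval_eq_of_apply_eq hω (p := arrow 1 * (arrow 0 * (arrow 3 * arrow 2)))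
    (q := arrow 3 * (arrow 2 * (arrow 1 * arrow 0))) (by decide +kernel)
  δ_γ_β_α_ne_zero := eval_ne_zero hω (p := arrow 3 * (arrow 2 * (arrow 1 * arrow 0)))
    (by decide +kernel)
  α_δ_γ_β_ne_zero := eval_ne_zero hω (p := arrow 0 * (arrow 3 * (arrow 2 * arrow 1)))
    (by decide +kernel)
  γ_β_α_δ_ne_zero := eval_ne_zero hω (p := arrow 2 * (arrow 1 * (arrow 0 * arrow 3)))
    (by decide +kernel)
  e_ne_zero i := eval_ne_zero hω (by revert i; decide +kernel)

end Frame

end AlgTerm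

lemma card_A5 : Fintype.card A5 = 60 := by
  rw [← Nat.card_eq_fintype_card, nat_card_alternatingGroup, Nat.card_eq_fintype_card,
    Fintype.card_fin]
  rfl

lemma elt_surjective : Function.Surjective elt :=
  ((Fintype.bijective_iff_injective_and_card elt).mpr
    ⟨elt_injective, by rw [card_A5, Fintype.card_fin]⟩).surjective

lemma finrank_monoidAlgebra_A5 (k : Type*) [Field k] : Module.finrank k k[A5] = 60 := by
  rw [Module.finrank_eq_card_basis (MonoidAlgebra.basis A5 k), card_A5]

lemma klein_mem {N : Submonoid A5} (ht : cycle123 ∈ N) (hw : swaps1234 ∈ N) (i : Fin 4) :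
    klein i ∈ N := by
  have ht' : cycle123⁻¹ ∈ N := by
    rw [show cycle123⁻¹ = cycle123 ^ 2 by decide]
    exact N.pow_mem ht 2
  fin_cases i
  · exact N.one_mem
  · exact hw
  · exact N.mul_mem (N.mul_mem ht hw) ht'
  · exact N.mul_mem (N.mul_mem ht' hw) ht

lemma closure_cycles : Submonoid.closure {cycle12345, cycle123} = ⊤ := by
  refine eq_top_iff.mpr fun g _ => ?_
  obtain ⟨l, rfl⟩ := elt_surjective g
  have hc : cycle12345 ∈ Submonoid.closure {cycle12345, cycle123} :=
    Submonoid.subset_closure (Set.mem_insert _ _)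
  have ht : cycle123 ∈ Submonoid.closure {cycle12345, cycle123} :=
    Submonoid.subset_closure (Set.mem_insert_of_mem _ rfl)
  have hw : swaps1234 ∈ Submonoid.closure {cycle12345, cycle123} := by
    rw [show swaps1234 = cycle12345 * cycle123 ^ 2 * cycle12345 ^ 4 * cycle123 ^ 2 by decide]
    exact mul_mem (mul_mem (mul_mem hc (pow_mem ht 2)) (pow_mem hc 4)) (pow_mem ht 2)
  exact mul_mem (mul_mem (pow_mem hc _) (pow_mem ht _)) (klein_mem ht hw _)

lemma lt_of_elt_mem_A4 : ∀ l : Fin 60, (elt l : Equiv.Perm (Fin 5)) 4 = 4 → (l / 12 : ℕ) = 0 := by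
  decide +kernel

lemma swaps1234_mem_A4 : swaps1234 ∈ A4 := by
  rw [MulAction.mem_stabilizer_iff]
  decide

lemma mem_of_mem_A4 {N : Submonoid A5} (ht : cycle123 ∈ N) (hw : swaps1234 ∈ N) {g : A5}
    (hg : g ∈ A4) : g ∈ N := by
  obtain ⟨l, rfl⟩ := elt_surjective g
  rw [elt, lt_of_elt_mem_A4 l hg, pow_zero, one_mul]
  exact mul_mem (pow_mem ht _) (klein_mem ht hw _)

section ProjectiveLine

variable {k : Type*} [Field k]

lemma linePoint_ne_zero (η : k) (i : Fin 5) : linePoint η i ≠ 0 := by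
  intro h
  have h0 := congrFun h 0
  have h1 := congrFun h 1
  fin_cases i <;> simp [linePoint] at h0 h1

lemma IsProjectiveLineRep.exists_character {η : k} {ρ : Representation k A5 (Fin 2 → k)}
    (hρ : IsProjectiveLineRep η ρ) : ∃ χ : A4 →* k,
      ∀ h : A4, ρ h (linePoint η 4) = χ h • linePoint η 4 := by
  have hex (h : A4) : ∃ c : k, ρ h (linePoint η 4) = c • linePoint η 4 := by
    obtain ⟨c, hc⟩ := hρ.2 h 4
    have h4 : ((h : A5) : Equiv.Perm (Fin 5)) 4 = 4 := h.2
    exact ⟨c, by rw [hc, h4]⟩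
  choose c hc using hex
  have hinj : Function.Injective fun a : k => a • linePoint η 4 :=
    smul_left_injective k (linePoint_ne_zero η 4)
  refine ⟨⟨⟨c, hinj ?_⟩, fun g h => hinj ?_⟩, hc⟩
  · simp only [← hc, one_smul, OneMemClass.coe_one, map_one, Module.End.one_apply]
  · simp only [← hc, Subgroup.coe_mul, map_mul, Module.End.mul_apply, mul_smul]
    rw [hc h, map_smul, hc g, smul_smul, smul_smul, mul_comm]

/-- The matrix by which `(1,2,3,4,5)` acts in the projective line representation. -/
def cycle12345Matrix (η : k) : Matrix (Fin 2) (Fin 2) k := !![0, η ^ 2; η, η ^ 2]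

/-- The matrix by which `(1,2,3)` acts in the projective line representation. -/
def cycle123Matrix (η : k) : Matrix (Fin 2) (Fin 2) k := !![η, 0; 0, η ^ 2]

variable [CharP k 2] {η : k} (hη : η ^ 2 + η + 1 = 0)

include hη

lemma cycle12345Matrix_mulVec_linePoint (i : Fin 5) : (cycle12345Matrix η).mulVec (linePoint η i) =
    ![η ^ 2, 1, η, η, η ^ 2] i • linePoint η ((cycle12345 : Equiv.Perm (Fin 5)) i) := by
  have := CharTwo.two_eq_zero (R := k)
  have : η ^ 3 = 1 := by linear_combination (η - 1) * hη
  rw [show (cycle12345 : Equiv.Perm (Fin 5)) i = ![1, 2, 3, 4, 0] i by revert i; decide]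
  ext r
  fin_cases i <;> fin_cases r <;> simp [cycle12345Matrix, linePoint] <;> grind

omit [CharP k 2] in
lemma cycle123Matrix_mulVec_linePoint (i : Fin 5) : (cycle123Matrix η).mulVec (linePoint η i) =
    ![η, η, η, η, η ^ 2] i • linePoint η ((cycle123 : Equiv.Perm (Fin 5)) i) := by
  have : η ^ 3 = 1 := by linear_combination (η - 1) * hη
  rw [show (cycle123 : Equiv.Perm (Fin 5)) i = ![1, 2, 0, 3, 4] i by revert i; decide]
  ext r
  fin_cases i <;> fin_cases r <;> simp [cycle123Matrix, linePoint] <;> grind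

lemma isProjectiveLineRep_of_generators {ρ : Representation k A5 (Fin 2 → k)}
    (hc : ρ cycle12345 = (cycle12345Matrix η).toLin')
    (ht : ρ cycle123 = (cycle123Matrix η).toLin') :
    IsProjectiveLineRep η ρ := by
  have h2 := CharTwo.two_eq_zero (R := k)
  have h3 : η ^ 3 = 1 := by linear_combination (η - 1) * hη
  suffices h : ∀ g, LinearMap.det (ρ g) = 1 ∧ ∀ i, ∃ c : k,
      ρ g (linePoint η i) = c • linePoint η ((g : Equiv.Perm (Fin 5)) i) from
    ⟨fun g => (h g).1, fun g => (h g).2⟩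
  intro g
  have hg : g ∈ Submonoid.closure {cycle12345, cycle123} := closure_cycles ▸ Submonoid.mem_top g
  induction hg using Submonoid.closure_induction with
  | one => exact ⟨by rw [map_one, map_one], fun i => ⟨1, by rw [map_one, one_smul]; rfl⟩⟩
  | mul g h _ _ ihg ihh =>
    refine ⟨by rw [map_mul, map_mul, ihg.1, ihh.1, one_mul], fun i => ?_⟩
    obtain ⟨c, hc⟩ := ihh.2 i
    obtain ⟨d, hd⟩ := ihg.2 ((h : Equiv.Perm (Fin 5)) i)
    exact ⟨c * d, by rw [map_mul, Module.End.mul_apply, hc, map_smul, hd, smul_smul]; rfl⟩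
  | mem g hg =>
    rcases hg with rfl | rfl
    · rw [hc]
      refine ⟨?_, fun i => ⟨_, cycle12345Matrix_mulVec_linePoint hη i⟩⟩
      rw [LinearMap.det_toLin', cycle12345Matrix, Matrix.det_fin_two_of]
      linear_combination -h3 - h2
    · rw [ht]
      refine ⟨?_, fun i => ⟨_, cycle123Matrix_mulVec_linePoint hη i⟩⟩
      rw [LinearMap.det_toLin', cycle123Matrix, Matrix.det_fin_two_of]
      linear_combination h3

variable {M : Type*} [AddCommGroup M] [Module k M] [Module k[A5] M] [IsScalarTower k k[A5] M]

lemma linearIndependent_of_eigenvectors {w₀ w₁ : M} (h₀ : w₀ ≠ 0) (h₁ : w₁ ≠ 0)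
    (ht₀ : MonoidAlgebra.of k A5 cycle123 • w₀ = η • w₀)
    (ht₁ : MonoidAlgebra.of k A5 cycle123 • w₁ = η ^ 2 • w₁) :
    LinearIndependent k ![w₀, w₁] := by
  have ne_sq : η ≠ η ^ 2 := fun h => one_ne_zero (α := k)
    (by linear_combination hη + h - η * CharTwo.two_eq_zero (R := k))
  have eigenvalues_injective : Function.Injective ![η, η ^ 2] :=
    Fin.cons_injective_iff.mpr ⟨by simpa using ne_sq, Function.injective_of_subsingleton _⟩
  refine Module.End.eigenvectors_linearIndependent'
    (Algebra.lsmul k k M (MonoidAlgebra.of k A5 cycle123)) _ eigenvalues_injective _ fun i => ?_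
  fin_cases i
  · exact ⟨Module.End.mem_eigenspace_iff.mpr ht₀, h₀⟩
  · exact ⟨Module.End.mem_eigenspace_iff.mpr ht₁, h₁⟩

lemma exists_isProjectiveLineRep {w₀ w₁ : M} (h₀ : w₀ ≠ 0) (h₁ : w₁ ≠ 0)
    (hc₀ : MonoidAlgebra.of k A5 cycle12345 • w₀ = η • w₁)
    (hc₁ : MonoidAlgebra.of k A5 cycle12345 • w₁ = η ^ 2 • (w₀ + w₁))
    (ht₀ : MonoidAlgebra.of k A5 cycle123 • w₀ = η • w₀)
    (ht₁ : MonoidAlgebra.of k A5 cycle123 • w₁ = η ^ 2 • w₁) :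
    ∃ ρ : Representation k A5 (Fin 2 → k), IsProjectiveLineRep η ρ ∧
      ρ cycle123 (linePoint η 4) = η ^ 2 • linePoint η 4 ∧
      ∃ f : ρ.asModule →ₗ[k[A5]] M,
        w₀ ∈ LinearMap.range f ∧ w₁ ∈ LinearMap.range f ∧ Function.Injective f := by
  let f : (Fin 2 → k) →ₗ[k] M := Fintype.linearCombination k ![w₀, w₁]
  have f_apply (x : Fin 2 → k) : f x = x 0 • w₀ + x 1 • w₁ := by
    simp [f, Fintype.linearCombination_apply]
  have f_inj : Function.Injective f :=
    (linearIndependent_of_eigenvectors hη h₀ h₁ ht₀ ht₁).fintypeLinearCombination_injective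
  have f_c (x : Fin 2 → k) : MonoidAlgebra.of k A5 cycle12345 • f x =
      f ((cycle12345Matrix η).toLin' x) := by
    simp only [f_apply, smul_add, smul_comm (MonoidAlgebra.of k A5 _), hc₀, hc₁,
      Matrix.toLin'_apply, cycle12345Matrix, Matrix.mulVec, dotProduct, Fin.sum_univ_two,
      Matrix.of_apply, Matrix.cons_val_zero, Matrix.cons_val_one]
    module
  have f_t (x : Fin 2 → k) : MonoidAlgebra.of k A5 cycle123 • f x =
      f ((cycle123Matrix η).toLin' x) := by
    simp only [f_apply, smul_add, smul_comm (MonoidAlgebra.of k A5 _), ht₀, ht₁,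
      Matrix.toLin'_apply, cycle123Matrix, Matrix.mulVec, dotProduct, Fin.sum_univ_two,
      Matrix.of_apply, Matrix.cons_val_zero, Matrix.cons_val_one]
    module
  obtain ⟨ρ, hρ⟩ := exists_representation_of_injective closure_cycles f_inj (by
    rintro _ (rfl | rfl) x
    exacts [⟨_, (f_c x).symm⟩, ⟨_, (f_t x).symm⟩])
  have hρt : ρ cycle123 = (cycle123Matrix η).toLin' :=
    LinearMap.ext fun x => f_inj ((hρ _ x).trans (f_t x))
  refine ⟨ρ, isProjectiveLineRep_of_generators hη
    (LinearMap.ext fun x => f_inj ((hρ _ x).trans (f_c x))) hρt, ?_,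
    linearMapOfCommutes ρ f hρ, ⟨ρ.asModuleEquiv.symm ![1, 0], ?_⟩,
    ⟨ρ.asModuleEquiv.symm ![0, 1], ?_⟩, f_inj⟩
  · rw [hρt, Matrix.toLin'_apply, cycle123Matrix_mulVec_linePoint hη]
    rfl
  · change f ![1, 0] = w₀
    simp [f_apply]
  · change f ![0, 1] = w₁
    simp [f_apply]

end ProjectiveLine

section Simples

namespace AlgTerm

/-- Generators of simple submodules of the regular module, isomorphic to `S₂` and `S₃`. -/
def socleGen : Fin 2 → AlgTerm :=
  ![arrow 0 * (arrow 3 * (arrow 2 * arrow 1)), arrow 2 * (arrow 1 * (arrow 0 * arrow 3))]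

lemma eval_omega_mul {k : Type*} [Field k] (ω : k) (p : AlgTerm) :
    eval ω (omega * p) = ω • eval ω p := by
  rw [eval_mul, Algebra.smul_def]
  rfl

variable {k : Type*} [Field k] [CharP k 2] {ω : k} (hω : ω ^ 2 + ω + 1 = 0)

include hω

lemma isTop_of_mem_range {i : Fin 4} {ρ : Representation k A5 (Fin 2 → k)} {x : k[A5]}
    (hdim : IdempotentFrame.dim label i = 2) (hx : x ≠ 0) (hi : (quiverFrame hω).e i • x = x)
    {f : ρ.asModule →ₗ[k[A5]] k[A5]} (hf : Function.Injective f) (hmem : x ∈ LinearMap.range f) :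
    (quiverFrame hω).IsTop i ρ.asModule := by
  obtain ⟨y, rfl⟩ := hmem
  refine (quiverFrame hω).isTop_of_finrank_eq k (x := y) (ne_zero_of_map hx)
    (hf (by rw [map_smul, hi])) ?_
  rw [hdim, ρ.asModuleEquiv.finrank_eq, Module.finrank_fin_fun]

lemma exists_isProjectiveLineRep_one : ∃ ρ : Representation k A5 (Fin 2 → k),
    IsProjectiveLineRep ω ρ ∧ ρ cycle123 (linePoint ω 4) = ω ^ 2 • linePoint ω 4 ∧
    (quiverFrame hω).IsTop 1 ρ.asModule := by
  have hs : eval ω (socleGen 0) ≠ 0 := eval_ne_zero hω (by decide +kernel)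
  obtain ⟨ρ, hρ, hline, f, hmem, -, hf⟩ := exists_isProjectiveLineRep hω hs
    (w₁ := eval ω (omega * (omega * (c * socleGen 0)))) (eval_ne_zero hω (by decide +kernel))
    (by
      rw [← eval_omega_mul]
      exact eval_eq_of_apply_eq hω (p := c * socleGen 0) (by decide +kernel))
    (by
      rw [← eval_add, sq, mul_smul, ← eval_omega_mul, ← eval_omega_mul]
      exact eval_eq_of_apply_eq hω (p := c * _) (by decide +kernel))
    (by
      rw [← eval_omega_mul]
      exact eval_eq_of_apply_eq hω (p := t * socleGen 0) (by decide +kernel))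
    (by
      rw [sq, mul_smul, ← eval_omega_mul, ← eval_omega_mul]
      exact eval_eq_of_apply_eq hω (p := t * _) (by decide +kernel))
  exact ⟨ρ, hρ, hline, isTop_of_mem_range hω rfl hs
    (eval_eq_of_apply_eq hω (p := idem 1 * socleGen 0) (by decide +kernel)) hf hmem⟩

lemma exists_isProjectiveLineRep_two : ∃ ρ : Representation k A5 (Fin 2 → k),
    IsProjectiveLineRep (ω ^ 2) ρ ∧ ρ cycle123 (linePoint (ω ^ 2) 4) = ω • linePoint (ω ^ 2) 4 ∧
    (quiverFrame hω).IsTop 2 ρ.asModule := by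
  have hω4 : (ω ^ 2) ^ 2 = ω := by linear_combination (ω ^ 2 - ω) * hω
  have hs : eval ω (socleGen 1) ≠ 0 := eval_ne_zero hω (by decide +kernel)
  obtain ⟨ρ, hρ, hline, f, -, hmem, hf⟩ := exists_isProjectiveLineRep (η := ω ^ 2)
    (by linear_combination (ω ^ 2 - ω + 1) * hω) (w₁ := eval ω (socleGen 1))
    (w₀ := eval ω (omega * (omega * (c * socleGen 1)) + socleGen 1))
    (eval_ne_zero hω (by decide +kernel)) hs
    (by
      rw [sq, mul_smul, ← eval_omega_mul, ← eval_omega_mul]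
      exact eval_eq_of_apply_eq hω (p := c * _) (by decide +kernel))
    (by
      rw [hω4, ← eval_add, ← eval_omega_mul]
      exact eval_eq_of_apply_eq hω (p := c * _) (by decide +kernel))
    (by
      rw [sq, mul_smul, ← eval_omega_mul, ← eval_omega_mul]
      exact eval_eq_of_apply_eq hω (p := t * _) (by decide +kernel))
    (by
      rw [hω4, ← eval_omega_mul]
      exact eval_eq_of_apply_eq hω (p := t * socleGen 1) (by decide +kernel))
  exact ⟨ρ, hρ, hω4 ▸ hline, isTop_of_mem_range hω rfl hs
    (eval_eq_of_apply_eq hω (p := idem 2 * socleGen 1) (by decide +kernel)) hf hmem⟩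

end AlgTerm

end Simples

namespace AlgTerm

section SumZero

variable {k : Type*} [Field k]

variable (k) in
lemma finrank_sumZero : Module.finrank k (sumZeroSubrep k).toSubmodule = 4 := by
  have sum_ne_zero : (∑ i : Fin 5, LinearMap.proj (R := k) (φ := fun _ => k) i) ≠ 0 := by
    intro h
    simpa using LinearMap.congr_fun h (Pi.single 0 1)
  have h := Module.Dual.finrank_ker_add_one_of_ne_zero sum_ne_zero
  rw [Module.finrank_fin_fun] at h
  exact Nat.succ_injective h

/-- A vector as an element of the permutation module. -/
def permVec (v : Fin 5 → k) : (permRep k).asModule := (permRep k).asModuleEquiv.symm v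

lemma permVec_add (v w : Fin 5 → k) : permVec v + permVec w = permVec (v + w) := rfl

lemma of_smul_permVec (g : A5) (v : Fin 5 → k) :
    MonoidAlgebra.of k A5 g • permVec v = permVec (permRep k g v) :=
  ((permRep k).asModuleEquiv_symm_map_rho g v).symm

variable (ω : k) (a b d e f : k)

lemma eval_c_smul_permVec : eval ω c • permVec ![a, b, d, e, f] = permVec ![f, a, b, d, e] := by
  refine (of_smul_permVec cycle12345 _).trans (congrArg permVec (funext fun i => ?_))
  fin_cases i <;> rfl

lemma eval_c'_smul_permVec : eval ω c' • permVec ![a, b, d, e, f] = permVec ![b, d, e, f, a] := by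
  refine (of_smul_permVec cycle12345⁻¹ _).trans (congrArg permVec (funext fun i => ?_))
  fin_cases i <;> rfl

lemma eval_t_smul_permVec : eval ω t • permVec ![a, b, d, e, f] = permVec ![d, a, b, e, f] := by
  refine (of_smul_permVec cycle123 _).trans (congrArg permVec (funext fun i => ?_))
  fin_cases i <;> rfl

lemma eval_w_smul_permVec : eval ω w • permVec ![a, b, d, e, f] = permVec ![b, a, e, d, f] := by
  refine (of_smul_permVec swaps1234 _).trans (congrArg permVec (funext fun i => ?_))
  fin_cases i <;> rfl

lemma eval_n_smul_permVec : eval ω n • permVec ![a, b, d, e, f] = permVec ![a, d, b, f, e] := by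
  simp only [n, eval_mul, mul_smul, eval_c_smul_permVec, eval_w_smul_permVec, eval_c'_smul_permVec]

variable [CharP k 2]

lemma eval_sumA4_smul_permVec : eval ω sumA4 • permVec ![a, b, d, e, f] =
    permVec ![a + b + d + e, a + b + d + e, a + b + d + e, a + b + d + e, 0] := by
  have := CharTwo.two_eq_zero (R := k)
  simp only [sumA4, eps, sumKlein, eval_mul, eval_add, eval_one, mul_smul, add_smul, one_smul,
    eval_t_smul_permVec, eval_w_smul_permVec, permVec_add, Matrix.cons_val_zero,
    Matrix.cons_add_cons, Matrix.empty_add_empty]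
  refine congrArg permVec (funext fun i => ?_)
  fin_cases i <;> dsimp <;> grind

lemma eval_idem_three_smul_permVec :
    eval ω (idem 3) • permVec ![1, 0, 0, 1, 0] = permVec (k := k) ![0, 0, 0, 1, 1] := by
  have h : eval ω (idem 3) = (1 + eval ω n) * eval ω n * eval ω sumA4 * eval ω n := rfl
  simp [h, mul_smul, add_smul, permVec_add, eval_sumA4_smul_permVec, eval_n_smul_permVec,
    CharTwo.add_self_eq_zero]

variable {ω} (hω : ω ^ 2 + ω + 1 = 0)

include hω

lemma isTop_sumZero : (quiverFrame hω).IsTop 3 (sumZeroSubrep k).toRepresentation.asModule := by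
  let f : (sumZeroSubrep k).toRepresentation.asModule →ₗ[k[A5]] (permRep k).asModule :=
    linearMapOfCommutes _
      ((permRep k).asModuleEquiv.symm.toLinearMap ∘ₗ (sumZeroSubrep k).toSubmodule.subtype)
      fun g x => (of_smul_permVec g (x : Fin 5 → k)).symm
  let x : (sumZeroSubrep k).toRepresentation.asModule :=
    (sumZeroSubrep k).toRepresentation.asModuleEquiv.symm ⟨![1, 0, 0, 1, 0], by
      simp [sumZeroSubrep, Fin.sum_univ_succ, CharTwo.add_self_eq_zero]⟩
  have hx : f ((quiverFrame hω).e 3 • x) = permVec ![0, 0, 0, 1, 1] :=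
    (map_smul _ _ _).trans (eval_idem_three_smul_permVec ω)
  refine (quiverFrame hω).isTop_of_finrank_eq k (x := (quiverFrame hω).e 3 • x) (fun h => ?_) ?_ ?_
  · rw [h, map_zero] at hx
    exact zero_ne_one (congrFun hx 3)
  · rw [smul_smul, (quiverFrame hω).e_mul_e]
  · exact ((sumZeroSubrep k).toRepresentation.asModuleEquiv.finrank_eq).trans (finrank_sumZero k)

lemma isTop_trivial : (quiverFrame hω).IsTop 0 (Representation.trivial k A5 k).asModule := by
  have hfin : Module.finrank k (Representation.trivial k A5 k).asModule = 1 :=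
    (Representation.trivial k A5 k).asModuleEquiv.finrank_eq.trans (Module.finrank_self k)
  have : Nontrivial (Representation.trivial k A5 k).asModule :=
    Module.nontrivial_of_finrank_pos (R := k) (by omega)
  obtain ⟨i, x, hx, hi⟩ :=
    (quiverFrame hω).exists_homogeneous (M := (Representation.trivial k A5 k).asModule)
  have hdim := (quiverFrame hω).dim_le_finrank (k := k) hx hi
  obtain rfl : i = 0 := by
    have dim_le_one : ∀ i : Fin 4, IdempotentFrame.dim label i ≤ 1 → i = 0 := by decide
    exact dim_le_one i (hfin ▸ hdim)
  exact (quiverFrame hω).isTop_of_finrank_eq k hx hi hfin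

end SumZero

end AlgTerm

lemma linearIndependent_of_smul {k G ι : Type*} [Field k] [Group G] [Finite ι] [DecidableEq ι]
    {r : ι → G} {x : k[G]} (hx : ∀ i j, x.coeff ((r i)⁻¹ * r j) = if i = j then 1 else 0) :
    LinearIndependent k fun i => MonoidAlgebra.of k G (r i) • x := by
  cases nonempty_fintype ι
  refine Fintype.linearIndependent_iff.mpr fun a ha j => ?_
  have h := congrArg (fun y : k[G] => y.coeff (r j)) ha
  simpa [MonoidAlgebra.coeff_sum, Finsupp.finsetSum_apply, hx] using h

lemma exists_cycle12345_inv_mul_mem_A4 (g : A5) :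
    ∃ i : Fin 5, (cycle12345 ^ (i : ℕ))⁻¹ * g ∈ A4 := by
  have exists_pow_apply : ∀ j : Fin 5, ∃ i : Fin 5,
      ((cycle12345 ^ (i : ℕ))⁻¹ : A5).1 j = 4 := by decide
  exact exists_pow_apply (g.1 4)

section InducedModules

variable {k : Type*} [Field k] {χ : A4 →* k}

lemma of_smul_eq_character_smul {M : Type*} [AddCommGroup M] [Module k M] [Module k[A5] M]
    [IsScalarTower k k[A5] M] {m : M}
    (ht : MonoidAlgebra.of k A5 cycle123 • m = χ cycle123' • m)
    (hw : MonoidAlgebra.of k A5 swaps1234 • m = χ ⟨swaps1234, swaps1234_mem_A4⟩ • m) (h : A4) :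
    MonoidAlgebra.of k A5 h • m = χ h • m := by
  let N : Submonoid A5 :=
    { carrier := {g | ∃ hg : g ∈ A4, MonoidAlgebra.of k A5 g • m = χ ⟨g, hg⟩ • m}
      one_mem' := ⟨A4.one_mem, by
        rw [map_one, one_smul, show χ ⟨1, A4.one_mem⟩ = 1 from map_one χ, one_smul]⟩
      mul_mem' := by
        rintro g g' ⟨hg, hgm⟩ ⟨hg', hgm'⟩
        refine ⟨A4.mul_mem hg hg', ?_⟩
        rw [map_mul, mul_smul, hgm', smul_comm, hgm, smul_smul, mul_comm, ← map_mul]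
        rfl }
  obtain ⟨_, hh⟩ := mem_of_mem_A4 (N := N) ⟨cycle123'.2, ht⟩ ⟨swaps1234_mem_A4, hw⟩ h.2
  exact hh

variable [CharP k 2]

lemma character_swaps1234 (χ : A4 →* k) : χ ⟨swaps1234, swaps1234_mem_A4⟩ = 1 := by
  have hsq : χ ⟨swaps1234, swaps1234_mem_A4⟩ ^ 2 = 1 := by
    rw [← map_pow, ← map_one χ]
    exact congrArg χ (Subtype.ext (by decide))
  exact CharTwo.sq_injective (hsq.trans (one_pow 2).symm)

namespace AlgTerm

variable {ω : k} (hω : ω ^ 2 + ω + 1 = 0)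

include hω

lemma eval_t_smul_eps_mul_sumKlein (j : Fin 3) :
    eval ω t • eval ω (eps j * sumKlein) = ω ^ (j : ℕ) • eval ω (eps j * sumKlein) := by
  fin_cases j
  · rw [pow_zero, one_smul]
    exact eval_eq_of_apply_eq hω (p := t * (eps 0 * sumKlein)) (by decide +kernel)
  · rw [pow_one, ← eval_omega_mul]
    exact eval_eq_of_apply_eq hω (p := t * (eps 1 * sumKlein)) (by decide +kernel)
  · rw [sq, mul_smul, ← eval_omega_mul, ← eval_omega_mul]
    exact eval_eq_of_apply_eq hω (p := t * (eps 2 * sumKlein)) (by decide +kernel)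

lemma coeff_eps_mul_sumKlein (j : Fin 3) (i i' : Fin 5) :
    (eval ω (eps j * sumKlein)).coeff ((cycle12345 ^ (i : ℕ))⁻¹ * cycle12345 ^ (i' : ℕ)) =
      if i = i' then 1 else 0 := by
  have elt_eq : ∀ i i' : Fin 5, (cycle12345 ^ (i : ℕ))⁻¹ * cycle12345 ^ (i' : ℕ) =
      elt (Fin.ofNat 60 (12 * (i' - i : Fin 5))) := by
    decide
  have testBit_eq : ∀ (j : Fin 3) (d : Fin 5),
      (apply (eps j * sumKlein) 1).testBit (Fin.ofNat 60 (12 * d)) = decide (d = 0) ∧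
      (apply (eps j * sumKlein) 1).testBit (60 + Fin.ofNat 60 (12 * d)) = false := by
    decide +kernel
  rw [elt_eq, coeff_eval hω, coeff, (testBit_eq j _).1, (testBit_eq j _).2]
  simp only [sub_eq_zero, eq_comm]
  split_ifs <;> simp [*]

lemma exists_indCharacter_injective {j : Fin 3} (hχ : χ cycle123' = ω ^ (j : ℕ)) :
    ∃ f : IndCharacter χ →ₗ[k[A5]] k[A5], Function.Injective f ∧
      f (indGen χ) = eval ω (eps j * sumKlein) ∧ Module.finrank k (IndCharacter χ) = 5 := by
  have hw : MonoidAlgebra.of k A5 swaps1234 • eval ω (eps j * sumKlein) =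
      eval ω (eps j * sumKlein) :=
    eval_eq_of_apply_eq hω (p := w * (eps j * sumKlein)) (by clear hχ; revert j; decide +kernel)
  obtain ⟨f, hf⟩ := exists_linearMap_indGen_eq (of_smul_eq_character_smul (χ := χ)
    (hχ ▸ eval_t_smul_eps_mul_sumKlein hω j) (by rw [hw, character_swaps1234, one_smul]))
  have hli : LinearIndependent k fun i : Fin 5 =>
      MonoidAlgebra.of k A5 (cycle12345 ^ (i : ℕ)) • f (indGen χ) :=
    hf ▸ linearIndependent_of_smul (coeff_eps_mul_sumKlein hω j)
  have transversal := exists_cycle12345_inv_mul_mem_A4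
  exact ⟨f, injective_of_linearIndependent_smul_indGen transversal hli, hf,
    finrank_indCharacter transversal hli⟩

lemma finrank_indCharacter_eq_five {j : Fin 3} (hχ : χ cycle123' = ω ^ (j : ℕ)) :
    Module.finrank k (IndCharacter χ) = 5 :=
  let ⟨_, _, _, h⟩ := exists_indCharacter_injective hω hχ
  h

lemma exists_generator_of_apply {j : Fin 3} (hχ : χ cycle123' = ω ^ (j : ℕ)) {i : Fin 4}
    {p q : AlgTerm}
    (hi : apply (idem i * (p * (eps j * sumKlein))) 1 = apply (p * (eps j * sumKlein)) 1)
    (hq : apply (q * (p * (eps j * sumKlein))) 1 = apply (eps j * sumKlein) 1) :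
    ∃ x : IndCharacter χ, (quiverFrame hω).e i • x = x ∧ Submodule.span k[A5] {x} = ⊤ := by
  obtain ⟨f, hf, hgen, -⟩ := exists_indCharacter_injective hω hχ
  refine ⟨eval ω p • indGen χ, hf ?_, ?_⟩
  · rw [map_smul, map_smul, hgen]
    exact eval_eq_of_apply_eq hω hi
  · have indGen_eq : eval ω q • eval ω p • indGen χ = indGen χ := hf (by
      rw [map_smul, map_smul, hgen]
      exact eval_eq_of_apply_eq hω hq)
    rw [eq_top_iff, ← span_indGen χ, Submodule.span_singleton_le_iff_mem]
    exact Submodule.mem_span_singleton.mpr ⟨_, indGen_eq⟩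

lemma exists_generator_one (hχ : χ cycle123' = ω ^ 2) :
    ∃ x : IndCharacter χ, (quiverFrame hω).e 1 • x = x ∧ Submodule.span k[A5] {x} = ⊤ :=
  exists_generator_of_apply hω (j := 2) hχ (p := c') (q := c) (by decide +kernel)
    (by decide +kernel)

lemma exists_generator_two (hχ : χ cycle123' = ω) :
    ∃ x : IndCharacter χ, (quiverFrame hω).e 2 • x = x ∧ Submodule.span k[A5] {x} = ⊤ :=
  exists_generator_of_apply hω (j := 1) (hχ.trans (pow_one ω).symm) (p := idem 2)
    (q := 1 + c' + omega * t * c') (by decide +kernel) (by decide +kernel)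

end AlgTerm

end InducedModules

section FourReps

variable {k : Type*} [Field k]

lemma finrank_fourReps (ρ₂ ρ₃ : Representation k A5 (Fin 2 → k)) (i : Fin 4) :
    Module.finrank k (fourReps ρ₂ ρ₃ i).ρ.asModule = ![1, 2, 2, 4] i := by
  rw [(fourReps ρ₂ ρ₃ i).ρ.asModuleEquiv.finrank_eq]
  fin_cases i
  · exact Module.finrank_self k
  · exact Module.finrank_fin_fun k
  · exact Module.finrank_fin_fun k
  · exact AlgTerm.finrank_sumZero k

lemma IsProjectiveLineRep.exists_character_eq {η c : k} {ρ : Representation k A5 (Fin 2 → k)}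
    (hρ : IsProjectiveLineRep η ρ) (hc : ρ cycle123 (linePoint η 4) = c • linePoint η 4) :
    ∃ χ : A4 →* k, χ cycle123' = c := by
  obtain ⟨χ, hχ⟩ := hρ.exists_character
  exact ⟨χ, smul_left_injective k (linePoint_ne_zero _ 4) ((hχ cycle123').symm.trans hc)⟩

variable [CharP k 2] {ω : k} (hω : ω ^ 2 + ω + 1 = 0)

lemma exists_fourReps_isTop : ∃ ρ₂ ρ₃ : Representation k A5 (Fin 2 → k),
    IsProjectiveLineRep ω ρ₂ ∧ IsProjectiveLineRep (ω ^ 2) ρ₃ ∧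
      ∀ i, (AlgTerm.quiverFrame hω).IsTop i (fourReps ρ₂ ρ₃ i).ρ.asModule := by
  obtain ⟨ρ₂, hρ₂, -, htop₂⟩ := AlgTerm.exists_isProjectiveLineRep_one hω
  obtain ⟨ρ₃, hρ₃, -, htop₃⟩ := AlgTerm.exists_isProjectiveLineRep_two hω
  refine ⟨ρ₂, ρ₃, hρ₂, hρ₃, fun i => ?_⟩
  fin_cases i
  exacts [AlgTerm.isTop_trivial hω, htop₂, htop₃, AlgTerm.isTop_sumZero hω]

include hω in
lemma exists_character_eq_omega : ∃ χ : A4 →* k, χ cycle123' = ω :=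
  let ⟨_, hρ, hcycle, _⟩ := AlgTerm.exists_isProjectiveLineRep_two hω
  hρ.exists_character_eq hcycle

include hω in
lemma exists_character_eq_omega_sq : ∃ χ : A4 →* k, χ cycle123' = ω ^ 2 :=
  let ⟨_, hρ, hcycle, _⟩ := AlgTerm.exists_isProjectiveLineRep_one hω
  hρ.exists_character_eq hcycle

end FourReps

theorem mainTheorem3_general (k : Type u) [Field k] [CharP k 2]
    (ω : k) (hω : ω ^ 2 + ω + 1 = 0) :
    ∃ (ρ₂ ρ₃ : Representation k A5 (Fin 2 → k)) (τ₂ τ₃ : Representation k A4 k)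
      (S : Fin 4 → Rep k A5) (P : Fin 4 → Ideal k[A5]),
      (IsProjectiveLineRep ω ρ₂ ∧ IsProjectiveLineRep (ω ^ 2) ρ₃ ∧ S = fourReps ρ₂ ρ₃) ∧
      (τ₂ cycle123' = ω • LinearMap.id ∧ τ₃ cycle123' = ω ^ 2 • LinearMap.id) ∧
      ((∀ i, IsSimpleModule k[A5] (S i).ρ.asModule) ∧
        (∀ i, Module.finrank k (S i).ρ.asModule = ![1, 2, 2, 4] i) ∧
        (∀ i j, Nonempty ((S i).ρ.asModule ≃ₗ[k[A5]] (S j).ρ.asModule) → i = j) ∧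
        (∀ (M : Type v) [AddCommGroup M] [Module k[A5] M], IsSimpleModule k[A5] M →
          ∃ i, Nonempty (M ≃ₗ[k[A5]] (S i).ρ.asModule))) ∧
      ((∀ i, Module.Projective k[A5] (P i) ∧ IsIndecomposableModule k[A5] (P i)) ∧
        (∀ i, Nonempty (RadLayer k[A5] (P i) 0 ≃ₗ[k[A5]] (S i).ρ.asModule)) ∧
        (∀ i, Module.finrank k (P i) = ![12, 8, 8, 4] i) ∧
        (∀ i j, Nonempty (P i ≃ₗ[k[A5]] P j) → i = j) ∧
        (∀ (M : Type v) [AddCommGroup M] [Module k[A5] M], Module.Finite k[A5] M →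
          Module.Projective k[A5] M → IsIndecomposableModule k[A5] M →
          ∃ i, Nonempty (M ≃ₗ[k[A5]] P i))) ∧
      Nonempty (k[A5] ≃ₗ[k[A5]]
        (P 0 × (Fin 2 → P 1) × (Fin 2 → P 2) × (Fin 4 → P 3))) ∧
      Nonempty (P 3 ≃ₗ[k[A5]] (S 3).ρ.asModule) ∧
      (IsUniserialModule k[A5] (P 1) ∧ radSeries k[A5] (P 1) 5 = ⊥ ∧
        ∀ n : Fin 5, Nonempty (RadLayer k[A5] (P 1) n ≃ₗ[k[A5]]
          (S (![1, 0, 2, 0, 1] n)).ρ.asModule)) ∧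
      (IsUniserialModule k[A5] (P 2) ∧ radSeries k[A5] (P 2) 5 = ⊥ ∧
        ∀ n : Fin 5, Nonempty (RadLayer k[A5] (P 2) n ≃ₗ[k[A5]]
          (S (![2, 0, 1, 0, 2] n)).ρ.asModule)) ∧
      (IsUniserialModule k[A5] (IndA5 τ₂) ∧ radSeries k[A5] (IndA5 τ₂) 3 = ⊥ ∧
        ∀ n : Fin 3, Nonempty (RadLayer k[A5] (IndA5 τ₂) n ≃ₗ[k[A5]]
          (S (![2, 0, 1] n)).ρ.asModule)) ∧
      (IsUniserialModule k[A5] (IndA5 τ₃) ∧ radSeries k[A5] (IndA5 τ₃) 3 = ⊥ ∧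
        ∀ n : Fin 3, Nonempty (RadLayer k[A5] (IndA5 τ₃) n ≃ₗ[k[A5]]
          (S (![1, 0, 2] n)).ρ.asModule)) ∧
      (Nonempty (moduleSocle k[A5] (P 0) ≃ₗ[k[A5]] (S 0).ρ.asModule) ∧
        moduleSocle k[A5] (P 0) ≤ Module.jacobson k[A5] (P 0) ∧
        Nonempty (ModuleHeart k[A5] (P 0) ≃ₗ[k[A5]] IndA5 τ₂ × IndA5 τ₃) ∧
        radSeries k[A5] (P 0) 5 = ⊥ ∧
        Nonempty (RadLayer k[A5] (P 0) 1 ≃ₗ[k[A5]] (S 2).ρ.asModule × (S 1).ρ.asModule) ∧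
        Nonempty (RadLayer k[A5] (P 0) 2 ≃ₗ[k[A5]] (S 0).ρ.asModule × (S 0).ρ.asModule) ∧
        Nonempty (RadLayer k[A5] (P 0) 3 ≃ₗ[k[A5]] (S 1).ρ.asModule × (S 2).ρ.asModule) ∧
        Nonempty (RadLayer k[A5] (P 0) 4 ≃ₗ[k[A5]] (S 0).ρ.asModule)) ∧
      (∀ i j, HasMultiplicity k[A5] (P j) (S i).ρ.asModule (cartanA5 i j)) ∧
      ((blocks k[A5]).ncard = 2 ∧
        ∃ e₁ e₂ : k[A5], IsBlockIdempotent e₁ ∧ IsBlockIdempotent e₂ ∧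
          e₁ * e₂ = 0 ∧ e₁ + e₂ = 1 ∧
          blocks k[A5] = {Ideal.span {e₁}, Ideal.span {e₂}} ∧
          IsCompl (Ideal.span {e₁}) (Ideal.span {e₂}) ∧
          (∀ i, i ≠ 3 → ∀ x ∈ P i, e₁ * x = x) ∧ (∀ x ∈ P 3, e₂ * x = x) ∧
          (∀ x : (S 0).ρ.asModule, e₁ • x = x) ∧
          ∀ (n : ℕ) (f : Fin n → k[A5]), CompleteOrthogonalIdempotents f →
            (∀ t, IsPrimitiveIdempotent (f t)) →
            e₁ = ∑ᶠ (t) (_ : ∃ i, i ≠ 3 ∧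
              Nonempty (Ideal.span {f t} ≃ₗ[k[A5]] P i)), f t ∧
            e₂ = ∑ᶠ (t) (_ : Nonempty (Ideal.span {f t} ≃ₗ[k[A5]] P 3)), f t) := by
  have hA := finrank_monoidAlgebra_A5 k
  obtain ⟨ρ₂, ρ₃, hρ₂, hρ₃, hS⟩ := exists_fourReps_isTop hω
  obtain ⟨χ₂, hχ₂⟩ := exists_character_eq_omega hω
  obtain ⟨χ₃, hχ₃⟩ := exists_character_eq_omega_sq hω
  obtain ⟨x₂, hx₂, hspan₂⟩ := AlgTerm.exists_generator_two hω hχ₂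
  obtain ⟨x₃, hx₃, hspan₃⟩ := AlgTerm.exists_generator_one hω hχ₃
  have dim₂ := AlgTerm.finrank_indCharacter_eq_five hω (j := 1) (by simpa using hχ₂)
  have dim₃ := AlgTerm.finrank_indCharacter_eq_five hω (j := 2) hχ₃
  generalize AlgTerm.quiverFrame hω = Q at hS hx₂ hx₃
  have hQ : Q.IsSplit k := Q.isSplit hA
  obtain ⟨simple, distinct, complete⟩ := Q.simples_classification hA hS
  exact ⟨ρ₂, ρ₃, characterRep χ₂, characterRep χ₃, fourReps ρ₂ ρ₃, Q.proj, ⟨hρ₂, hρ₃, rfl⟩,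
    ⟨congrArg (· • LinearMap.id) hχ₂, congrArg (· • LinearMap.id) hχ₃⟩,
    ⟨simple, finrank_fourReps ρ₂ ρ₃, distinct, complete⟩,
    Q.projectives_classification hA hS, Q.nonempty_regular_equiv hA,
    hQ.nonempty_equiv (Q.isTop_proj_three hA) (hS 3),
    hQ.uniserial_layers_equiv hS (Q.uniserial_proj_one hA),
    hQ.uniserial_layers_equiv hS (Q.uniserial_proj_two hA),
    hQ.uniserial_layers_equiv hS (Q.uniserial_of_e_two hA hx₂ hspan₂ dim₂),
    hQ.uniserial_layers_equiv hS (Q.uniserial_of_e_one hA hx₃ hspan₃ dim₃),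
    ⟨Q.nonempty_moduleSocle_proj_zero_equiv hA hS, Q.moduleSocle_le_jacobson hA,
      Q.nonempty_moduleHeart_equiv_of_generated hA hx₂ hspan₂ dim₂ hx₃ hspan₃ dim₃,
      Q.nonempty_radLayer_proj_zero_equiv_simples hA hS⟩,
    Q.hasMultiplicity_proj hA hS, Q.blocks_classification hA (hS 0)⟩

theorem mainTheorem3 (k : Type u) [Field k] [IsAlgClosed k] [CharP k 2]
    (ω : k) (hω : ω ^ 2 + ω + 1 = 0) :
    ∃ (ρ₂ ρ₃ : Representation k A5 (Fin 2 → k)) (τ₂ τ₃ : Representation k A4 k)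
      (S : Fin 4 → Rep k A5) (P : Fin 4 → Ideal k[A5]),
      -- the representations that define `S₁, S₂, S₃, S₄` and `T₂, T₃`
      (IsProjectiveLineRep ω ρ₂ ∧ IsProjectiveLineRep (ω ^ 2) ρ₃ ∧ S = fourReps ρ₂ ρ₃) ∧
      (τ₂ cycle123' = ω • LinearMap.id ∧ τ₃ cycle123' = ω ^ 2 • LinearMap.id) ∧
      -- `S₁, S₂, S₃, S₄` are the simple modules, each up to isomorphism exactly once
      ((∀ i, IsSimpleModule k[A5] (S i).ρ.asModule) ∧
        (∀ i, Module.finrank k (S i).ρ.asModule = ![1, 2, 2, 4] i) ∧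
        (∀ i j, Nonempty ((S i).ρ.asModule ≃ₗ[k[A5]] (S j).ρ.asModule) → i = j) ∧
        (∀ (M : Type v) [AddCommGroup M] [Module k[A5] M], IsSimpleModule k[A5] M →
          ∃ i, Nonempty (M ≃ₗ[k[A5]] (S i).ρ.asModule))) ∧
      -- `P₁, P₂, P₃, P₄` are the projective indecomposables, each exactly once; `Pᵢ` has head `Sᵢ`
      ((∀ i, Module.Projective k[A5] (P i) ∧ IsIndecomposableModule k[A5] (P i)) ∧
        (∀ i, Nonempty (RadLayer k[A5] (P i) 0 ≃ₗ[k[A5]] (S i).ρ.asModule)) ∧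
        (∀ i, Module.finrank k (P i) = ![12, 8, 8, 4] i) ∧
        (∀ i j, Nonempty (P i ≃ₗ[k[A5]] P j) → i = j) ∧
        (∀ (M : Type v) [AddCommGroup M] [Module k[A5] M], Module.Finite k[A5] M →
          Module.Projective k[A5] M → IsIndecomposableModule k[A5] M →
          ∃ i, Nonempty (M ≃ₗ[k[A5]] P i))) ∧
      -- the decomposition of the regular module
      Nonempty (k[A5] ≃ₗ[k[A5]]
        (P 0 × (Fin 2 → P 1) × (Fin 2 → P 2) × (Fin 4 → P 3))) ∧
      -- `P₄ = S₄`
      Nonempty (P 3 ≃ₗ[k[A5]] (S 3).ρ.asModule) ∧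
      -- `P₂` is uniserial with layers `S₂, S₁, S₃, S₁, S₂`
      (IsUniserialModule k[A5] (P 1) ∧ radSeries k[A5] (P 1) 5 = ⊥ ∧
        ∀ n : Fin 5, Nonempty (RadLayer k[A5] (P 1) n ≃ₗ[k[A5]]
          (S (![1, 0, 2, 0, 1] n)).ρ.asModule)) ∧
      -- `P₃` is uniserial with layers `S₃, S₁, S₂, S₁, S₃`
      (IsUniserialModule k[A5] (P 2) ∧ radSeries k[A5] (P 2) 5 = ⊥ ∧
        ∀ n : Fin 5, Nonempty (RadLayer k[A5] (P 2) n ≃ₗ[k[A5]]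
          (S (![2, 0, 1, 0, 2] n)).ρ.asModule)) ∧
      -- the modules induced from `T₂` and `T₃`
      (IsUniserialModule k[A5] (IndA5 τ₂) ∧ radSeries k[A5] (IndA5 τ₂) 3 = ⊥ ∧
        ∀ n : Fin 3, Nonempty (RadLayer k[A5] (IndA5 τ₂) n ≃ₗ[k[A5]]
          (S (![2, 0, 1] n)).ρ.asModule)) ∧
      (IsUniserialModule k[A5] (IndA5 τ₃) ∧ radSeries k[A5] (IndA5 τ₃) 3 = ⊥ ∧
        ∀ n : Fin 3, Nonempty (RadLayer k[A5] (IndA5 τ₃) n ≃ₗ[k[A5]]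
          (S (![1, 0, 2] n)).ρ.asModule)) ∧
      -- `P₁`: its socle, `rad P₁ / soc P₁`, and its radical layers
      (Nonempty (moduleSocle k[A5] (P 0) ≃ₗ[k[A5]] (S 0).ρ.asModule) ∧
        moduleSocle k[A5] (P 0) ≤ Module.jacobson k[A5] (P 0) ∧
        Nonempty (ModuleHeart k[A5] (P 0) ≃ₗ[k[A5]] IndA5 τ₂ × IndA5 τ₃) ∧
        radSeries k[A5] (P 0) 5 = ⊥ ∧
        Nonempty (RadLayer k[A5] (P 0) 1 ≃ₗ[k[A5]] (S 2).ρ.asModule × (S 1).ρ.asModule) ∧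
        Nonempty (RadLayer k[A5] (P 0) 2 ≃ₗ[k[A5]] (S 0).ρ.asModule × (S 0).ρ.asModule) ∧
        Nonempty (RadLayer k[A5] (P 0) 3 ≃ₗ[k[A5]] (S 1).ρ.asModule × (S 2).ρ.asModule) ∧
        Nonempty (RadLayer k[A5] (P 0) 4 ≃ₗ[k[A5]] (S 0).ρ.asModule)) ∧
      -- the Cartan matrix
      (∀ i j, HasMultiplicity k[A5] (P j) (S i).ρ.asModule (cartanA5 i j)) ∧
      -- the two blocks
      ((blocks k[A5]).ncard = 2 ∧
        ∃ e₁ e₂ : k[A5], IsBlockIdempotent e₁ ∧ IsBlockIdempotent e₂ ∧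
          e₁ * e₂ = 0 ∧ e₁ + e₂ = 1 ∧
          blocks k[A5] = {Ideal.span {e₁}, Ideal.span {e₂}} ∧
          IsCompl (Ideal.span {e₁}) (Ideal.span {e₂}) ∧
          (∀ i, i ≠ 3 → ∀ x ∈ P i, e₁ * x = x) ∧ (∀ x ∈ P 3, e₂ * x = x) ∧
          (∀ x : (S 0).ρ.asModule, e₁ • x = x) ∧
          ∀ (n : ℕ) (f : Fin n → k[A5]), CompleteOrthogonalIdempotents f →
            (∀ t, IsPrimitiveIdempotent (f t)) →
            e₁ = ∑ᶠ (t) (_ : ∃ i, i ≠ 3 ∧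
              Nonempty (Ideal.span {f t} ≃ₗ[k[A5]] P i)), f t ∧
            e₂ = ∑ᶠ (t) (_ : Nonempty (Ideal.span {f t} ≃ₗ[k[A5]] P 3)), f t) :=
  mainTheorem3_general k ω hω
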